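/- Let $(X_{i,j})_{i\ge j}$ be i.i.d. complex random variables with variance $1$, let $X(n)$ be the lower triangular $n\times n$ matrix with entries $X_{i,j}$, $1\le j\le i\le n$, and let $L_n=\frac1n\sum_{i=1}^n\delta_{\lambda^{(n)}_i}$ be the empirical distribution of the eigenvalues $\lambda_1^{(n)},\dots,\lambda_n^{(n)}$ (with multiplicity) of $\frac1n X(n)X(n)^*$. Let $\mu_0$ be the deterministic probability measure on $\mathbb R$ to which $L_n$ converges weakly with probability $1$. Let $W$ be the principal branch of the Lambert function, that is, the principal branch of the inverse of $w\mapsto we^w$. Then: 1. $\mu_0$ has a density $f_0\ge 0$ with respect to Lebesgue measure which is continuous on $\mathbb R\setminus\{0\}$ and has support (the closure of $\{f_0\ne0\}$) equal to $[0,e]$. 2. The Stieltjes transform $S(z)=\int_{\mathbb R}\frac{d\mu_0(x)}{x-z}$ satisfies $$S(z)=-1-\frac{1}{z\,W(-z^{-1})}=-1+e^{W(-z^{-1})}\qquad\text{for all } z\in\mathbb C \text{ with } \operatorname{Im} z>0 .$$ 3. The measure $\mu_0$ has compact support, and its $R$-transform $R$ (the function analytic near $0$ such that $K(z)=R(z)+\frac1z$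 satisfies $S(K(z))=-z$ for all sufficiently small $z\neq 0$) extends analytically to the disc $|z|<1$, where $$R(z)=-\frac{1}{(1-z)\log(1-z)}-\frac1z ,$$ with the principal logarithm; at $z=0$ the right-hand side is understood by its removable singularity. -/

import Mathlib

open MeasureTheory ProbabilityTheory Filter Topology

noncomputable section

/-- The entries `X i j`, `j ≤ i`, are i.i.d. complex random variables with variance `1`
(the values `X i j` with `i < j` play no role; rows and columns are numbered from `0`). -/
structure IsTriangularIIDArray {Ω : Type*} [MeasurableSpace Ω] (P : Measure Ω)
    (X : ℕ → ℕ → Ω → ℂ) : Prop where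
  measurable : ∀ i j, j ≤ i → Measurable (X i j)
  indep : iIndepFun (fun p : {p : ℕ × ℕ // p.2 ≤ p.1} => X p.1.1 p.1.2) P
  identDistrib : ∀ i j, j ≤ i → IdentDistrib (X i j) (X 0 0) P P
  memLp : MemLp (X 0 0) 2 P
  variance_eq_one : ∫ ω, ‖X 0 0 ω - ∫ ω', X 0 0 ω' ∂P‖ ^ 2 ∂P = 1

/-- The lower triangular `n × n` matrix with entries `X i j ω` for `j ≤ i`. -/
def triangularMatrix {Ω : Type*} (X : ℕ → ℕ → Ω → ℂ) (n : ℕ) (ω : Ω) :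
    Matrix (Fin n) (Fin n) ℂ :=
  Matrix.of fun i j => if j ≤ i then X i j ω else 0

/-- The Hermitian matrix `S_n = (1/n) X(n) X(n)^*`. -/
def sampleMatrix {Ω : Type*} (X : ℕ → ℕ → Ω → ℂ) (n : ℕ) (ω : Ω) :
    Matrix (Fin n) (Fin n) ℂ :=
  ((1 / (n : ℝ) : ℝ) : ℂ) •
    (triangularMatrix X n ω * (triangularMatrix X n ω).conjTranspose)

theorem sampleMatrix_isHermitian {Ω : Type*} (X : ℕ → ℕ → Ω → ℂ) (n : ℕ) (ω : Ω) :
    (sampleMatrix X n ω).IsHermitian := by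
  unfold sampleMatrix Matrix.IsHermitian
  rw [Matrix.conjTranspose_smul, Matrix.conjTranspose_mul, Matrix.conjTranspose_conjTranspose]
  congr 1
  exact Complex.conj_ofReal _

/-- The empirical distribution `L_n = (1/n) ∑ δ_{λ_i}` of the eigenvalues of `S_n`
(counted with multiplicity). -/
def empiricalDistribution {Ω : Type*} (X : ℕ → ℕ → Ω → ℂ) (n : ℕ) [NeZero n] (ω : Ω) :
    ProbabilityMeasure ℝ :=
  ⟨(n : ENNReal)⁻¹ •
      ∑ i : Fin n, Measure.dirac ((sampleMatrix_isHermitian X n ω).eigenvalues i), ⟨by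
    simp only [Measure.smul_apply, Measure.coe_finsetSum, Finset.sum_apply, measure_univ,
      Finset.sum_const, Finset.card_univ, Fintype.card_fin, nsmul_eq_mul, mul_one, smul_eq_mul]
    exact ENNReal.inv_mul_cancel (by exact_mod_cast NeZero.ne n) (ENNReal.natCast_ne_top n)⟩⟩

/-- The range of the principal branch of the Lambert function. For `|η| < π` one has `sinc η > 0`,
so the open condition on `w = ξ + iη` reads `ξ > -η cot η` (and `ξ > -1` when `η = 0`). The part
`ξ = -η cot η`, `0 ≤ η < π` of the boundary carries the values on the cut `(-∞, -1/e]`, where the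
branch is extended continuously from the upper half plane. -/
def lambertRange : Set ℂ :=
  {w | |w.im| < Real.pi ∧
    (0 < w.re * Real.sinc w.im + Real.cos w.im ∨
      (0 ≤ w.im ∧ w.re * Real.sinc w.im + Real.cos w.im = 0))}

/-- The principal branch `W` of the Lambert function: the inverse of `w ↦ w e^w` on
`lambertRange`, which that map carries bijectively onto `ℂ`. -/
def lambertW (z : ℂ) : ℂ :=
  Function.invFunOn (fun w : ℂ => w * Complex.exp w) lambertRange z

/-- The Stieltjes transform `S(z) = ∫ (x - z)⁻¹ dμ(x)`. -/
def stieltjesTransform (μ : Measure ℝ) (z : ℂ) : ℂ :=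
  ∫ x : ℝ, ((x : ℂ) - z)⁻¹ ∂μ

/-- `R`, on the open disc of radius `r` about `0`, is the R-transform of the compactly supported
measure `μ`: it is analytic on the disc and, for small `z ≠ 0`, the function `K z = R z + 1 / z`
satisfies `S (K z) = -z`. As `S` is injective near `∞`, this determines `R` near `0`, hence
(by analytic continuation) on the disc. -/
structure IsRTransformOnBall (μ : Measure ℝ) (R : ℂ → ℂ) (r : ℝ) : Prop where
  isCompact_support : IsCompact μ.support
  analyticOnNhd : AnalyticOnNhd ℂ R (Metric.ball 0 r)
  stieltjes_eq : ∀ᶠ z in 𝓝[≠] (0 : ℂ), stieltjesTransform μ (R z + 1 / z) = -z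

end

/-!
Write `S` for the Stieltjes transform of `μ₀`, `C = 1 + S`, and, for `r > 0`,
`c(r) = C(-1 / r) = 1 + ∫ r / (1 + r x) dμ₀`. Everything follows from the equation
`C(z) log C(z) = -1 / z`.

*The equation on the half line.* Let `u = n / r`. Adding a row to the triangular matrix multiplies
`det (X(k)^* X(k) + u)` by `u (1 + Q_k)`, where `Q_k` is a quadratic form of the new row in the
resolvent of the previous ones (`det_gram_triangularMatrix`). That row is independent of the
resolvent, so `Q_k` is close to the trace of the resolvent, which is the Stieltjes transform of the
empirical distribution of the `k`-th matrix at `-u / k`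
(`exists_lintegral_rowForm_sub_gramTrace_le`). Only two moments are available: the diagonal terms
are handled by truncation. The entries need not be centred, and the quadratic form of the constant
mean vector is controlled because averages of the last rows of the triangular matrix approximate
that vector. Taking logarithms and letting `n → ∞` gives
`∫ log ((1 + r x) / (1 + r' x)) dμ₀ = M(r) - M(r')` with `M(r) = r⁻¹ ∫₀^r log c`
(`integral_logRatio_eq`; passing to ratios avoids any tail estimate for `log`). Differentiating twice turns this into `(log c - r / c)' = 0`, that is
`c log c = r` (`one_add_stieltjesInv_mul_log`).

*The Stieltjes transform.* The equation extends by analytic continuation to `ℂ` cut along `[0, ∞)`.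
For `Im z > 0` the number `w = log C(z)` therefore satisfies `w e ^ w = -1 / z` and `0 < Im w < π`,
so it lies in the part `lambertUpper` of the range of `W` over the closed upper half plane. There
`w ↦ w e ^ w` is injective and proper, so `w = W(-1 / z)`, and `W` is continuous up to the real
axis (`lambertW_mul_exp`, `continuousOn_lambertW`).

*The density.* Stieltjes inversion gives the density `Im exp (W(-1 / x)) / π`, which vanishes
exactly where `w e ^ w = -1 / x` has a real solution `w ≥ -1`, that is off `(0, e)`. The inversion
is tested against functions weighted by `min (|x|, 1)`, since `S` blows up at `0`; the equation
also excludes an atom at `0` (`eq_withDensity_lambertDensity`, `measure_singleton_zero`).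

*The R-transform.* For `K(z) = -1 / ((1 - z) log (1 - z))` with `z < 0` the equation says that
`C(K(z))` and `1 - z` have the same value of `c log c`, so `S(K(z)) = -z`; both sides are analytic
in `z` at `0` (`eventually_stieltjesTransform_eq_neg`).
-/

/-! ### Injectivity and continuity of the Lambert function on the closed upper half plane -/

/-- The part of `lambertRange` in the closed upper half plane. The bound `w.im ≤ π` makes it visibly
closed; the last condition fails for `w.im = π`. -/
def lambertUpper : Set ℂ :=
  {w | 0 ≤ w.im ∧ w.im ≤ Real.pi ∧ 0 ≤ w.re * Real.sinc w.im + Real.cos w.im}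

theorem lambertUpper_im_lt_pi {w : ℂ} (hw : w ∈ lambertUpper) : w.im < Real.pi := by
  obtain ⟨_, h1, h2⟩ := hw
  rcases h1.lt_or_eq with h | h
  · exact h
  · rw [h, Real.sinc_of_ne_zero Real.pi_ne_zero] at h2
    norm_num at h2

theorem lambertUpper_subset_lambertRange : lambertUpper ⊆ lambertRange := by
  intro w hw
  have hlt := lambertUpper_im_lt_pi hw
  obtain ⟨h0, -, h2⟩ := hw
  refine ⟨by rwa [abs_of_nonneg h0], ?_⟩
  rcases h2.lt_or_eq with h | h
  · exact Or.inl h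
  · exact Or.inr ⟨h0, h.symm⟩

theorem isClosed_lambertUpper : IsClosed lambertUpper := by
  have hc : Continuous fun w : ℂ => w.re * Real.sinc w.im + Real.cos w.im :=
    (Complex.continuous_re.mul (Real.continuous_sinc.comp Complex.continuous_im)).add
      (Real.continuous_cos.comp Complex.continuous_im)
  exact (isClosed_le continuous_const Complex.continuous_im).inter
    ((isClosed_le Complex.continuous_im continuous_const).inter
      (isClosed_le continuous_const hc))

theorem im_mul_exp (w : ℂ) :
    (w * Complex.exp w).im
      = Real.exp w.re * w.im * (w.re * Real.sinc w.im + Real.cos w.im) := by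
  rw [Complex.mul_im, Complex.exp_re, Complex.exp_im]
  by_cases h : w.im = 0
  · simp [h]
  · rw [Real.sinc_of_ne_zero h]
    field_simp

theorem one_sub_mul_exp_lt_one {p : ℝ} (hp : p ≠ 0) : (1 - p) * Real.exp p < 1 := by
  have h := Real.add_one_lt_exp (neg_ne_zero.mpr hp)
  rw [Real.exp_neg] at h
  have hE := Real.exp_pos p
  have := mul_lt_mul_of_pos_right h hE
  rw [inv_mul_cancel₀ hE.ne'] at this
  linarith

theorem mul_cos_le_sin {r : ℝ} (h0 : 0 < r) (h1 : r < Real.pi) : r * Real.cos r ≤ Real.sin r := by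
  have hs := Real.sin_pos_of_pos_of_lt_pi h0 h1
  rcases le_or_gt (Real.cos r) 0 with hc | hc
  · nlinarith
  · have h2 : r < Real.pi / 2 := by
      by_contra! h
      exact absurd (Real.cos_nonpos_of_pi_div_two_le_of_le h (by linarith)) (not_le.mpr hc)
    have := Real.lt_tan h0 h2
    rw [Real.tan_eq_sin_div_cos, lt_div_iff₀ hc] at this
    exact this.le

/-- Two points of the strip `0 ≤ Im w < π` with the same image under `w ↦ w e ^ w` coincide or are
both real. With `w₁ - w₂ = p + q i` one has `w₁ (1 - e ^ (p + q i)) = p + q i`, and for `q ≠ 0` the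
imaginary parts of `w₁` and `w₂` computed from this have a forbidden sign. -/
theorem eq_or_real_of_mul_exp_eq {w₁ w₂ : ℂ} (h₁ : 0 ≤ w₁.im) (h₁' : w₁.im < Real.pi)
    (h₂ : 0 ≤ w₂.im) (h₂' : w₂.im < Real.pi) (hp : w₂.re ≤ w₁.re)
    (h : w₁ * Complex.exp w₁ = w₂ * Complex.exp w₂) :
    w₁ = w₂ ∨ (w₁.im = 0 ∧ w₂.im = 0) := by
  set p := w₁.re - w₂.re with hpdef
  set q := w₁.im - w₂.im with hqdef
  have hp0 : 0 ≤ p := by linarith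
  have key : w₁ * Complex.exp (w₁ - w₂) = w₂ := by
    rw [Complex.exp_sub, mul_div_assoc', h, mul_div_assoc, div_self (Complex.exp_ne_zero _),
      mul_one]
  have hre := congrArg Complex.re key
  have him := congrArg Complex.im key
  rw [Complex.mul_re, Complex.exp_re, Complex.exp_im, Complex.sub_re, Complex.sub_im] at hre
  rw [Complex.mul_im, Complex.exp_re, Complex.exp_im, Complex.sub_re, Complex.sub_im] at him
  rw [← hpdef, ← hqdef] at hre him
  set E := Real.exp p
  set C := Real.cos q with hC
  set S := Real.sin q with hS
  have hE : 1 + p ≤ E := by linarith [Real.add_one_le_exp p]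
  have hE0 : 0 < E := Real.exp_pos p
  have hCS : S ^ 2 + C ^ 2 = 1 := Real.sin_sq_add_cos_sq q
  set N := (1 - E * C) ^ 2 + (E * S) ^ 2 with hN
  have hN0 : 0 ≤ N := by positivity
  have e1 : w₁.im * N = q * (1 - E * C) + p * E * S := by
    rw [hN, hpdef, hqdef]
    linear_combination (-(E * S)) * hre - (1 - E * C) * him
  have e2 : w₂.im * N = E * (p * S + q * (C - E)) := by
    have : w₂.im = w₁.im - q := by rw [hqdef]; ring
    rw [this, sub_mul, e1, hN]
    linear_combination (-(q * E ^ 2)) * hCS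
  have n1 : 0 ≤ w₁.im * N := mul_nonneg h₁ hN0
  have n2 : 0 ≤ w₂.im * N := mul_nonneg h₂ hN0
  rcases lt_trichotomy q 0 with hq | hq | hq
  · exfalso
    have hr : 0 < -q := by linarith
    have hr' : -q < Real.pi := by linarith
    have hsp := Real.sin_pos_of_pos_of_lt_pi hr hr'
    have hsc := mul_cos_le_sin hr hr'
    have hC1 : C < 1 := by
      rw [hC, ← Real.cos_neg, ← Real.cos_zero]
      exact Real.cos_lt_cos_of_nonneg_of_le_pi le_rfl hr'.le hr
    rw [Real.sin_neg, ← hS] at hsp hsc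
    rw [Real.cos_neg, ← hC] at hsc
    rw [e1] at n1
    rcases le_or_gt C 0 with hc | hc
    · have a1 : 0 ≤ q * (E * C) := mul_nonneg_of_nonpos_of_nonpos hq.le (by nlinarith)
      have a2 : p * E * S ≤ 0 := mul_nonpos_of_nonneg_of_nonpos (by positivity) (by linarith)
      nlinarith
    · have a3 : p * E * S ≤ p * E * (q * C) :=
        mul_le_mul_of_nonneg_left (by linarith) (by positivity)
      have a4 : (1 - p) * E ≤ 1 := by
        rcases eq_or_ne p 0 with h0 | h0
        · simp only [E, h0]; simp
        · exact (one_sub_mul_exp_lt_one h0).le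
      have a5 : (1 - p) * E * C < 1 := by nlinarith
      nlinarith
  · have hS0 : S = 0 := by rw [hS, hq, Real.sin_zero]
    have hC1 : C = 1 := by rw [hC, hq, Real.cos_zero]
    rw [hq, hS0] at e1
    have : w₁.im * N = 0 := by rw [e1]; ring
    rcases mul_eq_zero.mp this with h0 | h0
    · exact Or.inr ⟨h0, by linarith⟩
    · left
      rw [hN, hS0, hC1] at h0
      have hE1 : E = 1 := by nlinarith
      exact Complex.ext (by linarith) (by linarith)
  · exfalso
    have hq' : q < Real.pi := by linarith
    have hsp := Real.sin_pos_of_pos_of_lt_pi hq hq'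
    have hsl := Real.sin_le hq.le
    have hC1 : C < 1 := by
      rw [hC, ← Real.cos_zero]
      exact Real.cos_lt_cos_of_nonneg_of_le_pi le_rfl hq'.le hq
    rw [e2] at n2
    have : 0 ≤ p * S + q * (C - E) := by
      by_contra! hneg
      exact absurd n2 (not_le.mpr (mul_neg_of_pos_of_neg hE0 hneg))
    have a1 : p * S ≤ p * q := mul_le_mul_of_nonneg_left hsl hp0
    nlinarith

theorem neg_one_le_re_of_mem_lambertUpper {w : ℂ} (hw : w ∈ lambertUpper) : -1 ≤ w.re := by
  have hlt := lambertUpper_im_lt_pi hw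
  obtain ⟨h0, h1, h2⟩ := hw
  rcases h0.eq_or_lt with h | h
  · rw [← h] at h2; simp at h2; linarith
  · rw [Real.sinc_of_ne_zero h.ne'] at h2
    have hs := Real.sin_pos_of_pos_of_lt_pi h hlt
    have hc := mul_cos_le_sin h hlt
    have : 0 ≤ w.re * Real.sin w.im + w.im * Real.cos w.im := by
      have := mul_nonneg h.le h2
      rwa [mul_add, mul_left_comm, mul_div_cancel₀ _ h.ne'] at this
    nlinarith

theorem injOn_mul_exp_lambertUpper :
    Set.InjOn (fun w : ℂ => w * Complex.exp w) lambertUpper := by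
  have aux : ∀ w₁ ∈ lambertUpper, ∀ w₂ ∈ lambertUpper, w₂.re ≤ w₁.re →
      w₁ * Complex.exp w₁ = w₂ * Complex.exp w₂ → w₁ = w₂ := by
    intro w₁ h₁ w₂ h₂ hle h
    rcases eq_or_real_of_mul_exp_eq h₁.1 (lambertUpper_im_lt_pi h₁) h₂.1
      (lambertUpper_im_lt_pi h₂) hle h with h' | ⟨h3, h4⟩
    · exact h'
    · refine Complex.ext ?_ (by rw [h3, h4])
      by_contra hne
      have hre := congrArg Complex.re h
      simp only [Complex.mul_re, Complex.exp_re, Complex.exp_im, h3, h4, Real.cos_zero,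
        Real.sin_zero, mul_zero, mul_one, sub_zero] at hre
      have h5 := neg_one_le_re_of_mem_lambertUpper h₂
      have h6 := one_sub_mul_exp_lt_one (p := w₁.re - w₂.re) (sub_ne_zero.mpr hne)
      have h7 : Real.exp w₁.re = Real.exp (w₁.re - w₂.re) * Real.exp w₂.re := by
        rw [← Real.exp_add]; ring_nf
      rw [h7, ← mul_assoc] at hre
      have h8 := mul_right_cancel₀ (Real.exp_ne_zero _) hre
      have h9 : 1 < Real.exp (w₁.re - w₂.re) := by
        rw [Real.one_lt_exp_iff]
        exact sub_pos.mpr (lt_of_le_of_ne hle (Ne.symm hne))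
      nlinarith
  intro w₁ h₁ w₂ h₂ h
  rcases le_total w₂.re w₁.re with hle | hle
  · exact aux w₁ h₁ w₂ h₂ hle h
  · exact (aux w₂ h₂ w₁ h₁ hle h.symm).symm

/-- A point of `lambertRange` that `w ↦ w e ^ w` carries to the closed upper half plane lies in
`lambertUpper`, because the sign of `Im (w e ^ w)` is that of
`Im w * (Re w * sinc (Im w) + cos (Im w))`. -/
theorem mem_lambertUpper_of_mem_lambertRange {w : ℂ} (hw : w ∈ lambertRange)
    (h : 0 ≤ (w * Complex.exp w).im) : w ∈ lambertUpper := by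
  obtain ⟨h1, h2⟩ := hw
  rw [im_mul_exp] at h
  have h0 : 0 ≤ w.im := by
    rcases h2 with h2 | h2
    · by_contra! hneg
      have : Real.exp w.re * w.im < 0 := mul_neg_of_pos_of_neg (Real.exp_pos _) hneg
      exact absurd h (not_le.mpr (mul_neg_of_neg_of_pos this h2))
    · exact h2.1
  refine ⟨h0, (abs_lt.mp h1).2.le, ?_⟩
  rcases h2 with h2 | h2
  · exact h2.le
  · exact h2.2.ge

theorem lambertW_mul_exp {w : ℂ} (hw : w ∈ lambertUpper) :
    lambertW (w * Complex.exp w) = w := by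
  have him : 0 ≤ (w * Complex.exp w).im := by
    rw [im_mul_exp]
    exact mul_nonneg (mul_nonneg (Real.exp_pos _).le hw.1) hw.2.2
  have hex : ∃ a ∈ lambertRange,
      (fun w : ℂ => w * Complex.exp w) a = w * Complex.exp w :=
    ⟨w, lambertUpper_subset_lambertRange hw, rfl⟩
  have h1 := Function.invFunOn_mem hex
  have h2 := Function.invFunOn_eq hex
  refine injOn_mul_exp_lambertUpper (mem_lambertUpper_of_mem_lambertRange h1 ?_) hw h2
  exact (congrArg Complex.im h2).symm ▸ him

/-- `lambertW` is continuous on the image of `lambertUpper`: on that closed set `w ↦ w e ^ w` is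
injective, continuous and proper (as `Re w ≥ -1` and `Im w` is bounded there). -/
theorem continuousOn_lambertW :
    ContinuousOn lambertW ((fun w : ℂ => w * Complex.exp w) '' lambertUpper) ∧
      IsClosed ((fun w : ℂ => w * Complex.exp w) '' lambertUpper) := by
  let f : lambertUpper → ℂ := fun w => (w : ℂ) * Complex.exp w
  have hf : Continuous f := by fun_prop
  have hinj : Function.Injective f := fun a b h =>
    Subtype.ext (injOn_mul_exp_lambertUpper a.2 b.2 h)
  have hproper : Tendsto f (cocompact lambertUpper) (cocompact ℂ) := by
    have h1 : Tendsto (fun w : lambertUpper => ‖(w : ℂ)‖) (cocompact lambertUpper) atTop :=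
      (tendsto_norm_cocompact_atTop (E := ℂ)).comp
        (isClosed_lambertUpper.isClosedEmbedding_subtypeVal.tendsto_cocompact)
    refine tendsto_cocompact_of_tendsto_dist_comp_atTop 0 ?_
    refine tendsto_atTop_mono (fun w => ?_)
      (h1.atTop_mul_const (r := Real.exp (-1)) (Real.exp_pos _))
    rw [dist_zero_right]
    simp only [f, norm_mul, Complex.norm_exp]
    exact mul_le_mul_of_nonneg_left
      (Real.exp_le_exp.mpr (neg_one_le_re_of_mem_lambertUpper w.2)) (norm_nonneg _)
  have hcl : IsClosedMap f :=
    (isProperMap_iff_tendsto_cocompact.mpr ⟨hf, hproper⟩).isClosedMap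
  have hemb := Topology.IsClosedEmbedding.of_continuous_injective_isClosedMap hf hinj hcl
  have himg : (fun w : ℂ => w * Complex.exp w) '' lambertUpper = Set.range f := by
    ext z
    simp [f]
  rw [himg]
  refine ⟨?_, hemb.isClosed_range⟩
  rw [continuousOn_iff_continuous_domRestrict]
  let e := hemb.isEmbedding.toHomeomorph
  have : Set.domRestrict (Set.range f) lambertW = fun z => ((e.symm z : lambertUpper) : ℂ) := by
    ext z
    obtain ⟨w, rfl⟩ := e.surjective z
    rw [e.symm_apply_apply]
    exact lambertW_mul_exp w.2
  rw [this]
  exact continuous_subtype_val.comp e.symm.continuous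

/-! ### Resolvents of Gram matrices -/

section Resolvent

open Matrix
open scoped ComplexOrder

variable {ι : Type*} [Fintype ι]

/-- The squared Euclidean norm of a vector. -/
noncomputable def normSqSum (v : ι → ℂ) : ℝ := ∑ i, ‖v i‖ ^ 2

theorem normSqSum_nonneg (v : ι → ℂ) : 0 ≤ normSqSum v :=
  Finset.sum_nonneg fun _ _ => by positivity

theorem star_dotProduct_self_eq (v : ι → ℂ) : star v ⬝ᵥ v = (normSqSum v : ℂ) := by
  simp only [dotProduct, normSqSum, Pi.star_apply, RCLike.star_def, Complex.ofReal_sum]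
  exact Finset.sum_congr rfl fun i _ => by rw [Complex.conj_mul']; norm_cast

theorem norm_dotProduct_sq_le (v w : ι → ℂ) :
    ‖v ⬝ᵥ w‖ ^ 2 ≤ normSqSum v * normSqSum w := by
  have h1 : ‖v ⬝ᵥ w‖ ≤ ∑ i, ‖v i‖ * ‖w i‖ := by
    refine (norm_sum_le _ _).trans (Finset.sum_le_sum fun i _ => (norm_mul _ _).le)
  refine (pow_le_pow_left₀ (norm_nonneg _) h1 2).trans ?_
  exact Finset.sum_mul_sq_le_sq_mul_sq _ _ _

variable [DecidableEq ι]

/-- The resolvent `(A^* A + u)⁻¹`. -/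
noncomputable def gramResolvent (A : Matrix ι ι ℂ) (u : ℝ) : Matrix ι ι ℂ :=
  (Aᴴ * A + (u : ℂ) • 1)⁻¹

/-- The quadratic form `v (A^* A + u)⁻¹ v^*` at a row vector `v`; it is real and nonnegative, so its
real part is taken. -/
noncomputable def gramForm (A : Matrix ι ι ℂ) (u : ℝ) (v : ι → ℂ) : ℝ :=
  (v ⬝ᵥ (gramResolvent A u *ᵥ star v)).re

theorem posDef_gram_add (A : Matrix ι ι ℂ) {u : ℝ} (hu : 0 < u) :
    (Aᴴ * A + (u : ℂ) • 1).PosDef := by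
  refine Matrix.PosDef.posSemidef_add (posSemidef_conjTranspose_mul_self A) ?_
  exact Matrix.PosDef.one.smul (by exact_mod_cast hu)

theorem isUnit_det_gram_add (A : Matrix ι ι ℂ) {u : ℝ} (hu : 0 < u) :
    IsUnit (Aᴴ * A + (u : ℂ) • 1).det :=
  (Matrix.isUnit_iff_isUnit_det _).mp (posDef_gram_add A hu).isUnit

theorem gramResolvent_mul (A : Matrix ι ι ℂ) {u : ℝ} (hu : 0 < u) :
    gramResolvent A u * (Aᴴ * A + (u : ℂ) • 1) = 1 :=
  nonsing_inv_mul _ (isUnit_det_gram_add A hu)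

theorem mul_gramResolvent (A : Matrix ι ι ℂ) {u : ℝ} (hu : 0 < u) :
    (Aᴴ * A + (u : ℂ) • 1) * gramResolvent A u = 1 :=
  mul_nonsing_inv _ (isUnit_det_gram_add A hu)

theorem gramResolvent_isHermitian (A : Matrix ι ι ℂ) {u : ℝ} (hu : 0 < u) :
    (gramResolvent A u).IsHermitian :=
  (posDef_gram_add A hu).isHermitian.inv

theorem dotProduct_gramResolvent (A : Matrix ι ι ℂ) {u : ℝ} (hu : 0 < u) (v : ι → ℂ) :
    v ⬝ᵥ (gramResolvent A u *ᵥ star v)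
      = ((normSqSum (A *ᵥ (gramResolvent A u *ᵥ star v))
          + u * normSqSum (gramResolvent A u *ᵥ star v) : ℝ) : ℂ) := by
  set w := gramResolvent A u *ᵥ star v with hw
  have h1 : star v = Aᴴ *ᵥ (A *ᵥ w) + (u : ℂ) • w := by
    have : (Aᴴ * A + (u : ℂ) • 1) *ᵥ w = star v := by
      rw [hw, mulVec_mulVec, mul_gramResolvent A hu, one_mulVec]
    rw [← this, add_mulVec, smul_mulVec, one_mulVec, ← mulVec_mulVec]
  have h2 : v = star (A *ᵥ w) ᵥ* A + (u : ℂ) • star w := by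
    have := congrArg star h1
    rw [star_star, star_add, star_mulVec, conjTranspose_conjTranspose, star_smul] at this
    rw [this]
    simp
  have h3 : v ⬝ᵥ w = star (A *ᵥ w) ⬝ᵥ (A *ᵥ w) + (u : ℂ) * (star w ⬝ᵥ w) := by
    conv_lhs => rw [h2]
    rw [add_dotProduct, smul_dotProduct, ← dotProduct_mulVec, smul_eq_mul]
  rw [h3, star_dotProduct_self_eq, star_dotProduct_self_eq]
  push_cast
  ring

theorem gramForm_eq (A : Matrix ι ι ℂ) {u : ℝ} (hu : 0 < u) (v : ι → ℂ) :
    gramForm A u v = normSqSum (A *ᵥ (gramResolvent A u *ᵥ star v))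
          + u * normSqSum (gramResolvent A u *ᵥ star v) := by
  rw [gramForm, dotProduct_gramResolvent A hu, Complex.ofReal_re]

theorem ofReal_gramForm (A : Matrix ι ι ℂ) {u : ℝ} (hu : 0 < u) (v : ι → ℂ) :
    (gramForm A u v : ℂ) = v ⬝ᵥ (gramResolvent A u *ᵥ star v) := by
  rw [gramForm_eq A hu, dotProduct_gramResolvent A hu]

theorem gramForm_nonneg (A : Matrix ι ι ℂ) {u : ℝ} (hu : 0 < u) (v : ι → ℂ) :
    0 ≤ gramForm A u v := by
  rw [gramForm_eq A hu]
  have := normSqSum_nonneg (A *ᵥ (gramResolvent A u *ᵥ star v))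
  have := normSqSum_nonneg (gramResolvent A u *ᵥ star v)
  positivity

theorem normSqSum_gramResolvent_le (A : Matrix ι ι ℂ) {u : ℝ} (hu : 0 < u) (v : ι → ℂ) :
    normSqSum (gramResolvent A u *ᵥ star v) ≤ normSqSum v / u ^ 2 := by
  have h1 := norm_dotProduct_sq_le v (gramResolvent A u *ᵥ star v)
  rw [← ofReal_gramForm A hu, Complex.norm_of_nonneg (gramForm_nonneg A hu v),
    gramForm_eq A hu] at h1
  have h2 := normSqSum_nonneg (A *ᵥ (gramResolvent A u *ᵥ star v))
  have h3 := normSqSum_nonneg (gramResolvent A u *ᵥ star v)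
  have h4 := normSqSum_nonneg v
  set a := normSqSum (A *ᵥ (gramResolvent A u *ᵥ star v))
  set b := normSqSum (gramResolvent A u *ᵥ star v)
  rw [le_div_iff₀ (by positivity)]
  rcases h3.eq_or_lt with h | h
  · rw [← h]; simpa using h4
  · have h5 : (u * b) ^ 2 ≤ normSqSum v * b :=
      (pow_le_pow_left₀ (by positivity) (by linarith) 2).trans h1
    have h6 : b * (b * u ^ 2) ≤ b * normSqSum v := by nlinarith
    exact le_of_mul_le_mul_left h6 h

theorem gramForm_le (A : Matrix ι ι ℂ) {u : ℝ} (hu : 0 < u) (v : ι → ℂ) :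
    gramForm A u v ≤ normSqSum v / u := by
  have h1 := norm_dotProduct_sq_le v (gramResolvent A u *ᵥ star v)
  rw [← ofReal_gramForm A hu, Complex.norm_of_nonneg (gramForm_nonneg A hu v)] at h1
  have h2 := normSqSum_gramResolvent_le A hu v
  have h4 := normSqSum_nonneg v
  refine abs_le_of_sq_le_sq' ?_ (by positivity) |>.2
  calc _ ≤ _ := h1
    _ ≤ normSqSum v * (normSqSum v / u ^ 2) := mul_le_mul_of_nonneg_left h2 h4
    _ = _ := by ring

/-- Since `A (A^* A + u)⁻¹ A^* ≤ 1`, the quadratic form is small on a combination `p A` of the rows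
of `A` with a coefficient vector `p` of small norm. -/
theorem gramForm_vecMul_le (A : Matrix ι ι ℂ) {u : ℝ} (hu : 0 < u) (p : ι → ℂ) :
    gramForm A u (p ᵥ* A) ≤ normSqSum p := by
  set w := gramResolvent A u *ᵥ star (p ᵥ* A) with hw
  have h1 := norm_dotProduct_sq_le p (A *ᵥ w)
  rw [dotProduct_mulVec, hw, ← ofReal_gramForm A hu,
    Complex.norm_of_nonneg (gramForm_nonneg A hu _)] at h1
  have h2 : normSqSum (A *ᵥ w) ≤ gramForm A u (p ᵥ* A) := by
    rw [gramForm_eq A hu]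
    have := normSqSum_nonneg w
    have : 0 ≤ u * normSqSum w := by positivity
    linarith
  have h3 := normSqSum_nonneg p
  have h4 := gramForm_nonneg A hu (p ᵥ* A)
  rcases h4.eq_or_lt with h | h
  · rw [← h]; exact h3
  · have := h1.trans (mul_le_mul_of_nonneg_left h2 h3)
    rw [sq] at this
    exact le_of_mul_le_mul_right this h

theorem gramForm_add_le (A : Matrix ι ι ℂ) {u : ℝ} (hu : 0 < u) (v w : ι → ℂ) :
    gramForm A u (v + w) ≤ 2 * gramForm A u v + 2 * gramForm A u w := by
  have h : gramForm A u (v + w) + gramForm A u (v - w)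
      = 2 * gramForm A u v + 2 * gramForm A u w := by
    simp only [gramForm, star_add, star_sub, mulVec_add, mulVec_sub, add_dotProduct,
      sub_dotProduct, dotProduct_add, dotProduct_sub, Complex.add_re, Complex.sub_re]
    ring
  linarith [gramForm_nonneg A hu (v - w)]

theorem gramForm_add (A : Matrix ι ι ℂ) {u : ℝ} (hu : 0 < u) (v w : ι → ℂ) :
    gramForm A u (v + w) = gramForm A u v + 2 * (v ⬝ᵥ (gramResolvent A u *ᵥ star w)).re
      + gramForm A u w := by
  have h : star (w ⬝ᵥ (gramResolvent A u *ᵥ star v))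
      = v ⬝ᵥ (gramResolvent A u *ᵥ star w) := by
    rw [← star_dotProduct_star, star_mulVec, star_star, gramResolvent_isHermitian A hu,
      ← dotProduct_mulVec]
  have h' : (w ⬝ᵥ (gramResolvent A u *ᵥ star v)).re
      = (v ⬝ᵥ (gramResolvent A u *ᵥ star w)).re := by
    rw [← h]; rfl
  simp only [gramForm, star_add, mulVec_add, add_dotProduct, dotProduct_add, Complex.add_re, h']
  ring

theorem gramResolvent_diag (A : Matrix ι ι ℂ) {u : ℝ} (hu : 0 < u) (i : ι) :
    gramResolvent A u i i = (gramForm A u (Pi.single i 1) : ℂ) := by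
  rw [ofReal_gramForm A hu]
  simp

theorem normSqSum_single (i : ι) : normSqSum (Pi.single i (1 : ℂ)) = 1 := by
  rw [normSqSum, Finset.sum_eq_single i]
  · simp
  · intro j _ hj; simp [hj]
  · simp

theorem norm_gramResolvent_diag_le (A : Matrix ι ι ℂ) {u : ℝ} (hu : 0 < u) (i : ι) :
    ‖gramResolvent A u i i‖ ≤ 1 / u := by
  rw [gramResolvent_diag A hu, Complex.norm_of_nonneg (gramForm_nonneg A hu _)]
  exact (gramForm_le A hu _).trans_eq (by rw [normSqSum_single])

theorem sum_norm_sq_gramResolvent_col_le (A : Matrix ι ι ℂ) {u : ℝ} (hu : 0 < u) (j : ι) :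
    ∑ i, ‖gramResolvent A u i j‖ ^ 2 ≤ 1 / u ^ 2 := by
  have := normSqSum_gramResolvent_le A hu (Pi.single j 1)
  rw [normSqSum_single] at this
  refine le_of_eq_of_le ?_ this
  simp [normSqSum]

/-- The real number `tr (A^* A + u)⁻¹`. -/
noncomputable def gramTrace (A : Matrix ι ι ℂ) (u : ℝ) : ℝ := (gramResolvent A u).trace.re

theorem ofReal_gramTrace (A : Matrix ι ι ℂ) {u : ℝ} (hu : 0 < u) :
    (gramTrace A u : ℂ) = (gramResolvent A u).trace := by
  have : (gramResolvent A u).trace = ((∑ i, gramForm A u (Pi.single i 1) : ℝ) : ℂ) := by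
    rw [Matrix.trace, Complex.ofReal_sum]
    exact Finset.sum_congr rfl fun i _ => gramResolvent_diag A hu i
  rw [gramTrace, this, Complex.ofReal_re]

theorem gramTrace_nonneg (A : Matrix ι ι ℂ) {u : ℝ} (hu : 0 < u) : 0 ≤ gramTrace A u := by
  have : gramTrace A u = ∑ i, gramForm A u (Pi.single i 1) := by
    rw [gramTrace, Matrix.trace, Complex.re_sum]
    exact Finset.sum_congr rfl fun i _ => by
      rw [diag_apply, gramResolvent_diag A hu i, Complex.ofReal_re]
  rw [this]
  exact Finset.sum_nonneg fun i _ => gramForm_nonneg A hu _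

/-- The traces of the resolvents of `A^* A` and of `A A^*` agree. -/
theorem trace_gramResolvent_comm (A : Matrix ι ι ℂ) {u : ℝ} (hu : 0 < u) :
    (gramResolvent A u).trace = ((A * Aᴴ + (u : ℂ) • 1)⁻¹).trace := by
  have hH : IsUnit (A * Aᴴ + (u : ℂ) • 1).det := by
    simpa using isUnit_det_gram_add Aᴴ hu
  set H := (A * Aᴴ + (u : ℂ) • 1)⁻¹ with hHdef
  have hu' : (u : ℂ) ≠ 0 := by exact_mod_cast hu.ne'
  have h1 : H * A = A * gramResolvent A u := by
    have e : A * (Aᴴ * A + (u : ℂ) • 1) = (A * Aᴴ + (u : ℂ) • 1) * A := by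
      rw [Matrix.mul_add, Matrix.add_mul, Matrix.mul_assoc]
      simp
    calc H * A = H * (A * ((Aᴴ * A + (u : ℂ) • 1) * gramResolvent A u)) := by
          rw [mul_gramResolvent A hu, Matrix.mul_one]
      _ = (H * (A * Aᴴ + (u : ℂ) • 1)) * A * gramResolvent A u := by
          rw [← Matrix.mul_assoc A, e]; simp only [Matrix.mul_assoc]
      _ = A * gramResolvent A u := by rw [hHdef, nonsing_inv_mul _ hH, Matrix.one_mul]
  have h2 : (H * (A * Aᴴ)).trace = (gramResolvent A u * (Aᴴ * A)).trace := by
    rw [← Matrix.mul_assoc, h1, Matrix.mul_assoc, Matrix.trace_mul_comm, Matrix.mul_assoc]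
  have h3 := congrArg Matrix.trace (gramResolvent_mul A hu)
  have h4 := congrArg Matrix.trace (nonsing_inv_mul _ hH)
  rw [Matrix.mul_add, trace_add, Matrix.mul_smul, trace_smul, Matrix.mul_one, smul_eq_mul]
    at h3 h4
  rw [← hHdef, h2, ← h3] at h4
  exact (mul_left_cancel₀ hu' (add_left_cancel h4)).symm

theorem one_add_smul_conj (U : Matrix.unitaryGroup ι ℂ) (d : ι → ℝ) (y : ℂ) :
    1 + y • ((U : Matrix ι ι ℂ) * diagonal (fun i => (d i : ℂ)) * star (U : Matrix ι ι ℂ))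
      = (U : Matrix ι ι ℂ) * diagonal (fun i => 1 + y * d i) * star (U : Matrix ι ι ℂ) := by
  have : diagonal (fun i => 1 + y * (d i : ℂ)) = 1 + y • diagonal (fun i => (d i : ℂ)) := by
    ext i j
    by_cases h : i = j
    · subst h; simp
    · simp [h]
  rw [this, Matrix.mul_add, Matrix.add_mul, Matrix.mul_one,
    Matrix.mem_unitaryGroup_iff.mp U.2, Matrix.mul_smul, Matrix.smul_mul]

theorem isHermitian_eq_conj_diagonal {S : Matrix ι ι ℂ} (hS : S.IsHermitian) :
    S = (hS.eigenvectorUnitary : Matrix ι ι ℂ) * diagonal (fun i => (hS.eigenvalues i : ℂ))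
      * star (hS.eigenvectorUnitary : Matrix ι ι ℂ) := by
  conv_lhs => rw [hS.spectral_theorem]
  rfl

theorem det_one_add_smul_isHermitian {S : Matrix ι ι ℂ} (hS : S.IsHermitian) (y : ℂ) :
    (1 + y • S).det = ∏ i, (1 + y * hS.eigenvalues i) := by
  conv_lhs => rw [isHermitian_eq_conj_diagonal hS]
  rw [one_add_smul_conj, det_mul_right_comm, Matrix.mem_unitaryGroup_iff.mp (Subtype.prop _),
    Matrix.one_mul, det_diagonal]

theorem trace_inv_one_add_smul_conj (U : Matrix.unitaryGroup ι ℂ) (d : ι → ℝ) (y : ℂ)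
    (h : ∀ i, 1 + y * d i ≠ 0) :
    ((1 + y • ((U : Matrix ι ι ℂ) * diagonal (fun i => (d i : ℂ))
      * star (U : Matrix ι ι ℂ)))⁻¹).trace = ∑ i, (1 + y * d i)⁻¹ := by
  have hU1 := Matrix.mem_unitaryGroup_iff.mp U.2
  have hU2 := Matrix.mem_unitaryGroup_iff'.mp U.2
  have hinv : (1 + y • ((U : Matrix ι ι ℂ) * diagonal (fun i => (d i : ℂ))
      * star (U : Matrix ι ι ℂ)))⁻¹ = (U : Matrix ι ι ℂ)
      * diagonal (fun i => (1 + y * d i)⁻¹) * star (U : Matrix ι ι ℂ) := by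
    apply inv_eq_right_inv
    rw [one_add_smul_conj]
    calc _ = (U : Matrix ι ι ℂ) * (diagonal (fun i => 1 + y * d i)
          * ((star (U : Matrix ι ι ℂ) * (U : Matrix ι ι ℂ))
          * diagonal (fun i => (1 + y * d i)⁻¹))) * star (U : Matrix ι ι ℂ) := by
            simp only [Matrix.mul_assoc]
      _ = 1 := by
        rw [hU2, Matrix.one_mul, diagonal_mul_diagonal]
        simp only [mul_inv_cancel₀ (h _)]
        rw [diagonal_one, Matrix.mul_one, hU1]
  rw [hinv, Matrix.mul_assoc, trace_mul_comm, Matrix.mul_assoc, hU2, Matrix.mul_one,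
    trace_diagonal]

theorem trace_inv_one_add_smul_isHermitian {S : Matrix ι ι ℂ} (hS : S.IsHermitian) (y : ℂ)
    (h : ∀ i, 1 + y * hS.eigenvalues i ≠ 0) :
    ((1 + y • S)⁻¹).trace = ∑ i, (1 + y * hS.eigenvalues i)⁻¹ := by
  rw [← trace_inv_one_add_smul_conj hS.eigenvectorUnitary hS.eigenvalues y h,
    ← isHermitian_eq_conj_diagonal hS]

theorem continuous_gramResolvent {u : ℝ} (hu : 0 < u) :
    Continuous fun A : Matrix ι ι ℂ => gramResolvent A u := by
  have h1 : Continuous fun A : Matrix ι ι ℂ => Aᴴ * A + (u : ℂ) • 1 := by fun_prop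
  simp only [gramResolvent, Matrix.inv_def, Ring.inverse_eq_inv']
  exact (h1.matrix_det.inv₀ fun A => (isUnit_det_gram_add A hu).ne_zero).smul h1.matrix_adjugate

theorem continuous_gramForm {u : ℝ} (hu : 0 < u) :
    Continuous fun q : Matrix ι ι ℂ × (ι → ℂ) => gramForm q.1 u q.2 := by
  have h1 := (continuous_gramResolvent (ι := ι) hu).comp
    (continuous_fst (X := Matrix ι ι ℂ) (Y := ι → ℂ))
  exact Complex.continuous_re.comp
    (continuous_snd.dotProduct (h1.matrix_mulVec continuous_snd.star))

theorem continuous_gramTrace {u : ℝ} (hu : 0 < u) :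
    Continuous fun A : Matrix ι ι ℂ => gramTrace A u :=
  Complex.continuous_re.comp (continuous_gramResolvent hu).matrix_trace

end Resolvent

/-! ### Growing the triangular matrix by one row -/

section Recursion

open Matrix

variable {Ω : Type*}

/-- The `k`-th row of the triangular matrix, without its diagonal entry. -/
def triangularRow (X : ℕ → ℕ → Ω → ℂ) (k : ℕ) (ω : Ω) : Fin k → ℂ := fun j => X k j ω

/-- The factor by which `det (X(n)^* X(n) + u) / u ^ n` grows with the `k`-th row is
`1 + rowForm`. -/
noncomputable def rowForm (X : ℕ → ℕ → Ω → ℂ) (u : ℝ) (k : ℕ) (ω : Ω) : ℝ :=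
  gramForm (triangularMatrix X k ω) u (triangularRow X k ω) + ‖X k k ω‖ ^ 2 / u

theorem triangularMatrix_apply (X : ℕ → ℕ → Ω → ℂ) (n : ℕ) (ω : Ω) (i j : Fin n) :
    triangularMatrix X n ω i j = if j ≤ i then X i j ω else 0 := rfl

theorem triangularMatrix_succ_submatrix (X : ℕ → ℕ → Ω → ℂ) (k : ℕ) (ω : Ω) :
    (triangularMatrix X (k + 1) ω).submatrix finSumFinEquiv finSumFinEquiv
      = fromBlocks (triangularMatrix X k ω) 0 (replicateRow (Fin 1) (triangularRow X k ω))
          (diagonal fun _ => X k k ω) := by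
  refine Matrix.ext fun i j => ?_
  rcases i with i | i <;> rcases j with j | j
  · rw [submatrix_apply, fromBlocks_apply₁₁, triangularMatrix_apply, triangularMatrix_apply]
    rfl
  · have : ¬ (k ≤ (i : ℕ)) := by omega
    rw [submatrix_apply, fromBlocks_apply₁₂]
    simp [triangularMatrix_apply, Fin.le_def, this]
  · have : (j : ℕ) ≤ k := by omega
    rw [submatrix_apply, fromBlocks_apply₂₁]
    simp [triangularMatrix_apply, triangularRow, Fin.le_def, this]
  · obtain rfl : i = 0 := Subsingleton.elim _ _
    obtain rfl : j = 0 := Subsingleton.elim _ _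
    rw [submatrix_apply, fromBlocks_apply₂₂]
    simp [triangularMatrix_apply]

theorem det_gram_triangularMatrix_succ (X : ℕ → ℕ → Ω → ℂ) (k : ℕ) (ω : Ω) {u : ℝ} (hu : 0 < u) :
    ((triangularMatrix X (k + 1) ω)ᴴ * triangularMatrix X (k + 1) ω + (u : ℂ) • 1).det
      = ((triangularMatrix X k ω)ᴴ * triangularMatrix X k ω + (u : ℂ) • 1).det
        * (u * (1 + rowForm X u k ω)) := by
  set A := triangularMatrix X k ω
  set x := triangularRow X k ω
  set c := X k k ω
  have hu' : (u : ℂ) ≠ 0 := by exact_mod_cast hu.ne'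
  set r : Fin k ⊕ Fin 1 → ℂ := Sum.elim x (fun _ => c)
  set B : Matrix (Fin k ⊕ Fin 1) (Fin k ⊕ Fin 1) ℂ :=
    fromBlocks (Aᴴ * A + (u : ℂ) • 1) 0 0 ((u : ℂ) • 1) with hB
  have hBdet : B.det = (Aᴴ * A + (u : ℂ) • 1).det * u := by
    rw [hB, det_fromBlocks_zero₁₂]; simp
  have hBunit : IsUnit B.det := by
    rw [hBdet]; exact (isUnit_det_gram_add A hu).mul (isUnit_iff_ne_zero.mpr hu')
  have hBinv : B⁻¹ = fromBlocks (gramResolvent A u) 0 0 ((u : ℂ)⁻¹ • 1) := by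
    apply inv_eq_right_inv
    rw [hB, fromBlocks_multiply, mul_gramResolvent A hu]
    have : ((u : ℂ) • (1 : Matrix (Fin 1) (Fin 1) ℂ)) * ((u : ℂ)⁻¹ • 1) = 1 := by
      rw [Matrix.smul_mul, Matrix.mul_smul, smul_smul, mul_inv_cancel₀ hu', one_smul,
        Matrix.one_mul]
    rw [this]
    simp
  have h1 : ((triangularMatrix X (k + 1) ω)ᴴ * triangularMatrix X (k + 1) ω
      + (u : ℂ) • 1).submatrix finSumFinEquiv finSumFinEquiv
      = B + replicateCol (Fin 1) (star r) * replicateRow (Fin 1) r := by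
    have e1 := triangularMatrix_succ_submatrix X k ω
    have e2 : ∀ M : Matrix (Fin (k + 1)) (Fin (k + 1)) ℂ,
        (Mᴴ * M + (u : ℂ) • 1).submatrix finSumFinEquiv finSumFinEquiv
          = (M.submatrix finSumFinEquiv finSumFinEquiv)ᴴ
            * (M.submatrix finSumFinEquiv finSumFinEquiv)
            + (u : ℂ) • (1 : Matrix (Fin k ⊕ Fin 1) (Fin k ⊕ Fin 1) ℂ) := by
      intro M
      rw [conjTranspose_submatrix, submatrix_mul_equiv]
      refine Matrix.ext fun i j => ?_
      simp [Matrix.one_apply]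
    rw [e2, e1, fromBlocks_conjTranspose, fromBlocks_multiply]
    refine Matrix.ext fun i j => ?_
    rcases i with i | i <;> rcases j with j | j
    · simp [B, r, Matrix.mul_apply, Matrix.one_apply, A, x]
      ring
    · obtain rfl : j = 0 := Subsingleton.elim _ _
      simp [B, r, Matrix.mul_apply, A, x, c]
    · obtain rfl : i = 0 := Subsingleton.elim _ _
      simp [B, r, Matrix.mul_apply, A, x, c]
    · fin_cases i; fin_cases j
      simp [B, r, Matrix.mul_apply, c]
      ring
  have h2 : (replicateRow (Fin 1) r * B⁻¹ * replicateCol (Fin 1) (star r)).det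
      = gramForm A u x + ‖c‖ ^ 2 / u := by
    rw [Matrix.det_fin_one, Matrix.mul_assoc]
    have : (replicateRow (Fin 1) r * (B⁻¹ * replicateCol (Fin 1) (star r))) 0 0
        = r ⬝ᵥ (B⁻¹ *ᵥ star r) := rfl
    rw [this, hBinv, ofReal_gramForm A hu]
    have h3 : star r = Sum.elim (star x) (fun _ => star c) := by
      ext (i | i) <;> rfl
    rw [h3, fromBlocks_mulVec]
    simp only [Matrix.zero_mulVec, add_zero, zero_add, r]
    rw [sumElim_dotProduct_sumElim]
    congr 1
    simp [Matrix.smul_mulVec, dotProduct, ← Complex.mul_conj']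
    ring
  rw [← Matrix.det_submatrix_equiv_self finSumFinEquiv, h1,
    det_add_mul _ _ hBunit, hBdet]
  have h4 : (1 + replicateRow (Fin 1) r * B⁻¹ * replicateCol (Fin 1) (star r)).det
      = ((1 + rowForm X u k ω : ℝ) : ℂ) := by
    rw [Matrix.det_fin_one] at h2 ⊢
    rw [Matrix.add_apply, h2, rowForm]
    push_cast
    rfl
  rw [h4]
  push_cast
  ring

theorem rowForm_nonneg (X : ℕ → ℕ → Ω → ℂ) {u : ℝ} (hu : 0 < u) (k : ℕ) (ω : Ω) :
    0 ≤ rowForm X u k ω :=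
  add_nonneg (gramForm_nonneg _ hu _) (by positivity)

theorem det_gram_triangularMatrix (X : ℕ → ℕ → Ω → ℂ) (ω : Ω) {u : ℝ} (hu : 0 < u) (n : ℕ) :
    ((triangularMatrix X n ω)ᴴ * triangularMatrix X n ω + (u : ℂ) • 1).det
      = (u : ℂ) ^ n * ((∏ k ∈ Finset.range n, (1 + rowForm X u k ω) : ℝ) : ℂ) := by
  induction n with
  | zero => simp
  | succ n ih =>
    rw [det_gram_triangularMatrix_succ X n ω hu, ih, Finset.prod_range_succ]
    push_cast
    ring

open scoped ComplexOrder in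
theorem sampleMatrix_eigenvalues_nonneg (X : ℕ → ℕ → Ω → ℂ) (n : ℕ) (ω : Ω) (i : Fin n) :
    0 ≤ (sampleMatrix_isHermitian X n ω).eigenvalues i := by
  refine Matrix.PosSemidef.eigenvalues_nonneg ?_ i
  refine (posSemidef_self_mul_conjTranspose _).smul ?_
  exact_mod_cast (by positivity : (0 : ℝ) ≤ 1 / (n : ℝ))

/-- The matrix `X(n) X(n)^* + u` is `u (1 + (n / u) S_n)`. -/
theorem mul_conjTranspose_add_eq (X : ℕ → ℕ → Ω → ℂ) {n : ℕ} (hn : n ≠ 0) (ω : Ω) {u : ℝ}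
    (hu : 0 < u) :
    triangularMatrix X n ω * (triangularMatrix X n ω)ᴴ + (u : ℂ) • 1
      = (u : ℂ) • (1 + ((n / u : ℝ) : ℂ) • sampleMatrix X n ω) := by
  have hu' : (u : ℂ) ≠ 0 := by exact_mod_cast hu.ne'
  have hn' : (n : ℂ) ≠ 0 := by exact_mod_cast hn
  rw [sampleMatrix, smul_smul, smul_add, smul_smul, add_comm]
  congr 1
  have : (u : ℂ) * (((n / u : ℝ) : ℂ) * ((1 / (n : ℝ) : ℝ) : ℂ)) = 1 := by
    push_cast
    field_simp
  rw [this, one_smul]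

/-- The product of the `1 + r λ_i` over the eigenvalues of `S_n` telescopes over the rows. -/
theorem prod_one_add_eigenvalues (X : ℕ → ℕ → Ω → ℂ) {n : ℕ} (hn : n ≠ 0) (ω : Ω) {r : ℝ}
    (hr : 0 < r) :
    ∏ i, (1 + r * (sampleMatrix_isHermitian X n ω).eigenvalues i)
      = ∏ k ∈ Finset.range n, (1 + rowForm X (n / r) k ω) := by
  have hn0 : (0 : ℝ) < n := by exact_mod_cast Nat.pos_of_ne_zero hn
  have hu : 0 < (n : ℝ) / r := by positivity
  have hu' : (((n : ℝ) / r : ℝ) : ℂ) ≠ 0 := by exact_mod_cast hu.ne'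
  have h1 := det_gram_triangularMatrix X ω hu n
  have h2 : ((triangularMatrix X n ω)ᴴ * triangularMatrix X n ω + (((n : ℝ) / r : ℝ) : ℂ) • 1).det
      = (triangularMatrix X n ω * (triangularMatrix X n ω)ᴴ + (((n : ℝ) / r : ℝ) : ℂ) • 1).det := by
    have e : ∀ M : Matrix (Fin n) (Fin n) ℂ, (M + (((n : ℝ) / r : ℝ) : ℂ) • 1).det
        = (-1) ^ n * M.charpoly.eval (-(((n : ℝ) / r : ℝ) : ℂ)) := by
      intro M
      have h := Matrix.det_neg (scalar (Fin n) (-(((n : ℝ) / r : ℝ) : ℂ)) - M)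
      rw [Fintype.card_fin] at h
      rw [Matrix.eval_charpoly, ← h]
      congr 1
      rw [neg_sub, sub_eq_add_neg, ← map_neg, neg_neg, scalar_apply, smul_one_eq_diagonal]
    rw [e, e, Matrix.charpoly_mul_comm]
  rw [h2, mul_conjTranspose_add_eq X hn ω hu, det_smul,
    det_one_add_smul_isHermitian (sampleMatrix_isHermitian X n ω), Fintype.card_fin] at h1
  have h3 := mul_left_cancel₀ (pow_ne_zero _ hu') h1
  have h4 : (n : ℝ) / (n / r) = r := by field_simp
  rw [h4] at h3
  exact_mod_cast h3

theorem gramTrace_triangularMatrix (X : ℕ → ℕ → Ω → ℂ) {n : ℕ} (hn : n ≠ 0) (ω : Ω) {u : ℝ}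
    (hu : 0 < u) :
    gramTrace (triangularMatrix X n ω) u
      = (n : ℝ)⁻¹ * ∑ i, (n / u)
        / (1 + n / u * (sampleMatrix_isHermitian X n ω).eigenvalues i) := by
  have hu' : (u : ℂ) ≠ 0 := by exact_mod_cast hu.ne'
  have hn0 : (0 : ℝ) < n := by exact_mod_cast Nat.pos_of_ne_zero hn
  have hpos : ∀ i, 0 < 1 + n / u * (sampleMatrix_isHermitian X n ω).eigenvalues i := fun i => by
    have := sampleMatrix_eigenvalues_nonneg X n ω i
    positivity
  have hne : ∀ i, 1 + ((n / u : ℝ) : ℂ) * (sampleMatrix_isHermitian X n ω).eigenvalues i ≠ 0 :=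
    fun i => by exact_mod_cast (hpos i).ne'
  have hinv : ((u : ℂ) • (1 + ((n / u : ℝ) : ℂ) • sampleMatrix X n ω))⁻¹
      = (u : ℂ)⁻¹ • (1 + ((n / u : ℝ) : ℂ) • sampleMatrix X n ω)⁻¹ := by
    apply inv_eq_right_inv
    rw [Matrix.smul_mul, Matrix.mul_smul, smul_smul, mul_inv_cancel₀ hu', one_smul]
    apply mul_nonsing_inv
    rw [det_one_add_smul_isHermitian (sampleMatrix_isHermitian X n ω)]
    exact isUnit_iff_ne_zero.mpr (Finset.prod_ne_zero_iff.mpr fun i _ => hne i)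
  have h1 := ofReal_gramTrace (triangularMatrix X n ω) hu
  rw [trace_gramResolvent_comm _ hu, mul_conjTranspose_add_eq X hn ω hu, hinv, trace_smul,
    trace_inv_one_add_smul_isHermitian (sampleMatrix_isHermitian X n ω) _ hne] at h1
  have h2 : gramTrace (triangularMatrix X n ω) u
      = u⁻¹ * ∑ i, (1 + n / u * (sampleMatrix_isHermitian X n ω).eigenvalues i)⁻¹ := by
    rw [smul_eq_mul] at h1
    exact_mod_cast h1
  rw [h2, Finset.mul_sum, Finset.mul_sum]
  refine Finset.sum_congr rfl fun i _ => ?_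
  have := (hpos i).ne'
  field_simp

theorem integral_empiricalDistribution (X : ℕ → ℕ → Ω → ℂ) (n : ℕ) [NeZero n] (ω : Ω)
    (f : ℝ → ℝ) :
    ∫ x, f x ∂(empiricalDistribution X n ω : Measure ℝ)
      = (n : ℝ)⁻¹ * ∑ i, f ((sampleMatrix_isHermitian X n ω).eigenvalues i) := by
  change ∫ x, f x ∂((n : ENNReal)⁻¹ •
      ∑ i : Fin n, Measure.dirac ((sampleMatrix_isHermitian X n ω).eigenvalues i)) = _
  rw [integral_smul_measure, integral_finsetSum_measure]
  · simp
  · intro i _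
    exact (integrable_dirac (by simp)).congr (by rfl)

end Recursion

/-! ### Second moments of linear and quadratic forms in independent variables -/

section Moments

variable {Ω : Type*} [MeasurableSpace Ω] {P : Measure Ω}

/-- Pythagoras for an orthogonal family of square integrable random variables. -/
theorem integral_norm_sq_sum_of_orthogonal {κ : Type*} (s : Finset κ) (Z : κ → Ω → ℂ)
    (hZ : ∀ i ∈ s, MemLp (Z i) 2 P)
    (horth : ∀ i ∈ s, ∀ j ∈ s, i ≠ j → ∫ ω, Z i ω * (starRingEnd ℂ) (Z j ω) ∂P = 0) :
    ∫ ω, ‖∑ i ∈ s, Z i ω‖ ^ 2 ∂P = ∑ i ∈ s, ∫ ω, ‖Z i ω‖ ^ 2 ∂P := by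
  have hint : ∀ i ∈ s, ∀ j ∈ s, Integrable (fun ω => Z i ω * (starRingEnd ℂ) (Z j ω)) P :=
    fun i hi j hj => (hZ i hi).integrable_mul (hZ j hj).star
  have h1 : ((∫ ω, ‖∑ i ∈ s, Z i ω‖ ^ 2 ∂P : ℝ) : ℂ)
      = ∫ ω, ∑ i ∈ s, ∑ j ∈ s, Z i ω * (starRingEnd ℂ) (Z j ω) ∂P := by
    rw [← integral_complex_ofReal]
    refine integral_congr_ae (Eventually.of_forall fun ω => ?_)
    simp only
    rw [← Finset.sum_mul_sum, ← map_sum, Complex.mul_conj']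
    norm_cast
  have h2 : ∀ i ∈ s, ∫ ω, Z i ω * (starRingEnd ℂ) (Z i ω) ∂P
      = ((∫ ω, ‖Z i ω‖ ^ 2 ∂P : ℝ) : ℂ) := by
    intro i _
    rw [← integral_complex_ofReal]
    refine integral_congr_ae (Eventually.of_forall fun ω => ?_)
    simp only [Complex.mul_conj']
    norm_cast
  have h3 : ((∫ ω, ‖∑ i ∈ s, Z i ω‖ ^ 2 ∂P : ℝ) : ℂ)
      = ((∑ i ∈ s, ∫ ω, ‖Z i ω‖ ^ 2 ∂P : ℝ) : ℂ) := by
    rw [h1, integral_finsetSum _ fun i hi => integrable_finsetSum _ (hint i hi),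
      Complex.ofReal_sum]
    refine Finset.sum_congr rfl fun i hi => ?_
    rw [integral_finsetSum _ (hint i hi), ← h2 i hi]
    exact Finset.sum_eq_single i (fun j hj hji => horth i hi j hj hji.symm)
      (fun h => absurd hi h)
  exact_mod_cast h3

theorem lintegral_enorm_le_sqrt [IsProbabilityMeasure P] {Z : Ω → ℂ} (hZ : MemLp Z 2 P) {B : ℝ}
    (hB : ∫ ω, ‖Z ω‖ ^ 2 ∂P ≤ B) :
    ∫⁻ ω, ‖Z ω‖ₑ ∂P ≤ ENNReal.ofReal (Real.sqrt B) := by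
  rw [← eLpNorm_one_eq_lintegral_enorm]
  refine (eLpNorm_le_eLpNorm_of_exponent_le (by norm_num : (1 : ENNReal) ≤ 2)
    hZ.aestronglyMeasurable).trans ?_
  rw [hZ.eLpNorm_eq_integral_rpow_norm (by norm_num) (by norm_num)]
  refine ENNReal.ofReal_le_ofReal ?_
  rw [Real.sqrt_eq_rpow]
  simp only [ENNReal.toReal_ofNat, Real.rpow_two, one_div]
  exact Real.rpow_le_rpow (integral_nonneg fun _ => by positivity) hB (by norm_num)

/-- Integrating out a variable independent of the rest. -/
theorem lintegral_le_of_indepFun [IsFiniteMeasure P] {α β : Type*} [MeasurableSpace α]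
    [MeasurableSpace β]
    {U : Ω → α} {V : Ω → β} (hU : Measurable U) (hV : Measurable V) (hUV : IndepFun U V P)
    {f : α × β → ENNReal} (hf : Measurable f) {g : α → ENNReal}
    (hg : ∀ a, ∫⁻ ω, f (a, V ω) ∂P ≤ g a) :
    ∫⁻ ω, f (U ω, V ω) ∂P ≤ ∫⁻ ω, g (U ω) ∂P := by
  have h1 := (indepFun_iff_map_prod_eq_prod_map_map hU.aemeasurable hV.aemeasurable).mp hUV
  rw [← lintegral_map (f := f) hf (hU.prodMk hV), h1, lintegral_prod _ hf.aemeasurable,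
    lintegral_map hf.lintegral_prod_right' hU]
  refine lintegral_mono fun ω => ?_
  rw [lintegral_map (f := fun y => f (U ω, y)) (hf.comp measurable_prodMk_left) hV]
  exact hg _

/-- Independent, centred random variables with second moment `1`. -/
structure IsStandardFamily {ι : Type*} (P : Measure Ω) (Y : ι → Ω → ℂ) : Prop where
  measurable : ∀ i, Measurable (Y i)
  indep : iIndepFun Y P
  memLp : ∀ i, MemLp (Y i) 2 P
  mean : ∀ i, ∫ ω, Y i ω ∂P = 0
  second : ∀ i, ∫ ω, ‖Y i ω‖ ^ 2 ∂P = 1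

namespace IsStandardFamily

variable {ι : Type*} {Y : ι → Ω → ℂ}

theorem precomp {κ : Type*} (hY : IsStandardFamily P Y)
    {g : κ → ι} (hg : Function.Injective g) : IsStandardFamily P (fun k => Y (g k)) where
  measurable _ := hY.measurable _
  indep := hY.indep.precomp hg
  memLp _ := hY.memLp _
  mean _ := hY.mean _
  second _ := hY.second _

/-- A variable occurring once and unconjugated makes the expectation of a product vanish. -/
theorem integral_mul_eq_zero [DecidableEq ι] (hY : IsStandardFamily P Y) {t : ι} (S : Finset ι)
    (ht : t ∉ S) {F : (S → ℂ) → ℂ} (hF : Measurable F) :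
    ∫ ω, Y t ω * F (fun i => Y i ω) ∂P = 0 := by
  have h1 := hY.indep.indepFun_finset {t} S (by simpa using ht) hY.measurable
  have h2 : IndepFun (Y t) (fun ω => F (fun i => Y i ω)) P :=
    h1.comp (φ := fun g : (({t} : Finset ι) → ℂ) => g ⟨t, Finset.mem_singleton_self t⟩) (ψ := F)
      (by fun_prop) hF
  rw [h2.integral_fun_mul_eq_mul_integral (hY.measurable t).aestronglyMeasurable
    (hF.comp (measurable_pi_lambda _ fun i => hY.measurable i)).aestronglyMeasurable,
    hY.mean, zero_mul]

theorem integral_conj_mul_eq_zero [DecidableEq ι] (hY : IsStandardFamily P Y) {t : ι}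
    (S : Finset ι) (ht : t ∉ S) {F : (S → ℂ) → ℂ} (hF : Measurable F) :
    ∫ ω, (starRingEnd ℂ) (Y t ω) * F (fun i => Y i ω) ∂P = 0 := by
  have h := hY.integral_mul_eq_zero S ht (F := fun g => (starRingEnd ℂ) (F g))
    (Complex.continuous_conj.measurable.comp hF)
  have h2 := congrArg (starRingEnd ℂ) h
  rw [← integral_conj, map_zero] at h2
  simpa using h2

theorem integral_mul_conj (hY : IsStandardFamily P Y) {i j : ι} (hij : i ≠ j) :
    ∫ ω, Y i ω * (starRingEnd ℂ) (Y j ω) ∂P = 0 := by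
  classical
  exact hY.integral_mul_eq_zero {j} (by simpa using hij)
    (F := fun g => (starRingEnd ℂ) (g ⟨j, by simp⟩))
    (Complex.continuous_conj.measurable.comp (measurable_pi_apply _))

theorem integral_norm_sq_sum (hY : IsStandardFamily P Y) (s : Finset ι) (c : ι → ℂ) :
    MemLp (fun ω => ∑ i ∈ s, c i * Y i ω) 2 P ∧
    ∫ ω, ‖∑ i ∈ s, c i * Y i ω‖ ^ 2 ∂P = ∑ i ∈ s, ‖c i‖ ^ 2 := by
  refine ⟨memLp_finsetSum _ fun i _ => (hY.memLp i).const_mul (c i), ?_⟩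
  rw [integral_norm_sq_sum_of_orthogonal s (fun i ω => c i * Y i ω)
    (fun i _ => (hY.memLp i).const_mul (c i))]
  · refine Finset.sum_congr rfl fun i _ => ?_
    simp only [norm_mul, mul_pow]
    rw [integral_const_mul, hY.second, mul_one]
  · intro i _ j _ hij
    have : ∀ ω, c i * Y i ω * (starRingEnd ℂ) (c j * Y j ω)
        = (c i * (starRingEnd ℂ) (c j)) * (Y i ω * (starRingEnd ℂ) (Y j ω)) := fun ω => by
      rw [map_mul]; ring
    simp only [this]
    rw [integral_const_mul, hY.integral_mul_conj hij, mul_zero]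

theorem memLp_mul_conj (hY : IsStandardFamily P Y) {i j : ι} (hij : i ≠ j) :
    MemLp (fun ω => Y i ω * (starRingEnd ℂ) (Y j ω)) 2 P ∧
    ∫ ω, ‖Y i ω * (starRingEnd ℂ) (Y j ω)‖ ^ 2 ∂P = 1 := by
  have hind : IndepFun (fun ω => ‖Y i ω‖ ^ 2) (fun ω => ‖Y j ω‖ ^ 2) P :=
    (hY.indep.indepFun hij).comp (φ := fun z : ℂ => ‖z‖ ^ 2) (ψ := fun z : ℂ => ‖z‖ ^ 2)
      (by fun_prop) (by fun_prop)
  have hm := fun i => (hY.measurable i)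
  have hsq : ∀ i, Integrable (fun ω => ‖Y i ω‖ ^ 2) P := fun i =>
    (hY.memLp i).integrable_norm_pow (by norm_num)
  have hmeas : AEStronglyMeasurable (fun ω => Y i ω * (starRingEnd ℂ) (Y j ω)) P :=
    ((hm i).mul (Complex.continuous_conj.measurable.comp (hm j))).aestronglyMeasurable
  have heq : ∀ ω, ‖Y i ω * (starRingEnd ℂ) (Y j ω)‖ ^ 2 = ‖Y i ω‖ ^ 2 * ‖Y j ω‖ ^ 2 := fun ω => by
    rw [norm_mul, RCLike.norm_conj, mul_pow]
  refine ⟨(memLp_two_iff_integrable_sq_norm hmeas).mpr ?_, ?_⟩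
  · simp only [heq]
    exact hind.integrable_mul (hsq i) (hsq j)
  · simp only [heq]
    rw [hind.integral_fun_mul_eq_mul_integral (hsq i).aestronglyMeasurable
      (hsq j).aestronglyMeasurable, hY.second, hY.second, mul_one]

/-- The products `Y i * conj (Y j)`, `i < j`, are orthogonal: in the expectation of
`Y i * conj (Y j) * conj (Y k) * Y l` some index occurs once. -/
theorem integral_mul_conj_mul_conj [LinearOrder ι] (hY : IsStandardFamily P Y) {i j k l : ι}
    (hij : i < j) (hkl : k < l) (hne : (i, j) ≠ (k, l)) :
    ∫ ω, Y i ω * (starRingEnd ℂ) (Y j ω)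
      * (starRingEnd ℂ) (Y k ω * (starRingEnd ℂ) (Y l ω)) ∂P = 0 := by
  have mc := Complex.continuous_conj.measurable
  rcases lt_trichotomy j l with h | h | h
  · have := hY.integral_mul_eq_zero (t := l) {i, j, k}
      (by simp [h.ne', hkl.ne', (hij.trans h).ne'])
      (F := fun g => g ⟨i, by simp⟩ * (starRingEnd ℂ) (g ⟨j, by simp⟩)
        * (starRingEnd ℂ) (g ⟨k, by simp⟩))
      (((measurable_pi_apply _).mul (mc.comp (measurable_pi_apply _))).mul
        (mc.comp (measurable_pi_apply _)))
    rw [← this]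
    congr 1; ext ω
    simp only [map_mul, Complex.conj_conj]; ring
  · subst h
    have hik : i ≠ k := fun h => hne (by rw [h])
    have := hY.integral_mul_eq_zero (t := i) {j, k} (by simp [hik, hij.ne])
      (F := fun g => g ⟨j, by simp⟩ * (starRingEnd ℂ) (g ⟨j, by simp⟩)
        * (starRingEnd ℂ) (g ⟨k, by simp⟩))
      (((measurable_pi_apply _).mul (mc.comp (measurable_pi_apply _))).mul
        (mc.comp (measurable_pi_apply _)))
    rw [← this]
    congr 1; ext ω
    simp only [map_mul, Complex.conj_conj]; ring
  · have := hY.integral_conj_mul_eq_zero (t := j) {i, k, l}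
      (by simp [h.ne', hij.ne', (hkl.trans h).ne'])
      (F := fun g => g ⟨i, by simp⟩ * (starRingEnd ℂ) (g ⟨k, by simp⟩)
        * (g ⟨l, by simp⟩))
      (Measurable.mul (Measurable.mul (by fun_prop) (mc.comp (measurable_pi_apply _)))
        (by fun_prop))
    rw [← this]
    congr 1; ext ω
    simp only [map_mul, Complex.conj_conj]; ring

theorem lintegral_sum_lt_le [IsProbabilityMeasure P] [Fintype ι] [LinearOrder ι]
    (hY : IsStandardFamily P Y) (G : ι → ι → ℂ) {B : ℝ} (hB : ∑ i, ∑ j, ‖G i j‖ ^ 2 ≤ B) :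
    ∫⁻ ω, ‖∑ q : ι × ι with q.1 < q.2,
      G q.1 q.2 * (Y q.1 ω * (starRingEnd ℂ) (Y q.2 ω))‖ₑ ∂P ≤ ENNReal.ofReal (Real.sqrt B) := by
  have hmem : ∀ q ∈ Finset.univ.filter (fun q : ι × ι => q.1 < q.2),
      MemLp (fun ω => G q.1 q.2 * (Y q.1 ω * (starRingEnd ℂ) (Y q.2 ω))) 2 P := fun q hq =>
    (hY.memLp_mul_conj (Finset.mem_filter.mp hq).2.ne).1.const_mul _
  refine lintegral_enorm_le_sqrt (memLp_finsetSum _ hmem) ?_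
  have horth := integral_norm_sq_sum_of_orthogonal (P := P) _
    (fun (q : ι × ι) ω => G q.1 q.2 * (Y q.1 ω * (starRingEnd ℂ) (Y q.2 ω))) hmem ?_
  · calc _ = _ := horth
      _ = ∑ q : ι × ι with q.1 < q.2, ‖G q.1 q.2‖ ^ 2 := by
          refine Finset.sum_congr rfl fun q hq => ?_
          simp only [norm_mul (G q.1 q.2), mul_pow]
          rw [integral_const_mul, (hY.memLp_mul_conj (Finset.mem_filter.mp hq).2.ne).2, mul_one]
      _ ≤ ∑ q : ι × ι, ‖G q.1 q.2‖ ^ 2 :=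
          Finset.sum_le_sum_of_subset_of_nonneg (Finset.filter_subset _ _)
            fun _ _ _ => by positivity
      _ = ∑ i, ∑ j, ‖G i j‖ ^ 2 := Fintype.sum_prod_type _
      _ ≤ B := hB
  · intro q hq q' hq' hne
    have : ∀ ω, G q.1 q.2 * (Y q.1 ω * (starRingEnd ℂ) (Y q.2 ω))
        * (starRingEnd ℂ) (G q'.1 q'.2 * (Y q'.1 ω * (starRingEnd ℂ) (Y q'.2 ω)))
        = (G q.1 q.2 * (starRingEnd ℂ) (G q'.1 q'.2)) * (Y q.1 ω * (starRingEnd ℂ) (Y q.2 ω)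
          * (starRingEnd ℂ) (Y q'.1 ω * (starRingEnd ℂ) (Y q'.2 ω))) := fun ω => by
      simp only [map_mul]; ring
    simp only [this]
    rw [integral_const_mul, hY.integral_mul_conj_mul_conj (Finset.mem_filter.mp hq).2
      (Finset.mem_filter.mp hq').2 hne, mul_zero]

/-- A weak law of large numbers, by truncating `‖Y i‖ ^ 2` at `M`: only the second moment of the
`Y i` is available, so the part above `M` is estimated in mean. -/
theorem lintegral_sum_norm_sq_sub_one_le [IsProbabilityMeasure P] [Fintype ι]
    (hY : IsStandardFamily P Y) (a : ι → ℂ) {κ M ρ : ℝ} (hκ : 0 ≤ κ) (ha : ∀ i, ‖a i‖ ≤ κ)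
    (hM : 0 ≤ M) (hρ : ∀ i, ∫ ω, max (‖Y i ω‖ ^ 2 - M) 0 ∂P ≤ ρ) :
    ∫⁻ ω, ‖∑ i, a i * ((‖Y i ω‖ ^ 2 - 1 : ℝ) : ℂ)‖ₑ ∂P
      ≤ ENNReal.ofReal (κ * (M * √(Fintype.card ι) + 2 * Fintype.card ι * ρ)) := by
  have hm := hY.measurable
  have hsq : ∀ i, Integrable (fun ω => ‖Y i ω‖ ^ 2) P :=
    fun i => (hY.memLp i).integrable_norm_pow (by norm_num)
  have hDint : ∀ i, Integrable (fun ω => max (‖Y i ω‖ ^ 2 - M) 0) P := fun i =>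
    ((hsq i).sub (integrable_const M)).sup (integrable_const 0)
  have hBint : ∀ i, Integrable (fun ω => min (‖Y i ω‖ ^ 2) M) P := fun i =>
    (hsq i).inf (integrable_const M)
  have hBD : ∀ i ω, min (‖Y i ω‖ ^ 2) M + max (‖Y i ω‖ ^ 2 - M) 0 = ‖Y i ω‖ ^ 2 := by
    intro i ω
    rcases le_total (‖Y i ω‖ ^ 2) M with h | h
    · rw [min_eq_left h, max_eq_right (by linarith), add_zero]
    · rw [min_eq_right h, max_eq_left (by linarith)]; ring
  set c : ι → ℝ := fun i => ∫ ω, min (‖Y i ω‖ ^ 2) M ∂P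
  set d : ι → ℝ := fun i => ∫ ω, max (‖Y i ω‖ ^ 2 - M) 0 ∂P
  have hd0 : ∀ i, 0 ≤ d i := fun i => integral_nonneg fun ω => le_max_right _ _
  have hcd : ∀ i, c i + d i = 1 := fun i => by
    rw [← integral_add (hBint i) (hDint i), ← hY.second i]
    simp only [hBD]
  have hB0 : ∀ i ω, 0 ≤ min (‖Y i ω‖ ^ 2) M := fun i ω => le_min (by positivity) hM
  have hc0 : ∀ i, 0 ≤ c i := fun i => integral_nonneg (hB0 i)
  have hcM : ∀ i, c i ≤ M := fun i => by
    have := integral_mono (hBint i) (integrable_const (μ := P) M) fun ω => min_le_right _ _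
    simpa using this
  set W : ι → Ω → ℂ := fun i ω => ((min (‖Y i ω‖ ^ 2) M - c i : ℝ) : ℂ) with hW
  have hWM : ∀ i ω, ‖W i ω‖ ≤ M := fun i ω => by
    rw [hW, Complex.norm_real, Real.norm_eq_abs, abs_le]
    constructor
    · linarith [hB0 i ω, hcM i]
    · linarith [hc0 i, min_le_right (‖Y i ω‖ ^ 2) M]
  have hWmeas : ∀ i, Measurable (W i) := fun i =>
    Complex.measurable_ofReal.comp ((((hm i).norm.pow_const 2).min measurable_const).sub_const _)
  have hWmem : ∀ i, MemLp (W i) 2 P := fun i =>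
    MemLp.of_bound (hWmeas i).aestronglyMeasurable M (Eventually.of_forall (hWM i))
  have hWmean : ∀ i, ∫ ω, W i ω ∂P = 0 := fun i => by
    rw [hW, integral_complex_ofReal, integral_sub (hBint i) (integrable_const _)]
    simp [c]
  have horth : ∀ i j, i ≠ j → ∫ ω, W i ω * (starRingEnd ℂ) (W j ω) ∂P = 0 := by
    intro i j hij
    have hconj : ∀ ω, (starRingEnd ℂ) (W j ω) = W j ω := fun ω => Complex.conj_ofReal _
    simp only [hconj]
    have hind : IndepFun (W i) (W j) P :=
      (hY.indep.indepFun hij).comp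
        (φ := fun z : ℂ => ((min (‖z‖ ^ 2) M - c i : ℝ) : ℂ))
        (ψ := fun z : ℂ => ((min (‖z‖ ^ 2) M - c j : ℝ) : ℂ))
        (Continuous.measurable (by fun_prop)) (Continuous.measurable (by fun_prop))
    rw [hind.integral_fun_mul_eq_mul_integral (hWmeas i).aestronglyMeasurable
      (hWmeas j).aestronglyMeasurable, hWmean, zero_mul]
  have h1 : ∫⁻ ω, ‖∑ i, a i * W i ω‖ₑ ∂P
      ≤ ENNReal.ofReal (κ * (M * √(Fintype.card ι))) := by
    have hmem : ∀ i ∈ (Finset.univ : Finset ι), MemLp (fun ω => a i * W i ω) 2 P :=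
      fun i _ => (hWmem i).const_mul _
    have hle : ∫ ω, ‖∑ i, a i * W i ω‖ ^ 2 ∂P ≤ (κ * M) ^ 2 * Fintype.card ι := by
      rw [integral_norm_sq_sum_of_orthogonal Finset.univ (fun i ω => a i * W i ω) hmem]
      · calc ∑ i, ∫ ω, ‖a i * W i ω‖ ^ 2 ∂P ≤ ∑ _i : ι, (κ * M) ^ 2 := by
              refine Finset.sum_le_sum fun i _ => ?_
              have := integral_mono ((hmem i (Finset.mem_univ i)).integrable_norm_pow
                (by norm_num)) (integrable_const (μ := P) ((κ * M) ^ 2)) fun ω => by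
                  simp only [norm_mul]
                  exact pow_le_pow_left₀ (by positivity)
                    (mul_le_mul (ha i) (hWM i ω) (norm_nonneg _) hκ) 2
              simpa using this
          _ = _ := by simp [mul_comm]
      · intro i _ j _ hij
        have : ∀ ω, a i * W i ω * (starRingEnd ℂ) (a j * W j ω)
            = (a i * (starRingEnd ℂ) (a j)) * (W i ω * (starRingEnd ℂ) (W j ω)) := fun ω => by
          rw [map_mul]; ring
        simp only [this]
        rw [integral_const_mul, horth i j hij, mul_zero]
    refine (lintegral_enorm_le_sqrt (memLp_finsetSum _ hmem) hle).trans_eq ?_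
    rw [Real.sqrt_mul (by positivity), Real.sqrt_sq (by positivity), mul_assoc]
  have h2 : ∫⁻ ω, ‖∑ i, a i * ((max (‖Y i ω‖ ^ 2 - M) 0 - d i : ℝ) : ℂ)‖ₑ ∂P
      ≤ ENNReal.ofReal (κ * (2 * Fintype.card ι * ρ)) := by
    have hb : ∀ ω, ‖∑ i, a i * ((max (‖Y i ω‖ ^ 2 - M) 0 - d i : ℝ) : ℂ)‖
        ≤ ∑ i, κ * (max (‖Y i ω‖ ^ 2 - M) 0 + d i) := fun ω => by
      refine (norm_sum_le _ _).trans (Finset.sum_le_sum fun i _ => ?_)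
      rw [norm_mul, Complex.norm_real, Real.norm_eq_abs]
      refine mul_le_mul (ha i) ?_ (abs_nonneg _) hκ
      have := le_max_right (‖Y i ω‖ ^ 2 - M) 0
      rw [abs_le]
      constructor <;> linarith [hd0 i]
    have hint : Integrable (fun ω => ∑ i, κ * (max (‖Y i ω‖ ^ 2 - M) 0 + d i)) P :=
      integrable_finsetSum _ fun i _ => ((hDint i).add (integrable_const _)).const_mul _
    calc _ ≤ ∫⁻ ω, ENNReal.ofReal (∑ i, κ * (max (‖Y i ω‖ ^ 2 - M) 0 + d i)) ∂P := by
          refine lintegral_mono fun ω => ?_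
          rw [← ofReal_norm]
          exact ENNReal.ofReal_le_ofReal (hb ω)
      _ = ENNReal.ofReal (∫ ω, ∑ i, κ * (max (‖Y i ω‖ ^ 2 - M) 0 + d i) ∂P) := by
          rw [ofReal_integral_eq_lintegral_ofReal hint
            (Eventually.of_forall fun ω => (norm_nonneg _).trans (hb ω))]
      _ ≤ _ := by
          refine ENNReal.ofReal_le_ofReal ?_
          have hint' : ∀ i, Integrable (fun ω => κ * (max (‖Y i ω‖ ^ 2 - M) 0 + d i)) P :=
            fun i => ((hDint i).add (integrable_const _)).const_mul _
          rw [integral_finsetSum _ fun i _ => hint' i]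
          calc ∑ i, ∫ ω, κ * (max (‖Y i ω‖ ^ 2 - M) 0 + d i) ∂P
              ≤ ∑ _i : ι, κ * (2 * ρ) := by
                refine Finset.sum_le_sum fun i _ => ?_
                rw [integral_const_mul, integral_add (hDint i) (integrable_const _)]
                refine mul_le_mul_of_nonneg_left ?_ hκ
                have := hρ i
                simp only [integral_const, probReal_univ, smul_eq_mul, one_mul]
                change d i + d i ≤ 2 * ρ
                change d i ≤ ρ at this
                linarith
            _ = _ := by simp; ring
  have hρ0 : 0 ≤ 2 * Fintype.card ι * ρ := by
    rcases isEmpty_or_nonempty ι with h | ⟨⟨i⟩⟩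
    · simp
    · have := (hd0 i).trans (hρ i); positivity
  have hsplit : ∀ ω, ∑ i, a i * ((‖Y i ω‖ ^ 2 - 1 : ℝ) : ℂ)
      = ∑ i, a i * W i ω + ∑ i, a i * ((max (‖Y i ω‖ ^ 2 - M) 0 - d i : ℝ) : ℂ) := fun ω => by
    rw [← Finset.sum_add_distrib]
    refine Finset.sum_congr rfl fun i _ => ?_
    rw [← mul_add, hW, ← Complex.ofReal_add]
    congr 2
    linarith [hBD i ω, hcd i]
  calc _ ≤ ∫⁻ ω, (‖∑ i, a i * W i ω‖ₑ
        + ‖∑ i, a i * ((max (‖Y i ω‖ ^ 2 - M) 0 - d i : ℝ) : ℂ)‖ₑ) ∂P :=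
        lintegral_mono fun ω => by
          simp only
          rw [hsplit]; exact enorm_add_le _ _
    _ = _ := lintegral_add_left (Finset.measurable_sum _ fun i _ =>
        (hWmeas i).const_mul _).enorm _
    _ ≤ _ := add_le_add h1 h2
    _ = _ := by
        rw [← ENNReal.ofReal_add (by positivity) (by positivity), mul_add]

/-- Concentration of the quadratic form `v (A^* A + u)⁻¹ v^*` about the trace of the resolvent, for
`v = Y + μ` with `Y` standard; the mean `μ` contributes its own quadratic form. -/
theorem lintegral_gramForm_sub_gramTrace_le [IsProbabilityMeasure P] [Fintype ι] [LinearOrder ι]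
    (hY : IsStandardFamily P Y) (A : Matrix ι ι ℂ) {u : ℝ} (hu : 0 < u) (μ : ι → ℂ) {M ρ : ℝ}
    (hM : 0 ≤ M) (hρ : ∀ i, ∫ ω, max (‖Y i ω‖ ^ 2 - M) 0 ∂P ≤ ρ) :
    ∫⁻ ω, ‖gramForm A u (fun i => Y i ω + μ i) - gramTrace A u‖ₑ ∂P
      ≤ ENNReal.ofReal ((2 * √(Fintype.card ι) + (M * √(Fintype.card ι)
          + 2 * Fintype.card ι * ρ) + 2 * √(normSqSum μ)) / u)
        + ENNReal.ofReal (gramForm A u μ) := by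
  classical
  set G := gramResolvent A u with hG
  have hm := hY.measurable
  have mc := Complex.continuous_conj.measurable
  set c : ι → ℂ := Matrix.mulVec G (star μ) with hc
  set T₁ : Ω → ℂ := fun ω => ∑ q : ι × ι with q.1 < q.2,
    G q.1 q.2 * (Y q.1 ω * (starRingEnd ℂ) (Y q.2 ω)) with hT₁
  set T₂ : Ω → ℂ := fun ω => ∑ q : ι × ι with q.1 < q.2,
    (starRingEnd ℂ) (G q.2 q.1) * (Y q.1 ω * (starRingEnd ℂ) (Y q.2 ω)) with hT₂
  set T₃ : Ω → ℂ := fun ω => ∑ i, G i i * ((‖Y i ω‖ ^ 2 - 1 : ℝ) : ℂ) with hT₃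
  set T₄ : Ω → ℂ := fun ω => ∑ i, c i * Y i ω with hT₄
  have mT₁ : Measurable T₁ := Finset.measurable_sum _ fun q _ =>
    ((hm _).mul (mc.comp (hm _))).const_mul _
  have mT₂ : Measurable T₂ := Finset.measurable_sum _ fun q _ =>
    ((hm _).mul (mc.comp (hm _))).const_mul _
  have mT₃ : Measurable T₃ := Finset.measurable_sum _ fun i _ =>
    (Complex.measurable_ofReal.comp (((hm i).norm.pow_const 2).sub_const _)).const_mul _
  have mT₄ : Measurable T₄ := Finset.measurable_sum _ fun i _ => (hm i).const_mul _
  have hquad : ∀ ω, (∑ i, Y i ω * ∑ j, G i j * (starRingEnd ℂ) (Y j ω)) - G.trace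
      = T₁ ω + (starRingEnd ℂ) (T₂ ω) + T₃ ω := by
    intro ω
    have e1 : ∑ i, Y i ω * ∑ j, G i j * (starRingEnd ℂ) (Y j ω)
        = ∑ q : ι × ι, G q.1 q.2 * (Y q.1 ω * (starRingEnd ℂ) (Y q.2 ω)) := by
      rw [Fintype.sum_prod_type]
      refine Finset.sum_congr rfl fun i _ => ?_
      rw [Finset.mul_sum]
      exact Finset.sum_congr rfl fun j _ => by ring
    set F : ι × ι → ℂ := fun q => G q.1 q.2 * (Y q.1 ω * (starRingEnd ℂ) (Y q.2 ω)) with hF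
    have e2 : ∑ q, F q = ∑ q : ι × ι with q.1 < q.2, F q
        + ∑ q : ι × ι with q.2 < q.1, F q + ∑ q : ι × ι with q.1 = q.2, F q := by
      simp only [Finset.sum_filter]
      rw [← Finset.sum_add_distrib, ← Finset.sum_add_distrib]
      refine Finset.sum_congr rfl fun q _ => ?_
      rcases lt_trichotomy q.1 q.2 with h | h | h
      · simp [h, h.not_gt, h.ne]
      · simp [h]
      · simp [h, h.not_gt, h.ne']
    have e3 : ∑ q : ι × ι with q.2 < q.1, F q = (starRingEnd ℂ) (T₂ ω) := by
      rw [hT₂, map_sum, Finset.sum_filter, Finset.sum_filter,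
        ← Equiv.sum_comp (Equiv.prodComm ι ι)]
      refine Finset.sum_congr rfl fun q _ => ?_
      simp only [Equiv.prodComm_apply, Prod.fst_swap, Prod.snd_swap, hF, map_mul,
        Complex.conj_conj]
      split_ifs
      · ring
      · rfl
    have e4 : ∑ q : ι × ι with q.1 = q.2, F q - G.trace = T₃ ω := by
      rw [Finset.sum_filter, Fintype.sum_prod_type, Matrix.trace, ← Finset.sum_sub_distrib]
      refine Finset.sum_congr rfl fun i _ => ?_
      simp only [Finset.sum_ite_eq, Finset.mem_univ, if_true, hF, Matrix.diag_apply,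
        Complex.mul_conj']
      push_cast
      ring
    rw [e1, e2, e3, ← e4]
    ring
  have hform : ∀ ω, gramForm A u (fun i => Y i ω + μ i) - gramTrace A u
      = (T₁ ω + (starRingEnd ℂ) (T₂ ω) + T₃ ω).re + 2 * (T₄ ω).re + gramForm A u μ := by
    intro ω
    have e1 := gramForm_add A hu (fun i => Y i ω) μ
    have e2 : dotProduct (fun i => Y i ω) (Matrix.mulVec G (star μ)) = T₄ ω :=
      Finset.sum_congr rfl fun i _ => mul_comm _ _
    have e3 : gramForm A u (fun i => Y i ω)
        = (∑ i, Y i ω * ∑ j, G i j * (starRingEnd ℂ) (Y j ω)).re := rfl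
    rw [← hG, e2, e3] at e1
    rw [← hquad, Complex.sub_re]
    change gramForm A u ((fun i => Y i ω) + μ) - G.trace.re = _
    rw [e1]
    ring
  have hpt : ∀ ω, ‖gramForm A u (fun i => Y i ω + μ i) - gramTrace A u‖ₑ
      ≤ ‖T₁ ω‖ₑ + (‖T₂ ω‖ₑ + (‖T₃ ω‖ₑ + (2 * ‖T₄ ω‖ₑ + ENNReal.ofReal (gramForm A u μ)))) := by
    intro ω
    have hre : ∀ z : ℂ, ‖z.re‖ₑ ≤ ‖z‖ₑ := fun z => by
      rw [← ofReal_norm, ← ofReal_norm]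
      exact ENNReal.ofReal_le_ofReal (by simpa using Complex.abs_re_le_norm z)
    rw [hform]
    refine (enorm_add_le _ _).trans ?_
    rw [Real.enorm_of_nonneg (gramForm_nonneg A hu μ)]
    refine (add_le_add_left ((enorm_add_le _ _).trans (add_le_add (hre _) le_rfl)) _).trans ?_
    rw [enorm_mul]
    have h2 : ‖(2 : ℝ)‖ₑ = 2 := by
      rw [Real.enorm_of_nonneg (by norm_num)]; simp
    have hc2 : ‖(starRingEnd ℂ) (T₂ ω)‖ₑ = ‖T₂ ω‖ₑ := by
      rw [← ofReal_norm, ← ofReal_norm, RCLike.norm_conj]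
    have h3 : ‖T₁ ω + (starRingEnd ℂ) (T₂ ω) + T₃ ω‖ₑ ≤ ‖T₁ ω‖ₑ + ‖T₂ ω‖ₑ + ‖T₃ ω‖ₑ := by
      refine (enorm_add_le _ _).trans (add_le_add_left ((enorm_add_le _ _).trans ?_) _)
      rw [hc2]
    rw [h2]
    refine (add_le_add_left (add_le_add h3 (mul_le_mul_right (hre _) 2)) _).trans (le_of_eq ?_)
    ring
  set n : ℝ := ((Fintype.card ι : ℕ) : ℝ) with hn
  have hGsum : ∑ i, ∑ j, ‖G i j‖ ^ 2 ≤ n / u ^ 2 := by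
    rw [Finset.sum_comm]
    refine (Finset.sum_le_sum fun j _ => sum_norm_sq_gramResolvent_col_le A hu j).trans ?_
    simp [hn, div_eq_mul_inv]
  have hGsum' : ∑ i, ∑ j, ‖(starRingEnd ℂ) (G j i)‖ ^ 2 ≤ n / u ^ 2 := by
    rw [Finset.sum_comm]
    simpa using hGsum
  have hsqrt : ∀ x : ℝ, √(x / u ^ 2) = √x / u := fun x => by
    rw [Real.sqrt_div' _ (by positivity), Real.sqrt_sq hu.le]
  have b₁ : ∫⁻ ω, ‖T₁ ω‖ₑ ∂P ≤ ENNReal.ofReal (√n / u) := by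
    rw [← hsqrt]; exact hY.lintegral_sum_lt_le G hGsum
  have b₂ : ∫⁻ ω, ‖T₂ ω‖ₑ ∂P ≤ ENNReal.ofReal (√n / u) := by
    rw [← hsqrt]; exact hY.lintegral_sum_lt_le (fun i j => (starRingEnd ℂ) (G j i)) hGsum'
  have b₃ : ∫⁻ ω, ‖T₃ ω‖ₑ ∂P ≤ ENNReal.ofReal (1 / u * (M * √n + 2 * n * ρ)) :=
    hY.lintegral_sum_norm_sq_sub_one_le (fun i => G i i) (by positivity)
      (fun i => norm_gramResolvent_diag_le A hu i) hM hρ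
  have b₄ : ∫⁻ ω, ‖T₄ ω‖ₑ ∂P ≤ ENNReal.ofReal (√(normSqSum μ) / u) := by
    have := hY.integral_norm_sq_sum Finset.univ c
    rw [← hsqrt]
    exact lintegral_enorm_le_sqrt this.1
      (this.2.le.trans (normSqSum_gramResolvent_le A hu μ))
  have hρ0 : 0 ≤ 2 * n * ρ := by
    rcases isEmpty_or_nonempty ι with h | ⟨⟨i⟩⟩
    · simp [hn]
    · have := (integral_nonneg fun ω => le_max_right (‖Y i ω‖ ^ 2 - M) 0).trans (hρ i)
      positivity
  calc _ ≤ ∫⁻ ω, (‖T₁ ω‖ₑ + (‖T₂ ω‖ₑ + (‖T₃ ω‖ₑ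
        + (2 * ‖T₄ ω‖ₑ + ENNReal.ofReal (gramForm A u μ))))) ∂P := lintegral_mono hpt
    _ = ∫⁻ ω, ‖T₁ ω‖ₑ ∂P + (∫⁻ ω, ‖T₂ ω‖ₑ ∂P + (∫⁻ ω, ‖T₃ ω‖ₑ ∂P
        + (2 * ∫⁻ ω, ‖T₄ ω‖ₑ ∂P + ENNReal.ofReal (gramForm A u μ)))) := by
      rw [lintegral_add_left mT₁.enorm, lintegral_add_left mT₂.enorm,
        lintegral_add_left mT₃.enorm, lintegral_add_left (mT₄.enorm.const_mul 2),
        lintegral_const_mul _ mT₄.enorm, lintegral_const, measure_univ, mul_one]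
    _ ≤ ENNReal.ofReal (√n / u) + (ENNReal.ofReal (√n / u)
        + (ENNReal.ofReal (1 / u * (M * √n + 2 * n * ρ))
        + (ENNReal.ofReal 2 * ENNReal.ofReal (√(normSqSum μ) / u)
          + ENNReal.ofReal (gramForm A u μ)))) := by
      rw [ENNReal.ofReal_ofNat]
      gcongr
    _ = _ := by
      rw [← ENNReal.ofReal_mul (by norm_num), ← add_assoc, ← add_assoc, ← add_assoc]
      congr 1
      rw [← ENNReal.ofReal_add (by positivity) (by positivity),
        ← ENNReal.ofReal_add (by positivity) (by positivity),
        ← ENNReal.ofReal_add (by positivity) (by positivity)]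
      congr 1
      ring

end IsStandardFamily

end Moments

/-! ### The quadratic forms of the rows are close to the traces -/

section RowForm

variable {Ω : Type*} [MeasurableSpace Ω] {P : Measure Ω} [IsProbabilityMeasure P]
  {X : ℕ → ℕ → Ω → ℂ}

theorem IsTriangularIIDArray.isStandardFamily (hX : IsTriangularIIDArray P X) :
    IsStandardFamily P (fun (p : {p : ℕ × ℕ // p.2 ≤ p.1}) ω =>
      X p.1.1 p.1.2 ω - ∫ ω', X 0 0 ω' ∂P) where
  measurable p := (hX.measurable _ _ p.2).sub_const _
  indep := hX.indep.comp (fun _ z => z - ∫ ω', X 0 0 ω' ∂P)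
    fun _ => measurable_id.sub_const _
  memLp p := ((hX.identDistrib _ _ p.2).memLp_iff.mpr hX.memLp).sub (memLp_const _)
  mean p := by
    have h := hX.identDistrib _ _ p.2
    have hint : Integrable (X p.1.1 p.1.2) P :=
      (h.memLp_iff.mpr hX.memLp).integrable (by norm_num)
    rw [integral_sub hint (integrable_const _), h.integral_eq]
    simp
  second p := by
    have h := (hX.identDistrib _ _ p.2).comp (u := fun z : ℂ => ‖z - ∫ ω', X 0 0 ω' ∂P‖ ^ 2)
      (by fun_prop)
    exact h.integral_eq.trans hX.variance_eq_one

/-- The coefficient vector `1 / b` on the last `b` of `k` coordinates. -/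
noncomputable def lastCoeff (k b : ℕ) (i : Fin k) : ℂ := if k ≤ i + b then (b : ℂ)⁻¹ else 0

theorem sum_lastCoeff {k b j : ℕ} (hb : 1 ≤ b) (hbk : b ≤ k) :
    ∃ s : ℝ, 0 ≤ s ∧ s ≤ 1 ∧ (j + b ≤ k → s = 1) ∧
      ∑ i : Fin k, (if j ≤ i then lastCoeff k b i else 0) = (s : ℂ) := by
  have hb0 : (0 : ℝ) < b := by exact_mod_cast hb
  have hsum : ∑ i : Fin k, (if j ≤ i then lastCoeff k b i else 0)
      = (((Finset.Ico (max (k - b) j) k).card * (b : ℝ)⁻¹ : ℝ) : ℂ) := by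
    have h1 := Fin.sum_univ_eq_sum_range
      (fun i => if j ≤ i then (if k ≤ i + b then (b : ℂ)⁻¹ else 0) else 0) k
    rw [show ∑ i : Fin k, (if j ≤ i then lastCoeff k b i else 0) = _ from h1]
    simp only [← ite_and]
    rw [← Finset.sum_filter]
    have h2 : (Finset.range k).filter (fun i => j ≤ i ∧ k ≤ i + b)
        = Finset.Ico (max (k - b) j) k := by
      ext i
      simp only [Finset.mem_filter, Finset.mem_range, Finset.mem_Ico]
      omega
    rw [h2, Finset.sum_const, nsmul_eq_mul]
    push_cast
    rfl
  refine ⟨_, by positivity, ?_, ?_, hsum⟩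
  · rw [← div_eq_mul_inv, div_le_one hb0, Nat.card_Ico]
    exact_mod_cast (by omega : k - max (k - b) j ≤ b)
  · intro hj
    rw [Nat.card_Ico, show k - max (k - b) j = b by omega, mul_inv_cancel₀ hb0.ne']

theorem normSqSum_lastCoeff_le {k b : ℕ} (hb : 1 ≤ b) (hbk : b ≤ k) :
    normSqSum (lastCoeff k b) = 1 / b := by
  have hb0 : (b : ℝ) ≠ 0 := by exact_mod_cast (by omega : b ≠ 0)
  have h1 := Fin.sum_univ_eq_sum_range (fun i => ‖(if k ≤ i + b then (b : ℂ)⁻¹ else 0)‖ ^ 2) k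
  rw [show normSqSum (lastCoeff k b) = _ from h1]
  have h2 : ∀ i, ‖(if k ≤ i + b then (b : ℂ)⁻¹ else 0)‖ ^ 2
      = if k ≤ i + b then ((b : ℝ)⁻¹) ^ 2 else 0 := fun i => by
    split_ifs <;> simp
  simp only [h2]
  rw [← Finset.sum_filter]
  have h3 : (Finset.range k).filter (fun i => k ≤ i + b) = Finset.Ico (k - b) k := by
    ext i
    simp only [Finset.mem_filter, Finset.mem_range, Finset.mem_Ico]
    omega
  rw [h3, Finset.sum_const, Nat.card_Ico, show k - (k - b) = b by omega, nsmul_eq_mul]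
  field_simp

/-- The average of the last `b` rows approximates the mean vector of the next row. -/
theorem integral_norm_sub_vecMul_le (hX : IsTriangularIIDArray P X) {k b : ℕ} (hb : 1 ≤ b)
    (hbk : b ≤ k) (m : ℂ) (hm : m = ∫ ω', X 0 0 ω' ∂P) (j : Fin k) :
    Integrable (fun ω =>
      ‖m - Matrix.vecMul (lastCoeff k b) (triangularMatrix X k ω) j‖ ^ 2) P ∧
    ∫ ω, ‖m - Matrix.vecMul (lastCoeff k b) (triangularMatrix X k ω) j‖ ^ 2 ∂P
      ≤ 2 * (if k < j + b then ‖m‖ ^ 2 else 0) + 2 / b := by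
  have hY := hX.isStandardFamily
  rw [← hm] at hY
  have hYj := hY.precomp (κ := {i : Fin k // j ≤ i})
    (g := fun i => ⟨((i : Fin k), (j : ℕ)), i.2⟩) (fun a b h => by
      simp only [Subtype.mk.injEq, Prod.mk.injEq, and_true] at h
      exact Subtype.ext (Fin.ext h))
  obtain ⟨s, hs0, hs1, hs, hsum⟩ := sum_lastCoeff (j := j) hb hbk
  obtain ⟨hZ, hZ2⟩ := hYj.integral_norm_sq_sum Finset.univ (fun i => lastCoeff k b i)
  set Z : Ω → ℂ := fun ω => ∑ i : {i : Fin k // j ≤ i}, lastCoeff k b i * (X i j ω - m) with hZdef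
  have heq : ∀ ω, m - Matrix.vecMul (lastCoeff k b) (triangularMatrix X k ω) j
      = m * (1 - s) - Z ω := by
    intro ω
    have h1 : Z ω = ∑ i : Fin k, if j ≤ i then lastCoeff k b i * (X i j ω - m) else 0 := by
      rw [← Finset.sum_filter (fun i : Fin k => j ≤ i)]
      exact (Finset.sum_subtype (Finset.univ.filter fun i : Fin k => j ≤ i)
        (p := fun i : Fin k => j ≤ i) (by simp)
        (fun i : Fin k => lastCoeff k b i * (X i j ω - m))).symm
    have h2 : Matrix.vecMul (lastCoeff k b) (triangularMatrix X k ω) j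
        = ∑ i : Fin k, if j ≤ i then lastCoeff k b i * X i j ω else 0 := by
      change ∑ i : Fin k, lastCoeff k b i * triangularMatrix X k ω i j = _
      refine Finset.sum_congr rfl fun i _ => ?_
      rw [triangularMatrix_apply]
      split_ifs <;> simp
    have h3 : Z ω + m * s = ∑ i : Fin k, if j ≤ i then lastCoeff k b i * X i j ω else 0 := by
      rw [h1, ← hsum, Finset.mul_sum, ← Finset.sum_add_distrib]
      refine Finset.sum_congr rfl fun i _ => ?_
      simp only [Fin.le_def]
      split_ifs <;> ring
    rw [h2, ← h3]
    ring
  simp only [heq]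
  have hmem : MemLp (fun ω => m * (1 - s) - Z ω) 2 P := (memLp_const _).sub hZ
  refine ⟨hmem.integrable_norm_pow (by norm_num), ?_⟩
  have hZint : Integrable (fun ω => ‖Z ω‖ ^ 2) P := hZ.integrable_norm_pow (by norm_num)
  have hle : ∀ ω, ‖m * (1 - s) - Z ω‖ ^ 2 ≤ 2 * ‖m * (1 - (s : ℂ))‖ ^ 2 + 2 * ‖Z ω‖ ^ 2 := by
    intro ω
    have h1 := norm_sub_le (m * (1 - (s : ℂ))) (Z ω)
    have h2 := pow_le_pow_left₀ (norm_nonneg _) h1 2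
    nlinarith [sq_nonneg (‖m * (1 - (s : ℂ))‖ - ‖Z ω‖)]
  have hRint : Integrable (fun ω => 2 * ‖m * (1 - (s : ℂ))‖ ^ 2 + 2 * ‖Z ω‖ ^ 2) P :=
    (integrable_const _).add (hZint.const_mul 2)
  refine (integral_mono (hmem.integrable_norm_pow (by norm_num)) hRint hle).trans ?_
  rw [integral_add (integrable_const _) (hZint.const_mul 2), integral_const_mul, integral_const_mul,
    show ∫ ω, ‖Z ω‖ ^ 2 ∂P = _ from hZ2]
  have h1 : ∑ i : {i : Fin k // j ≤ i}, ‖lastCoeff k b i‖ ^ 2 ≤ 1 / b := by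
    rw [← normSqSum_lastCoeff_le hb hbk, normSqSum]
    rw [← Finset.sum_subtype (Finset.univ.filter fun i : Fin k => j ≤ i)
      (p := fun i : Fin k => j ≤ i) (by simp) (fun i => ‖lastCoeff k b i‖ ^ 2)]
    exact Finset.sum_le_sum_of_subset_of_nonneg (Finset.filter_subset _ _)
      fun _ _ _ => by positivity
  have h2 : ‖m * (1 - (s : ℂ))‖ ^ 2 ≤ if k < j + b then ‖m‖ ^ 2 else 0 := by
    split_ifs with h
    · have : ‖(1 - (s : ℂ))‖ ≤ 1 := by
        rw [← Complex.ofReal_one, ← Complex.ofReal_sub, Complex.norm_real, Real.norm_eq_abs,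
          abs_le]
        constructor <;> linarith
      rw [norm_mul]
      exact pow_le_pow_left₀ (by positivity) (mul_le_of_le_one_right (norm_nonneg _) this) 2
    · rw [hs (by omega)]; simp
  simp only [integral_const, probReal_univ, smul_eq_mul, one_mul]
  calc _ ≤ 2 * (if k < j + b then ‖m‖ ^ 2 else 0) + 2 * (1 / (b : ℝ)) := by gcongr
    _ = _ := by ring

/-- The quadratic form at the (constant) mean of a row is small in mean: that mean is close to the
average of the previous `b` rows, where `gramForm_vecMul_le` applies. -/
theorem lintegral_gramForm_mean_le (hX : IsTriangularIIDArray P X) {k b : ℕ} (hb : 1 ≤ b)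
    (hbk : b ≤ k) {u : ℝ} (hu : 0 < u) (m : ℂ) (hm : m = ∫ ω', X 0 0 ω' ∂P) :
    ∫⁻ ω, ENNReal.ofReal (gramForm (triangularMatrix X k ω) u fun _ => m) ∂P
      ≤ ENNReal.ofReal (2 / b + (2 / u) * (2 * b * ‖m‖ ^ 2 + 2 * k / b)) := by
  set D : Ω → ℝ := fun ω =>
    ∑ j, ‖m - Matrix.vecMul (lastCoeff k b) (triangularMatrix X k ω) j‖ ^ 2 with hD
  have hint := fun j => (integral_norm_sub_vecMul_le hX hb hbk m hm j).1
  have hDint : Integrable D P := integrable_finsetSum _ fun j _ => hint j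
  have hDle : ∫ ω, D ω ∂P ≤ 2 * b * ‖m‖ ^ 2 + 2 * k / b := by
    rw [hD, integral_finsetSum _ fun j _ => hint j]
    refine (Finset.sum_le_sum fun j _ =>
      (integral_norm_sub_vecMul_le hX hb hbk m hm j).2).trans ?_
    rw [Finset.sum_add_distrib, ← Finset.mul_sum,
      Fin.sum_univ_eq_sum_range (fun j => if k < j + b then ‖m‖ ^ 2 else 0) k,
      ← Finset.sum_filter, Finset.sum_const, nsmul_eq_mul]
    have h3 : ((Finset.range k).filter (fun j => k < j + b)).card ≤ b := by
      have : (Finset.range k).filter (fun j => k < j + b) ⊆ Finset.Ico (k - b) k := by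
        intro i
        simp only [Finset.mem_filter, Finset.mem_range, Finset.mem_Ico]
        omega
      refine (Finset.card_le_card this).trans ?_
      rw [Nat.card_Ico]; omega
    have h4 : (((Finset.range k).filter (fun j => k < j + b)).card : ℝ) ≤ b := by
      exact_mod_cast h3
    simp only [Finset.sum_const, Finset.card_univ, Fintype.card_fin, nsmul_eq_mul]
    have := mul_le_mul_of_nonneg_right h4 (sq_nonneg ‖m‖)
    have e : (k : ℝ) * (2 / b) = 2 * k / b := by ring
    rw [e]
    linarith
  have hpt : ∀ ω, gramForm (triangularMatrix X k ω) u (fun _ => m) ≤ 2 / b + (2 / u) * D ω := by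
    intro ω
    set A := triangularMatrix X k ω
    have h1 := gramForm_add_le A hu (Matrix.vecMul (lastCoeff k b) A)
      ((fun _ => m) - Matrix.vecMul (lastCoeff k b) A)
    rw [add_sub_cancel] at h1
    have h2 := gramForm_vecMul_le A hu (lastCoeff k b)
    have h3 := gramForm_le A hu ((fun _ => m) - Matrix.vecMul (lastCoeff k b) A)
    rw [normSqSum_lastCoeff_le hb hbk] at h2
    have h4 : normSqSum ((fun _ => m) - Matrix.vecMul (lastCoeff k b) A) = D ω := rfl
    rw [h4] at h3
    calc _ ≤ _ := h1
      _ ≤ 2 * (1 / b) + 2 * (D ω / u) := by gcongr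
      _ = _ := by ring
  calc _ ≤ ∫⁻ ω, ENNReal.ofReal (2 / b + (2 / u) * D ω) ∂P :=
        lintegral_mono fun ω => ENNReal.ofReal_le_ofReal (hpt ω)
    _ = ENNReal.ofReal (∫ ω, (2 / b + (2 / u) * D ω) ∂P) := by
        have hRint : Integrable (fun ω => 2 / b + (2 / u) * D ω) P :=
          (integrable_const _).add (hDint.const_mul _)
        rw [ofReal_integral_eq_lintegral_ofReal hRint (Eventually.of_forall fun ω =>
            (gramForm_nonneg _ hu _).trans (hpt ω))]
    _ ≤ _ := by
        refine ENNReal.ofReal_le_ofReal ?_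
        rw [integral_add (integrable_const _) (hDint.const_mul _), integral_const_mul]
        simp only [integral_const, probReal_univ, smul_eq_mul, one_mul]
        gcongr

omit [IsProbabilityMeasure P] in
theorem measurable_triangularMatrix (hX : IsTriangularIIDArray P X) (k : ℕ) :
    Measurable fun ω => (fun i j => triangularMatrix X k ω i j : Fin k → Fin k → ℂ) := by
  refine measurable_pi_lambda _ fun i => measurable_pi_lambda _ fun j => ?_
  simp only [triangularMatrix_apply]
  split_ifs with h
  · exact hX.measurable _ _ h
  · exact measurable_const

omit [IsProbabilityMeasure P] in
theorem measurable_triangularRow (hX : IsTriangularIIDArray P X) (k : ℕ) :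
    Measurable (triangularRow X k) :=
  measurable_pi_lambda _ fun j => hX.measurable _ _ j.2.le

omit [IsProbabilityMeasure P] in
theorem indepFun_triangularMatrix_triangularRow (hX : IsTriangularIIDArray P X) (k : ℕ) :
    IndepFun (fun ω => (fun i j => triangularMatrix X k ω i j : Fin k → Fin k → ℂ))
      (triangularRow X k) P := by
  let S : Finset {p : ℕ × ℕ // p.2 ≤ p.1} := (Finset.range k ×ˢ Finset.range k).subtype _
  let T : Finset {p : ℕ × ℕ // p.2 ≤ p.1} := ({k} ×ˢ Finset.range k).subtype _
  have hST : Disjoint S T := by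
    rw [Finset.disjoint_left]
    intro p hp hp'
    simp only [S, T, Finset.mem_subtype, Finset.mem_product, Finset.mem_range,
      Finset.mem_singleton] at hp hp'
    omega
  have h := hX.indep.indepFun_finset S T hST fun p => hX.measurable _ _ p.2
  let φ : (S → ℂ) → (Fin k → Fin k → ℂ) := fun g i j =>
    if hij : j ≤ i then g ⟨⟨((i : ℕ), (j : ℕ)), hij⟩, by simp [S]⟩ else 0
  let ψ : (T → ℂ) → (Fin k → ℂ) := fun g j => g ⟨⟨(k, (j : ℕ)), j.2.le⟩, by simp [T]⟩
  have hφ : Measurable φ := by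
    refine measurable_pi_lambda _ fun i => measurable_pi_lambda _ fun j => ?_
    simp only [φ]
    split_ifs with hij
    · exact measurable_pi_apply _
    · exact measurable_const
  have hψ : Measurable ψ := measurable_pi_lambda _ fun j => measurable_pi_apply _
  have h2 := h.comp hφ hψ
  have e1 : (φ ∘ fun ω (p : S) => X p.1.1.1 p.1.1.2 ω)
      = fun ω => (fun i j => triangularMatrix X k ω i j : Fin k → Fin k → ℂ) := by
    funext ω i j
    rw [triangularMatrix_apply]
    rfl
  rw [e1] at h2
  exact h2

theorem continuous_gramForm_sub_gramTrace (k : ℕ) {u : ℝ} (hu : 0 < u) :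
    Continuous fun q : (Fin k → Fin k → ℂ) × (Fin k → ℂ) =>
      gramForm (Matrix.of q.1) u q.2 - gramTrace (Matrix.of q.1) u :=
  (continuous_gramForm (ι := Fin k) hu).sub
    ((continuous_gramTrace (ι := Fin k) hu).comp continuous_fst)

omit [IsProbabilityMeasure P] in
theorem measurable_gramTrace_triangularMatrix (hX : IsTriangularIIDArray P X) (k : ℕ) {u : ℝ}
    (hu : 0 < u) : Measurable fun ω => gramTrace (triangularMatrix X k ω) u := by
  have h : Continuous fun a : Fin k → Fin k → ℂ => gramTrace (Matrix.of a) u :=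
    continuous_gramTrace (ι := Fin k) hu
  exact h.measurable.comp (measurable_triangularMatrix hX k)

omit [IsProbabilityMeasure P] in
theorem measurable_rowForm (hX : IsTriangularIIDArray P X) (k : ℕ) {u : ℝ}
    (hu : 0 < u) : Measurable fun ω => rowForm X u k ω := by
  have h : Continuous fun q : (Fin k → Fin k → ℂ) × (Fin k → ℂ) =>
      gramForm (Matrix.of q.1) u q.2 := continuous_gramForm (ι := Fin k) hu
  have h2 : Measurable fun ω => gramForm (triangularMatrix X k ω) u (triangularRow X k ω) :=
    h.measurable.comp ((measurable_triangularMatrix hX k).prodMk (measurable_triangularRow hX k))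
  exact h2.add (((hX.measurable k k le_rfl).norm.pow_const 2).div_const _)

theorem lintegral_rowForm_sub_gramTrace_le (hX : IsTriangularIIDArray P X) {k b : ℕ} (hb : 1 ≤ b)
    (hbk : b ≤ k) {u : ℝ} (hu : 0 < u) (m : ℂ) (hm : m = ∫ ω', X 0 0 ω' ∂P) {M : ℝ}
    (hM : 0 ≤ M) :
    ∫⁻ ω, ‖gramForm (triangularMatrix X k ω) u (triangularRow X k ω)
        - gramTrace (triangularMatrix X k ω) u‖ₑ ∂P
      ≤ ENNReal.ofReal ((2 * √k + (M * √k
          + 2 * k * ∫ ω, max (‖X 0 0 ω - m‖ ^ 2 - M) 0 ∂P) + 2 * (√k * ‖m‖)) / u)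
        + ENNReal.ofReal (2 / b + (2 / u) * (2 * b * ‖m‖ ^ 2 + 2 * k / b)) := by
  have hY := (hX.isStandardFamily.precomp (κ := Fin k)
    (g := fun j => ⟨(k, (j : ℕ)), j.2.le⟩) (fun a b h => by
      simp only [Subtype.mk.injEq, Prod.mk.injEq, true_and] at h
      exact Fin.ext h))
  rw [← hm] at hY
  have hρ : ∀ j : Fin k, ∫ ω, max (‖X k j ω - m‖ ^ 2 - M) 0 ∂P
      ≤ ∫ ω, max (‖X 0 0 ω - m‖ ^ 2 - M) 0 ∂P := fun j =>
    ((hX.identDistrib k j j.2.le).comp (u := fun z : ℂ => max (‖z - m‖ ^ 2 - M) 0)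
      (Continuous.measurable (by fun_prop))).integral_eq.le
  have hnorm : √(normSqSum fun _ : Fin k => m) = √k * ‖m‖ := by
    simp only [normSqSum, Finset.sum_const, Finset.card_univ, Fintype.card_fin, nsmul_eq_mul]
    rw [Real.sqrt_mul (by positivity), Real.sqrt_sq (norm_nonneg _)]
  set c : ENNReal := ENNReal.ofReal ((2 * √k + (M * √k
          + 2 * k * ∫ ω, max (‖X 0 0 ω - m‖ ^ 2 - M) 0 ∂P) + 2 * (√k * ‖m‖)) / u)
  have hfix : ∀ a : Fin k → Fin k → ℂ,
      ∫⁻ ω, ‖gramForm (Matrix.of a) u (triangularRow X k ω) - gramTrace (Matrix.of a) u‖ₑ ∂P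
        ≤ c + ENNReal.ofReal (gramForm (Matrix.of a) u fun _ => m) := by
    intro a
    have h := hY.lintegral_gramForm_sub_gramTrace_le (Matrix.of a) hu (fun _ => m) hM hρ
    rw [hnorm, Fintype.card_fin] at h
    simp only [sub_add_cancel] at h
    exact h
  have hA := measurable_triangularMatrix hX k
  have h1 := lintegral_le_of_indepFun hA (measurable_triangularRow hX k)
    (indepFun_triangularMatrix_triangularRow hX k)
    (f := fun q => ‖gramForm (Matrix.of q.1) u q.2 - gramTrace (Matrix.of q.1) u‖ₑ)
    (continuous_gramForm_sub_gramTrace k hu).measurable.enorm hfix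
  refine h1.trans ?_
  rw [lintegral_add_left measurable_const, lintegral_const, measure_univ, mul_one]
  exact add_le_add le_rfl (lintegral_gramForm_mean_le hX hb hbk hu m hm)

/-- The quadratic form of the `k`-th row is close, in mean, to the trace of the resolvent. -/
theorem exists_lintegral_rowForm_sub_gramTrace_le (hX : IsTriangularIIDArray P X) {s : ℝ}
    (hs : 0 < s) :
    ∃ e : ℕ → ℝ, Tendsto e atTop (𝓝 0) ∧ ∀ (k : ℕ) (u : ℝ), (k + 1) * s ≤ u →
      ∫⁻ ω, ‖rowForm X u k ω - gramTrace (triangularMatrix X k ω) u‖ₑ ∂P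
        ≤ ENNReal.ofReal (e k) := by
  set m : ℂ := ∫ ω', X 0 0 ω' ∂P with hm
  set v : ℝ := ∫ ω, ‖X 0 0 ω‖ ^ 2 ∂P with hv
  have hv0 : 0 ≤ v := integral_nonneg fun _ => by positivity
  set ρ : ℝ → ℝ := fun M => ∫ ω, max (‖X 0 0 ω - m‖ ^ 2 - M) 0 ∂P with hρ
  have hρ0 : ∀ M, 0 ≤ ρ M := fun M => integral_nonneg fun _ => le_max_right _ _
  have hXm : Integrable (fun ω => ‖X 0 0 ω - m‖ ^ 2) P :=
    (hX.memLp.sub (memLp_const m)).integrable_norm_pow (by norm_num)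
  have hρlim : Tendsto ρ atTop (𝓝 0) := by
    have h : Tendsto ρ atTop (𝓝 (∫ _ω, (0 : ℝ) ∂P)) := by
      refine tendsto_integral_filter_of_dominated_convergence (fun ω => ‖X 0 0 ω - m‖ ^ 2)
        ?_ ?_ hXm ?_
      · exact Eventually.of_forall fun M =>
          ((hXm.sub (integrable_const M)).sup (integrable_const 0)).aestronglyMeasurable
      · filter_upwards [eventually_ge_atTop (0 : ℝ)] with M hM
        refine Eventually.of_forall fun ω => ?_
        rw [Real.norm_of_nonneg (le_max_right _ _)]
        exact max_le (by linarith) (by positivity)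
      · refine Eventually.of_forall fun ω => tendsto_const_nhds.congr' ?_
        filter_upwards [eventually_ge_atTop (‖X 0 0 ω - m‖ ^ 2)] with M hM
        rw [max_eq_right (by linarith)]
    simpa using h
  have hdiag : ∀ k u, 0 < u →
      ∫⁻ ω, ‖‖X k k ω‖ ^ 2 / u‖ₑ ∂P = ENNReal.ofReal (v / u) := by
    intro k u hu
    have hid := (hX.identDistrib k k le_rfl)
    have hint : Integrable (fun ω => ‖X k k ω‖ ^ 2 / u) P :=
      ((hid.memLp_iff.mpr hX.memLp).integrable_norm_pow (by norm_num)).div_const _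
    have h1 : ∫ ω, ‖X k k ω‖ ^ 2 / u ∂P = v / u := by
      rw [integral_div]
      congr 1
      exact (hid.comp (u := fun z : ℂ => ‖z‖ ^ 2) (by fun_prop)).integral_eq
    rw [← h1, ofReal_integral_eq_lintegral_ofReal hint
      (Eventually.of_forall fun ω => by positivity)]
    exact lintegral_congr fun ω => Real.enorm_of_nonneg (by positivity)
  have hsplit : ∀ k u, 0 < u → ∫⁻ ω, ‖rowForm X u k ω - gramTrace (triangularMatrix X k ω) u‖ₑ ∂P
      ≤ ∫⁻ ω, ‖gramForm (triangularMatrix X k ω) u (triangularRow X k ω)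
          - gramTrace (triangularMatrix X k ω) u‖ₑ ∂P + ENNReal.ofReal (v / u) := by
    intro k u hu
    have hmeas : Measurable fun ω => ‖gramForm (triangularMatrix X k ω) u (triangularRow X k ω)
          - gramTrace (triangularMatrix X k ω) u‖ₑ :=
      ((continuous_gramForm_sub_gramTrace k hu).measurable.comp
        ((measurable_triangularMatrix hX k).prodMk (measurable_triangularRow hX k))).enorm
    rw [← hdiag k u hu, ← lintegral_add_left hmeas]
    refine lintegral_mono fun ω => ?_
    refine le_trans (le_of_eq ?_) (enorm_add_le _ _)
    rw [rowForm]
    congr 1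
    ring
  set e : ℕ → ℝ := fun k =>
    ((2 + 2 * ‖m‖ + 4 * ‖m‖ ^ 2) * (√k)⁻¹ + (√√k)⁻¹ + 2 * ρ (√√k) + 4 * (Nat.sqrt k : ℝ)⁻¹
      + v * (k : ℝ)⁻¹) / s + 2 * (Nat.sqrt k : ℝ)⁻¹ with he
  refine ⟨fun k => if k = 0 then v / s else e k, ?_, ?_⟩
  · have h1 : Tendsto (fun k : ℕ => √(k : ℝ)) atTop atTop :=
      Real.tendsto_sqrt_atTop.comp tendsto_natCast_atTop_atTop
    have h2 : Tendsto (fun k : ℕ => √√(k : ℝ)) atTop atTop := Real.tendsto_sqrt_atTop.comp h1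
    have h3 : Tendsto (fun k : ℕ => (Nat.sqrt k : ℝ)) atTop atTop := by
      refine tendsto_natCast_atTop_atTop.comp (tendsto_atTop.mpr fun b => ?_)
      filter_upwards [eventually_ge_atTop (b * b)] with k hk
      exact Nat.le_sqrt.mpr hk
    have h4 : Tendsto e atTop (𝓝 (((2 + 2 * ‖m‖ + 4 * ‖m‖ ^ 2) * 0 + 0 + 2 * 0 + 4 * 0
        + v * 0) / s + 2 * 0)) :=
      (((((((tendsto_inv_atTop_zero.comp h1).const_mul _).add
        (tendsto_inv_atTop_zero.comp h2)).add ((hρlim.comp h2).const_mul _)).add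
        ((tendsto_inv_atTop_zero.comp h3).const_mul _)).add
        ((tendsto_inv_atTop_zero.comp tendsto_natCast_atTop_atTop).const_mul _)).div_const s).add
        ((tendsto_inv_atTop_zero.comp h3).const_mul _)
    simp only [mul_zero, add_zero, zero_div] at h4
    refine h4.congr' ?_
    filter_upwards [eventually_ne_atTop 0] with k hk
    rw [if_neg hk]
  · intro k u hku
    have hu : 0 < u := lt_of_lt_of_le (by positivity) hku
    refine (hsplit k u hu).trans ?_
    rcases Nat.eq_zero_or_pos k with rfl | hk
    · have h0 : ∀ ω, gramForm (triangularMatrix X 0 ω) u (triangularRow X 0 ω)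
          - gramTrace (triangularMatrix X 0 ω) u = 0 := fun ω => by
        simp [gramForm, gramTrace, Matrix.trace, dotProduct]
      simp only [h0, enorm_zero, lintegral_zero, zero_add, if_true]
      refine ENNReal.ofReal_le_ofReal ?_
      gcongr
      simpa using hku
    · simp only [if_neg hk.ne']
      have hk0 : (0 : ℝ) < k := by exact_mod_cast hk
      have hb : 1 ≤ Nat.sqrt k := Nat.le_sqrt.mpr (by omega)
      have hb0 : (0 : ℝ) < Nat.sqrt k := by exact_mod_cast hb
      have hbk : Nat.sqrt k ≤ k := Nat.sqrt_le_self k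
      have hbs : (Nat.sqrt k : ℝ) ≤ √k := Real.nat_sqrt_le_real_sqrt
      have hks : k * s ≤ u := by nlinarith
      refine (add_le_add_left (lintegral_rowForm_sub_gramTrace_le hX hb hbk hu m hm
        (Real.sqrt_nonneg (√(k : ℝ)))) _).trans ?_
      change ENNReal.ofReal ((2 * √k + (√√k * √k + 2 * k * ρ (√√k)) + 2 * (√k * ‖m‖)) / u)
        + _ + _ ≤ _
      have hρk := hρ0 (√√k)
      rw [← ENNReal.ofReal_add (by positivity) (by positivity),
        ← ENNReal.ofReal_add (by positivity) (by positivity)]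
      refine ENNReal.ofReal_le_ofReal ?_
      have hq : 0 < √(k : ℝ) := Real.sqrt_pos.mpr hk0
      have hqq : 0 < √√(k : ℝ) := Real.sqrt_pos.mpr hq
      have hsq : √(k : ℝ) ^ 2 = k := Real.sq_sqrt hk0.le
      have hsqq : √√(k : ℝ) ^ 2 = √k := Real.sq_sqrt hq.le
      set q := √(k : ℝ)
      set w := √q
      set b : ℝ := (Nat.sqrt k : ℝ)
      calc _ ≤ (2 * q + (w * q + 2 * k * ρ w) + 2 * (q * ‖m‖)) / (k * s)
            + (2 / b + (2 / (k * s)) * (2 * q * ‖m‖ ^ 2 + 2 * k / b)) + v / (k * s) := by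
            gcongr
        _ = e k := by
            simp only [he]
            change _ = ((2 + 2 * ‖m‖ + 4 * ‖m‖ ^ 2) * q⁻¹ + w⁻¹ + 2 * ρ w + 4 * b⁻¹
              + v * (k : ℝ)⁻¹) / s + 2 * b⁻¹
            have hkw : (k : ℝ) = w ^ 4 := by rw [← hsq, ← hsqq]; ring
            rw [hkw, ← hsqq]
            field_simp
            ring

end RowForm

/-! ### The limiting equation on the half line -/

section Limit

/-- The Stieltjes transform of a measure on `[0, ∞)` at `-1 / r`. The positive part `max x 0` makes
the integrand bounded and continuous on the whole line. -/
noncomputable def stieltjesInv (μ : Measure ℝ) (r : ℝ) : ℝ := ∫ x, r / (1 + r * max x 0) ∂μ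

theorem div_one_add_mul_le {r x : ℝ} (hr : 0 ≤ r) (hx : 0 ≤ x) : r / (1 + r * x) ≤ r :=
  div_le_self hr (by nlinarith [mul_nonneg hr hx])

theorem abs_div_one_add_mul_sub_le {r r' x : ℝ} (hr : 0 ≤ r) (hr' : 0 ≤ r') (hx : 0 ≤ x) :
    |r / (1 + r * x) - r' / (1 + r' * x)| ≤ |r - r'| := by
  have h1 : 1 ≤ 1 + r * x := by nlinarith [mul_nonneg hr hx]
  have h2 : 1 ≤ 1 + r' * x := by nlinarith [mul_nonneg hr' hx]
  rw [div_sub_div _ _ (by positivity) (by positivity), abs_div]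
  have : r * (1 + r' * x) - (1 + r * x) * r' = r - r' := by ring
  rw [this]
  refine div_le_self (abs_nonneg _) ?_
  rw [abs_of_pos (by positivity)]
  nlinarith

theorem integrable_div_one_add_mul (μ : Measure ℝ) [IsFiniteMeasure μ] {r : ℝ} (hr : 0 ≤ r) :
    Integrable (fun x => r / (1 + r * max x 0)) μ := by
  refine Integrable.of_bound (C := r) ?_ (Eventually.of_forall fun x => ?_)
  · refine Measurable.aestronglyMeasurable ?_
    fun_prop
  · have hx : 0 ≤ max x 0 := le_max_right _ _
    rw [Real.norm_of_nonneg (by positivity)]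
    exact div_one_add_mul_le hr hx

theorem stieltjesInv_nonneg (μ : Measure ℝ) {r : ℝ} (hr : 0 ≤ r) : 0 ≤ stieltjesInv μ r :=
  integral_nonneg fun x => by
    have hx : 0 ≤ max x 0 := le_max_right _ _
    positivity

theorem stieltjesInv_le (μ : Measure ℝ) [IsProbabilityMeasure μ] {r : ℝ} (hr : 0 ≤ r) :
    stieltjesInv μ r ≤ r := by
  have := integral_mono (integrable_div_one_add_mul μ hr) (integrable_const r)
    fun x => div_one_add_mul_le hr (le_max_right x 0)
  rw [stieltjesInv]
  simpa using this

theorem abs_stieltjesInv_sub_le (μ : Measure ℝ) [IsProbabilityMeasure μ] {r r' : ℝ}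
    (hr : 0 ≤ r) (hr' : 0 ≤ r') : |stieltjesInv μ r - stieltjesInv μ r'| ≤ |r - r'| := by
  rw [stieltjesInv, stieltjesInv, ← integral_sub (integrable_div_one_add_mul μ hr)
    (integrable_div_one_add_mul μ hr'), ← Real.norm_eq_abs]
  refine (norm_integral_le_of_norm_le_const (C := |r - r'|)
    (Eventually.of_forall fun x => ?_)).trans (by simp)
  exact abs_div_one_add_mul_sub_le hr hr' (le_max_right x 0)

theorem continuousOn_stieltjesInv (μ : Measure ℝ) [IsProbabilityMeasure μ] :
    ContinuousOn (stieltjesInv μ) (Set.Ici 0) := by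
  refine LipschitzOnWith.continuousOn (K := 1) (LipschitzOnWith.of_dist_le_mul ?_)
  intro r hr r' hr'
  simpa [Real.dist_eq] using abs_stieltjesInv_sub_le μ hr hr'

/-- `M(r) = ∫₀¹ log (1 + S(-1 / (t r))) dt`. -/
noncomputable def meanLog (μ : Measure ℝ) (r : ℝ) : ℝ :=
  ∫ t in (0 : ℝ)..1, Real.log (1 + stieltjesInv μ (t * r))

theorem intervalIntegrable_natFloor (F : ℕ → ℝ) (k : ℕ) :
    IntervalIntegrable (fun x : ℝ => F ⌊x⌋₊) volume (k : ℝ) ((k + 1 : ℕ) : ℝ) ∧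
      ∫ x in (k : ℝ)..((k + 1 : ℕ) : ℝ), F ⌊x⌋₊ = F k := by
  have hle : (k : ℝ) ≤ ((k + 1 : ℕ) : ℝ) := by exact_mod_cast k.le_succ
  have hcongr : ∀ x ∈ Set.Ioo (k : ℝ) ((k + 1 : ℕ) : ℝ), F k = F ⌊x⌋₊ := by
    intro x hx
    rw [(Nat.floor_eq_iff (by linarith [hx.1, (Nat.cast_nonneg k : (0 : ℝ) ≤ k)])).mpr
      ⟨hx.1.le, by have := hx.2; push_cast at this; exact this⟩]
  constructor
  · rw [intervalIntegrable_iff_integrableOn_Ioo_of_le hle]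
    exact (integrableOn_const (by simp) (by simp)).congr_fun hcongr measurableSet_Ioo
  · rw [intervalIntegral.integral_of_le hle, integral_Ioc_eq_integral_Ioo,
      ← setIntegral_congr_fun measurableSet_Ioo hcongr]
    simp

theorem integral_natFloor_mul (F : ℕ → ℝ) {n : ℕ} (hn : n ≠ 0) :
    ∫ t in (0 : ℝ)..1, F ⌊t * n⌋₊ = (n : ℝ)⁻¹ * ∑ k ∈ Finset.range n, F k := by
  have hn0 : (n : ℝ) ≠ 0 := by exact_mod_cast hn
  rw [intervalIntegral.integral_comp_mul_right (fun x => F ⌊x⌋₊) hn0, zero_mul, one_mul,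
    smul_eq_mul]
  congr 1
  have h := intervalIntegral.sum_integral_adjacent_intervals (a := fun k : ℕ => (k : ℝ)) (n := n)
    (f := fun x : ℝ => F ⌊x⌋₊) (μ := volume) fun k _ => (intervalIntegrable_natFloor F k).1
  rw [Nat.cast_zero] at h
  rw [← h]
  exact Finset.sum_congr rfl fun k _ => (intervalIntegrable_natFloor F k).2

/-- Averages along the diagonal of a locally uniformly convergent sequence of functions. -/
theorem tendsto_average_log {T : ℕ → ℝ → ℝ} {μ : Measure ℝ} [IsProbabilityMeasure μ] {r : ℝ}
    (hr : 0 < r)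
    (h0 : ∀ k y, 0 ≤ y → 0 ≤ T k y) (hle : ∀ k y, 0 ≤ y → T k y ≤ y)
    (hlip : ∀ k y y', 0 ≤ y → 0 ≤ y' → |T k y - T k y'| ≤ |y - y'|)
    (hT : ∀ y, 0 < y → Tendsto (fun k => T k y) atTop (𝓝 (stieltjesInv μ y))) :
    Tendsto (fun n : ℕ => (n : ℝ)⁻¹ * ∑ k ∈ Finset.range n, Real.log (1 + T k (k * r / n)))
      atTop (𝓝 (meanLog μ r)) := by
  have key : Tendsto (fun n : ℕ => ∫ t in (0 : ℝ)..1,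
      Real.log (1 + T ⌊t * n⌋₊ (⌊t * n⌋₊ * r / n))) atTop (𝓝 (meanLog μ r)) := by
    refine intervalIntegral.tendsto_integral_filter_of_dominated_convergence (fun _ => r)
      ?_ ?_ (by simp) ?_
    · refine Eventually.of_forall fun n => Measurable.aestronglyMeasurable ?_
      exact (measurable_from_nat (f := fun k : ℕ => Real.log (1 + T k (k * r / n)))).comp
        (Nat.measurable_floor.comp (measurable_id.mul_const _))
    · filter_upwards [eventually_gt_atTop 0] with n hn
      refine Eventually.of_forall fun t ht => ?_
      rw [Set.uIoc_of_le zero_le_one] at ht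
      have hn0 : (0 : ℝ) < n := by exact_mod_cast hn
      have hy0 : 0 ≤ (⌊t * n⌋₊ : ℝ) * r / n := by positivity
      have hyr : (⌊t * n⌋₊ : ℝ) * r / n ≤ r := by
        rw [div_le_iff₀ hn0, mul_comm r]
        refine mul_le_mul_of_nonneg_right ?_ hr.le
        exact (Nat.floor_le (by have := ht.1; positivity)).trans
          (mul_le_of_le_one_left hn0.le ht.2)
      have h1 := h0 ⌊t * n⌋₊ _ hy0
      have h2 := hle ⌊t * n⌋₊ _ hy0
      rw [Real.norm_of_nonneg (Real.log_nonneg (by linarith))]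
      have := Real.log_le_sub_one_of_pos (x := 1 + T ⌊t * n⌋₊ (⌊t * n⌋₊ * r / n)) (by linarith)
      linarith
    · refine Eventually.of_forall fun t ht => ?_
      rw [Set.uIoc_of_le zero_le_one] at ht
      have ht0 := ht.1
      have hk : Tendsto (fun n : ℕ => ⌊t * n⌋₊) atTop atTop :=
        tendsto_nat_floor_atTop.comp (tendsto_natCast_atTop_atTop.const_mul_atTop ht0)
      have hy : Tendsto (fun n : ℕ => (⌊t * n⌋₊ : ℝ) * r / n) atTop (𝓝 (t * r)) := by
        have h := ((tendsto_nat_floor_mul_div_atTop ht0.le).comp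
          (tendsto_natCast_atTop_atTop (R := ℝ))).mul_const r
        refine h.congr fun n => ?_
        simp only [Function.comp_apply]
        ring
      have h1 : Tendsto (fun n : ℕ => T ⌊t * n⌋₊ (t * r)) atTop (𝓝 (stieltjesInv μ (t * r))) :=
        (hT _ (by positivity)).comp hk
      have h2 : Tendsto (fun n : ℕ => T ⌊t * n⌋₊ (⌊t * n⌋₊ * r / n) - T ⌊t * n⌋₊ (t * r))
          atTop (𝓝 0) := by
        refine squeeze_zero_norm (a := fun n : ℕ => |(⌊t * n⌋₊ : ℝ) * r / n - t * r|)
          (fun n => hlip _ _ _ (by positivity) (by positivity)) ?_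
        have := (hy.sub_const (t * r)).abs
        simpa using this
      have h3 := (h2.add h1).const_add 1
      simp only [sub_add_cancel, zero_add] at h3
      refine h3.log ?_
      have := stieltjesInv_nonneg μ (r := t * r) (by positivity)
      positivity
  refine key.congr' ?_
  filter_upwards [eventually_ne_atTop 0] with n hn
  exact integral_natFloor_mul (fun k => Real.log (1 + T k (k * r / n))) hn

end Limit

section RandomLimit

variable {Ω : Type*} [MeasurableSpace Ω] {P : Measure Ω} [IsProbabilityMeasure P]
  {X : ℕ → ℕ → Ω → ℂ}

/-- The Stieltjes transform of the empirical distribution of the `k`-th matrix at `-1 / y`. -/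
noncomputable def empiricalStieltjes {Ω : Type*} (X : ℕ → ℕ → Ω → ℂ) (ω : Ω) (k : ℕ) (y : ℝ) : ℝ :=
  (k : ℝ)⁻¹ * ∑ i, y / (1 + y * (sampleMatrix_isHermitian X k ω).eigenvalues i)

theorem empiricalStieltjes_succ {Ω : Type*} (X : ℕ → ℕ → Ω → ℂ) (ω : Ω) (k : ℕ) (y : ℝ) :
    empiricalStieltjes X ω (k + 1) y
      = stieltjesInv (empiricalDistribution X (k + 1) ω : Measure ℝ) y := by
  rw [stieltjesInv, integral_empiricalDistribution, empiricalStieltjes]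
  congr 1
  exact Finset.sum_congr rfl fun i _ => by
    rw [max_eq_left (sampleMatrix_eigenvalues_nonneg X (k + 1) ω i)]

theorem empiricalStieltjes_zero {Ω : Type*} (X : ℕ → ℕ → Ω → ℂ) (ω : Ω) (y : ℝ) :
    empiricalStieltjes X ω 0 y = 0 := by
  simp [empiricalStieltjes]

theorem gramTrace_eq_empiricalStieltjes {Ω : Type*} (X : ℕ → ℕ → Ω → ℂ) (ω : Ω) (k : ℕ) {u : ℝ}
    (hu : 0 < u) :
    gramTrace (triangularMatrix X k ω) u = empiricalStieltjes X ω k (k / u) := by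
  rcases Nat.eq_zero_or_pos k with rfl | hk
  · rw [empiricalStieltjes_zero]
    simp [gramTrace, Matrix.trace]
  · exact gramTrace_triangularMatrix X hk.ne' ω hu

/-- `log ((1 + r x) / (1 + r' x))`, which is bounded in `x ≥ 0`. -/
noncomputable def logRatio (r r' x : ℝ) : ℝ :=
  Real.log (1 + r * max x 0) - Real.log (1 + r' * max x 0)

theorem continuous_logRatio {r r' : ℝ} (hr : 0 < r) (hr' : 0 < r') :
    Continuous (logRatio r r') := by
  have h : ∀ s : ℝ, 0 < s → Continuous fun x : ℝ => Real.log (1 + s * max x 0) := fun s hs =>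
    Continuous.log (by fun_prop) fun x => by
      have : 0 ≤ max x 0 := le_max_right _ _
      positivity
  exact (h r hr).sub (h r' hr')

theorem abs_logRatio_le {r r' : ℝ} (hr : 0 < r) (hr' : 0 < r') (x : ℝ) :
    |logRatio r r' x| ≤ |Real.log r - Real.log r'| := by
  have aux : ∀ s s' : ℝ, 0 < s → s ≤ s' →
      0 ≤ logRatio s' s x ∧ logRatio s' s x ≤ Real.log s' - Real.log s := by
    intro s s' hs hss
    have hx : 0 ≤ max x 0 := le_max_right _ _
    have hs' : 0 < s' := hs.trans_le hss
    rw [logRatio, ← Real.log_div (by positivity) (by positivity),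
      ← Real.log_div (by positivity) (by positivity)]
    constructor
    · refine Real.log_nonneg ((one_le_div (by positivity)).mpr ?_)
      gcongr
    · refine Real.log_le_log (by positivity) ?_
      rw [div_le_div_iff₀ (by positivity) hs]
      nlinarith
  rcases le_total r r' with h | h
  · obtain ⟨h1, h2⟩ := aux r r' hr h
    have e : logRatio r r' x = -logRatio r' r x := by rw [logRatio, logRatio]; ring
    rw [e, abs_neg, abs_of_nonneg h1, abs_sub_comm]
    exact h2.trans (le_abs_self _)
  · obtain ⟨h1, h2⟩ := aux r' r hr' h
    rw [abs_of_nonneg h1]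
    exact h2.trans (le_abs_self _)

/-- The normalised difference, over the first `n` rows, of the quadratic forms and the traces. -/
noncomputable def rowError {Ω : Type*} (X : ℕ → ℕ → Ω → ℂ) (r : ℝ) (n : ℕ) (ω : Ω) : ℝ :=
  (n : ℝ)⁻¹ * ∑ k ∈ Finset.range n, (Real.log (1 + rowForm X (n / r) k ω)
    - Real.log (1 + gramTrace (triangularMatrix X k ω) (n / r)))

omit [IsProbabilityMeasure P] in
theorem measurable_rowError (hX : IsTriangularIIDArray P X) {r : ℝ} (hr : 0 < r) (n : ℕ) :
    Measurable (rowError X r n) := by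
  rcases Nat.eq_zero_or_pos n with rfl | hn
  · have : rowError X r 0 = fun _ => 0 := by ext ω; simp [rowError]
    rw [this]
    exact measurable_const
  have hu : 0 < (n : ℝ) / r := by
    have : (0 : ℝ) < n := by exact_mod_cast hn
    positivity
  refine (Finset.measurable_sum _ fun k _ => ?_).const_mul _
  have h1 := measurable_gramTrace_triangularMatrix hX k hu
  have h3 := measurable_rowForm hX k hu
  exact (Real.measurable_log.comp (h3.const_add 1)).sub
    (Real.measurable_log.comp (h1.const_add 1))

theorem abs_log_one_add_sub_le {a b : ℝ} (ha : 0 ≤ a) (hb : 0 ≤ b) :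
    |Real.log (1 + a) - Real.log (1 + b)| ≤ |a - b| := by
  have aux : ∀ a b : ℝ, 0 ≤ b → b ≤ a → Real.log (1 + a) - Real.log (1 + b) ≤ a - b := by
    intro a b hb hab
    rw [← Real.log_div (by linarith) (by linarith)]
    refine (Real.log_le_sub_one_of_pos (div_pos (by linarith) (by linarith))).trans ?_
    rw [div_sub_one (by linarith), div_le_iff₀ (by linarith)]
    nlinarith
  rcases le_total a b with h | h
  · rw [abs_sub_comm, abs_sub_comm a, abs_of_nonneg (a := b - a) (by linarith), abs_of_nonneg]
    · exact aux b a ha h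
    · linarith [Real.log_le_log (by linarith : 0 < 1 + a) (by linarith : 1 + a ≤ 1 + b)]
  · rw [abs_of_nonneg (a := a - b) (by linarith), abs_of_nonneg]
    · exact aux a b hb h
    · linarith [Real.log_le_log (by linarith : 0 < 1 + b) (by linarith : 1 + b ≤ 1 + a)]

theorem tendsto_lintegral_rowError (hX : IsTriangularIIDArray P X) {r : ℝ} (hr : 0 < r) :
    Tendsto (fun n => ∫⁻ ω, ‖rowError X r n ω‖ₑ ∂P) atTop (𝓝 0) := by
  obtain ⟨e, he, hle⟩ := exists_lintegral_rowForm_sub_gramTrace_le hX (s := 1 / r) (by positivity)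
  have he' : Tendsto (fun k => |e k|) atTop (𝓝 0) := by simpa using he.abs
  have hces := ENNReal.tendsto_ofReal he'.cesaro
  rw [ENNReal.ofReal_zero] at hces
  refine tendsto_of_tendsto_of_tendsto_of_le_of_le tendsto_const_nhds hces
    (fun _ => zero_le) fun n => ?_
  rcases Nat.eq_zero_or_pos n with rfl | hn
  · simp [rowError]
  have hn0 : (0 : ℝ) < n := by exact_mod_cast hn
  have hu : 0 < (n : ℝ) / r := by positivity
  have hmeas : ∀ k, Measurable fun ω => ‖rowForm X ((n : ℝ) / r) k ω
      - gramTrace (triangularMatrix X k ω) ((n : ℝ) / r)‖ₑ :=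
    fun k => ((measurable_rowForm hX k hu).sub
      (measurable_gramTrace_triangularMatrix hX k hu)).enorm
  have hpt : ∀ ω, ‖rowError X r n ω‖ₑ ≤ ENNReal.ofReal (n : ℝ)⁻¹ * ∑ k ∈ Finset.range n,
      ‖rowForm X ((n : ℝ) / r) k ω - gramTrace (triangularMatrix X k ω) ((n : ℝ) / r)‖ₑ := by
    intro ω
    rw [rowError, enorm_mul, Real.enorm_of_nonneg (by positivity)]
    gcongr
    refine (enorm_sum_le _ _).trans (Finset.sum_le_sum fun k _ => ?_)
    rw [← ofReal_norm, ← ofReal_norm]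
    exact ENNReal.ofReal_le_ofReal (abs_log_one_add_sub_le (rowForm_nonneg X hu k ω)
      (gramTrace_nonneg _ hu))
  refine (lintegral_mono hpt).trans ?_
  rw [lintegral_const_mul _ (Finset.measurable_sum _ fun k _ => hmeas k),
    lintegral_finsetSum _ fun k _ => hmeas k, ENNReal.ofReal_mul (by positivity),
    ENNReal.ofReal_sum_of_nonneg fun k _ => abs_nonneg _]
  gcongr with k hk
  refine (hle k _ ?_).trans (ENNReal.ofReal_le_ofReal (le_abs_self _))
  rw [mul_one_div]
  have : (k : ℝ) + 1 ≤ n := by exact_mod_cast Finset.mem_range.mp hk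
  gcongr

theorem measure_Iio_zero_of_tendsto {Ω : Type*} {X : ℕ → ℕ → Ω → ℂ} {ω : Ω}
    {μ₀ : ProbabilityMeasure ℝ}
    (h : Tendsto (fun n : ℕ => empiricalDistribution X (n + 1) ω) atTop (𝓝 μ₀)) :
    (μ₀ : Measure ℝ) (Set.Iio 0) = 0 := by
  have h1 := ProbabilityMeasure.le_liminf_measure_open_of_tendsto h (isOpen_Iio (a := (0 : ℝ)))
  have h2 : ∀ n : ℕ, (empiricalDistribution X (n + 1) ω : Measure ℝ) (Set.Iio 0) = 0 := by
    intro n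
    change ((((n + 1 : ℕ) : ENNReal)⁻¹ • ∑ i : Fin (n + 1),
      Measure.dirac ((sampleMatrix_isHermitian X (n + 1) ω).eigenvalues i) : Measure ℝ)) _ = 0
    rw [Measure.smul_apply, Measure.finsetSum_apply, Finset.sum_eq_zero, smul_zero]
    intro i _
    rw [Measure.dirac_apply' _ measurableSet_Iio, Set.indicator_of_notMem]
    exact not_lt.mpr (sampleMatrix_eigenvalues_nonneg X (n + 1) ω i)
  simp only [h2] at h1
  simpa using h1

/-- The equation `∫ log ((1 + r x) / (1 + r' x)) dμ₀ = M(r) - M(r')`: the normalised log determinant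
is the average of `log (1 + rowForm)`, and `rowForm` may be replaced by the trace of the resolvent
of the preceding rows, which is given by `μ₀` again. -/
theorem integral_logRatio_eq (hX : IsTriangularIIDArray P X) (μ₀ : ProbabilityMeasure ℝ)
    (hμ₀ : ∀ᵐ ω ∂P, Tendsto (fun n : ℕ => empiricalDistribution X (n + 1) ω) atTop (𝓝 μ₀))
    {r r' : ℝ} (hr : 0 < r) (hr' : 0 < r') :
    ∫ x, logRatio r r' x ∂(μ₀ : Measure ℝ) = meanLog (μ₀ : Measure ℝ) r
      - meanLog (μ₀ : Measure ℝ) r' := by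
  set L := ∫ x, logRatio r r' x ∂(μ₀ : Measure ℝ) - (meanLog (μ₀ : Measure ℝ) r
      - meanLog (μ₀ : Measure ℝ) r') with hL
  have hlim : ∀ᵐ ω ∂P, Tendsto (fun n : ℕ => rowError X r (n + 1) ω - rowError X r' (n + 1) ω)
      atTop (𝓝 L) := by
    filter_upwards [hμ₀] with ω hω
    rw [ProbabilityMeasure.tendsto_iff_forall_integral_tendsto] at hω
    have hT : ∀ y, 0 < y → Tendsto (fun k => empiricalStieltjes X ω k y) atTop
        (𝓝 (stieltjesInv (μ₀ : Measure ℝ) y)) := by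
      intro y hy
      rw [← tendsto_add_atTop_iff_nat 1]
      simp only [empiricalStieltjes_succ]
      refine hω (BoundedContinuousFunction.ofNormedAddCommGroup
        (fun x => y / (1 + y * max x 0)) ?_ y fun x => ?_)
      · refine Continuous.div continuous_const (by fun_prop) fun x => ?_
        have : 0 ≤ max x 0 := le_max_right _ _
        positivity
      · have hx : 0 ≤ max x 0 := le_max_right _ _
        rw [Real.norm_of_nonneg (by positivity)]
        exact div_one_add_mul_le hy.le hx
    have hE : Tendsto (fun n : ℕ => ((n + 1 : ℕ) : ℝ)⁻¹ * ∑ i,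
        logRatio r r' ((sampleMatrix_isHermitian X (n + 1) ω).eigenvalues i)) atTop
        (𝓝 (∫ x, logRatio r r' x ∂(μ₀ : Measure ℝ))) := by
      simp only [← integral_empiricalDistribution]
      exact hω (BoundedContinuousFunction.ofNormedAddCommGroup (logRatio r r')
        (continuous_logRatio hr hr') _ (abs_logRatio_le hr hr'))
    have hM : ∀ s, 0 < s → Tendsto (fun n : ℕ => ((n + 1 : ℕ) : ℝ)⁻¹ *
        ∑ k ∈ Finset.range (n + 1),
          Real.log (1 + gramTrace (triangularMatrix X k ω) ((n + 1 : ℕ) / s))) atTop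
        (𝓝 (meanLog (μ₀ : Measure ℝ) s)) := by
      intro s hs
      have h := tendsto_average_log (T := empiricalStieltjes X ω) hs ?_ ?_ ?_ hT
      · refine (h.comp (tendsto_add_atTop_nat 1)).congr fun n => ?_
        simp only [Function.comp_apply]
        congr 1
        refine Finset.sum_congr rfl fun k _ => ?_
        rw [gramTrace_eq_empiricalStieltjes X ω k (by positivity), div_div_eq_mul_div]
      · intro k y hy
        cases k with
        | zero => rw [empiricalStieltjes_zero]
        | succ k => rw [empiricalStieltjes_succ]; exact stieltjesInv_nonneg _ hy
      · intro k y hy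
        cases k with
        | zero => rw [empiricalStieltjes_zero]; exact hy
        | succ k => rw [empiricalStieltjes_succ]; exact stieltjesInv_le _ hy
      · intro k y y' hy hy'
        cases k with
        | zero => rw [empiricalStieltjes_zero, empiricalStieltjes_zero]; simp
        | succ k =>
          rw [empiricalStieltjes_succ, empiricalStieltjes_succ]
          exact abs_stieltjesInv_sub_le _ hy hy'
    have hprod : ∀ s, 0 < s → ∀ n : ℕ, ∑ k ∈ Finset.range (n + 1),
        Real.log (1 + rowForm X ((n + 1 : ℕ) / s) k ω)
        = ∑ i, Real.log (1 + s * (sampleMatrix_isHermitian X (n + 1) ω).eigenvalues i) := by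
      intro s hs n
      rw [← Real.log_prod, ← Real.log_prod, prod_one_add_eigenvalues X n.succ_ne_zero ω hs]
      · intro i _
        have := sampleMatrix_eigenvalues_nonneg X (n + 1) ω i
        positivity
      · intro k _
        have := rowForm_nonneg X (u := (n + 1 : ℕ) / s) (by positivity) k ω
        positivity
    refine (hE.sub ((hM r hr).sub (hM r' hr'))).congr fun n => ?_
    simp only [rowError, Finset.sum_sub_distrib]
    rw [hprod r hr n, hprod r' hr' n]
    have : ∑ i, logRatio r r' ((sampleMatrix_isHermitian X (n + 1) ω).eigenvalues i)
        = ∑ i, Real.log (1 + r * (sampleMatrix_isHermitian X (n + 1) ω).eigenvalues i)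
          - ∑ i, Real.log (1 + r' * (sampleMatrix_isHermitian X (n + 1) ω).eigenvalues i) := by
      rw [← Finset.sum_sub_distrib]
      refine Finset.sum_congr rfl fun i _ => ?_
      rw [logRatio, max_eq_left (sampleMatrix_eigenvalues_nonneg X (n + 1) ω i)]
    rw [this]
    ring
  have hmeas : ∀ n : ℕ, Measurable fun ω =>
      ‖rowError X r (n + 1) ω - rowError X r' (n + 1) ω‖ₑ := fun n =>
    ((measurable_rowError hX hr (n + 1)).sub (measurable_rowError hX hr' (n + 1))).enorm
  have hsum : Tendsto (fun n : ℕ => ∫⁻ ω, ‖rowError X r (n + 1) ω‖ₑ ∂P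
      + ∫⁻ ω, ‖rowError X r' (n + 1) ω‖ₑ ∂P) atTop (𝓝 0) := by
    have := ((tendsto_lintegral_rowError hX hr).add (tendsto_lintegral_rowError hX hr')).comp
      (tendsto_add_atTop_nat 1)
    rw [add_zero] at this
    exact this
  have hzero : Tendsto (fun n : ℕ =>
      ∫⁻ ω, ‖rowError X r (n + 1) ω - rowError X r' (n + 1) ω‖ₑ ∂P) atTop (𝓝 0) := by
    refine tendsto_of_tendsto_of_tendsto_of_le_of_le tendsto_const_nhds hsum
      (fun _ => zero_le) fun n => ?_
    rw [← lintegral_add_left (measurable_rowError hX hr (n + 1)).enorm]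
    exact lintegral_mono fun ω => enorm_sub_le
  have hfatou : ∫⁻ ω, liminf (fun n : ℕ => ‖rowError X r (n + 1) ω - rowError X r' (n + 1) ω‖ₑ)
      atTop ∂P ≤ liminf (fun n : ℕ =>
        ∫⁻ ω, ‖rowError X r (n + 1) ω - rowError X r' (n + 1) ω‖ₑ ∂P) atTop :=
    lintegral_liminf_le hmeas
  have h1 : ∫⁻ ω, liminf (fun n : ℕ => ‖rowError X r (n + 1) ω - rowError X r' (n + 1) ω‖ₑ)
      atTop ∂P = ‖L‖ₑ := by
    rw [lintegral_congr_ae (g := fun _ => ‖L‖ₑ)]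
    · simp
    · filter_upwards [hlim] with ω hω
      exact hω.enorm.liminf_eq
  have h2 : ‖L‖ₑ ≤ 0 := by
    rw [← h1, ← hzero.liminf_eq]
    exact hfatou
  have h3 : L = 0 := by simpa using h2
  linarith

end RandomLimit

/-! ### Solving the limiting equation -/

section Solve

variable {μ : Measure ℝ} [IsProbabilityMeasure μ]

theorem hasDerivAt_stieltjesInv {r : ℝ} (hr : 0 < r) :
    HasDerivAt (stieltjesInv μ) (∫ x, ((1 + r * max x 0) ^ 2)⁻¹ ∂μ) r := by
  refine (hasDerivAt_integral_of_dominated_loc_of_deriv_le (μ := μ)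
    (F := fun r x => r / (1 + r * max x 0)) (F' := fun r x => ((1 + r * max x 0) ^ 2)⁻¹)
    (bound := fun _ => 1) (s := Set.Ioi 0) (Ioi_mem_nhds hr) ?_ ?_ ?_ ?_ (integrable_const _) ?_).2
  · filter_upwards [Ioi_mem_nhds hr] with s hs
    exact (integrable_div_one_add_mul μ (le_of_lt hs)).aestronglyMeasurable
  · exact integrable_div_one_add_mul μ hr.le
  · exact Measurable.aestronglyMeasurable (by fun_prop)
  · refine Eventually.of_forall fun x s hs => ?_
    have hx : 0 ≤ max x 0 := le_max_right _ _
    have hs : 0 < s := hs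
    rw [Real.norm_of_nonneg (by positivity)]
    refine inv_le_one_of_one_le₀ (one_le_pow₀ ?_)
    nlinarith [mul_nonneg hs.le hx]
  · refine Eventually.of_forall fun x s hs => ?_
    have hx : 0 ≤ max x 0 := le_max_right _ _
    have hs : 0 < s := hs
    have h1 : HasDerivAt (fun s : ℝ => 1 + s * max x 0) (max x 0) s := by
      simpa using ((hasDerivAt_id s).mul_const (max x 0)).const_add 1
    have h2 : HasDerivAt (fun s : ℝ => s / (1 + s * max x 0))
        ((1 * (1 + s * max x 0) - s * max x 0) / (1 + s * max x 0) ^ 2) s :=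
      (hasDerivAt_id s).div h1 (by positivity)
    refine h2.congr_deriv ?_
    rw [one_mul, add_sub_cancel_right, one_div]

theorem hasDerivAt_integral_logRatio {r : ℝ} (hr : 0 < r) :
    HasDerivAt (fun r => ∫ x, logRatio r 1 x ∂μ) ((1 - stieltjesInv μ r / r) / r) r := by
  have hval : ∫ x, max x 0 / (1 + r * max x 0) ∂μ = (1 - stieltjesInv μ r / r) / r := by
    have h1 : ∀ x : ℝ, max x 0 / (1 + r * max x 0) = (1 - r / (1 + r * max x 0) / r) / r := by
      intro x
      have hx : 0 ≤ max x 0 := le_max_right _ _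
      have : 1 + r * max x 0 ≠ 0 := by positivity
      field_simp
      ring
    simp only [h1]
    rw [integral_div, integral_sub (integrable_const _)
      ((integrable_div_one_add_mul μ hr.le).div_const r), integral_div]
    simp [stieltjesInv]
  rw [← hval]
  have hr2 : 0 < r / 2 := by positivity
  refine (hasDerivAt_integral_of_dominated_loc_of_deriv_le (μ := μ)
    (F := fun r x => logRatio r 1 x) (F' := fun r x => max x 0 / (1 + r * max x 0))
    (bound := fun _ => 2 / r) (s := Set.Ioi (r / 2)) (Ioi_mem_nhds (by linarith)) ?_ ?_ ?_ ?_
    (integrable_const _) ?_).2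
  · filter_upwards [Ioi_mem_nhds hr] with s hs
    exact (continuous_logRatio hs one_pos).aestronglyMeasurable
  · exact Integrable.of_bound (continuous_logRatio hr one_pos).aestronglyMeasurable _
      (Eventually.of_forall (abs_logRatio_le hr one_pos))
  · exact Measurable.aestronglyMeasurable (by fun_prop)
  · refine Eventually.of_forall fun x s hs => ?_
    have hx : 0 ≤ max x 0 := le_max_right _ _
    have hs : r / 2 < s := hs
    have hs0 : 0 < s := hr2.trans hs
    rw [Real.norm_of_nonneg (by positivity), div_le_div_iff₀ (by positivity) hr]
    nlinarith
  · refine Eventually.of_forall fun x s hs => ?_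
    have hx : 0 ≤ max x 0 := le_max_right _ _
    have hs : r / 2 < s := hs
    have hs0 : 0 < s := hr2.trans hs
    have h1 : HasDerivAt (fun s : ℝ => 1 + s * max x 0) (max x 0) s := by
      simpa using ((hasDerivAt_id s).mul_const (max x 0)).const_add 1
    exact (h1.log (by positivity)).sub_const _

/-- With `c = 1 + S(-1 / r)` and `I(r) = ∫₀^r log c`, the limiting equation differentiates to
`I = r log c - r + (c - 1)`, and then to `r c' / c + c' = 1`; hence `log c - r / c` is constant,
and it tends to `0` at `0`. -/
theorem one_add_stieltjesInv_mul_log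
    (h : ∀ r r', 0 < r → 0 < r' → ∫ x, logRatio r r' x ∂μ = meanLog μ r - meanLog μ r')
    {r : ℝ} (hr : 0 < r) :
    (1 + stieltjesInv μ r) * Real.log (1 + stieltjesInv μ r) = r := by
  set τ := stieltjesInv μ with hτ
  set ρ : ℝ → ℝ := fun y => Real.log (1 + τ y) with hρ
  have hτ0 : ∀ y, 0 ≤ y → 0 ≤ τ y := fun y hy => stieltjesInv_nonneg μ hy
  have hτle : ∀ y, 0 ≤ y → τ y ≤ y := fun y hy => stieltjesInv_le μ hy
  have hρcont : ContinuousOn ρ (Set.Ici 0) :=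
    ((continuousOn_stieltjesInv μ).const_add 1).log fun y hy => by
      have := hτ0 y hy; positivity
  set I : ℝ → ℝ := fun s => ∫ y in (0 : ℝ)..s, ρ y with hI
  have hIderiv : ∀ s, 0 < s → HasDerivAt I (ρ s) s := by
    intro s hs
    refine intervalIntegral.integral_hasDerivAt_right ?_ ?_ ?_
    · refine ContinuousOn.intervalIntegrable (hρcont.mono ?_)
      rw [Set.uIcc_of_le hs.le]
      exact Set.Icc_subset_Ici_self
    · exact ContinuousOn.stronglyMeasurableAtFilter isOpen_Ioi
        (hρcont.mono Set.Ioi_subset_Ici_self) s hs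
    · exact hρcont.continuousAt (Ici_mem_nhds hs)
  have hM : ∀ s, 0 < s → meanLog μ s = s⁻¹ * I s := by
    intro s hs
    rw [meanLog, intervalIntegral.integral_comp_mul_right (fun y => ρ y) hs.ne']
    simp [hI]
  have hI2 : ∀ s, 0 < s → I s = s * ρ s - s + τ s := by
    intro s hs
    have h1 : HasDerivAt (fun s => s⁻¹ * I s - 1⁻¹ * I 1)
        (-(s ^ 2)⁻¹ * I s + s⁻¹ * ρ s) s :=
      ((hasDerivAt_inv hs.ne').mul (hIderiv s hs)).sub_const _
    have h2 := hasDerivAt_integral_logRatio (μ := μ) hs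
    have h3 : (fun r => ∫ x, logRatio r 1 x ∂μ) =ᶠ[𝓝 s] fun s => s⁻¹ * I s - 1⁻¹ * I 1 := by
      filter_upwards [Ioi_mem_nhds hs] with t ht
      rw [h t 1 ht one_pos, hM t ht, hM 1 one_pos]
    have h4 := (h2.congr_of_eventuallyEq h3.symm).unique h1
    rw [← hτ] at h4
    field_simp at h4
    linarith
  have hτderiv := fun s (hs : 0 < s) => hasDerivAt_stieltjesInv (μ := μ) hs
  set τ' : ℝ → ℝ := fun s => ∫ x, ((1 + s * max x 0) ^ 2)⁻¹ ∂μ with hτ'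
  have hρderiv : ∀ s, 0 < s → HasDerivAt ρ (τ' s / (1 + τ s)) s := fun s hs =>
    ((hτderiv s hs).const_add 1).log (by have := hτ0 s hs.le; positivity)
  have hode : ∀ s, 0 < s → s * (τ' s / (1 + τ s)) + τ' s = 1 := by
    intro s hs
    have h1 : HasDerivAt (fun s => s * ρ s - s + τ s)
        (1 * ρ s + s * (τ' s / (1 + τ s)) - 1 + τ' s) s :=
      (((hasDerivAt_id s).mul (hρderiv s hs)).sub (hasDerivAt_id s)).add (hτderiv s hs)
    have h2 : I =ᶠ[𝓝 s] fun s => s * ρ s - s + τ s := by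
      filter_upwards [Ioi_mem_nhds hs] with t ht using hI2 t ht
    have := ((hIderiv s hs).congr_of_eventuallyEq h2.symm).unique h1
    linarith
  set g : ℝ → ℝ := fun s => ρ s - s / (1 + τ s) with hg
  have hgderiv : ∀ s, 0 < s → HasDerivAt g 0 s := by
    intro s hs
    have hc : 0 < 1 + τ s := by have := hτ0 s hs.le; positivity
    have h1 : HasDerivAt g
        (τ' s / (1 + τ s) - (1 * (1 + τ s) - s * τ' s) / (1 + τ s) ^ 2) s :=
      (hρderiv s hs).sub ((hasDerivAt_id s).div ((hτderiv s hs).const_add 1) hc.ne')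
    refine h1.congr_deriv ?_
    have h2 := hode s hs
    rw [← mul_div_assoc, div_add' _ _ _ hc.ne', div_eq_one_iff_eq hc.ne'] at h2
    rw [div_sub_div _ _ hc.ne' (by positivity), div_eq_zero_iff]
    left
    linear_combination (1 + τ s) * h2
  have hconst : ∀ s, 0 < s → g r = g s := fun s hs =>
    isOpen_Ioi.is_const_of_deriv_eq_zero isPreconnected_Ioi
      (fun t ht => (hgderiv t ht).differentiableAt.differentiableWithinAt)
      (fun t ht => (hgderiv t ht).deriv) hr hs
  have hbound : ∀ s, 0 < s → |g s| ≤ s := by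
    intro s hs
    have h0 := hτ0 s hs.le
    have h1 := hτle s hs.le
    have h2 : 0 ≤ ρ s := Real.log_nonneg (by linarith)
    have h3 : ρ s ≤ s := by
      have := Real.log_le_sub_one_of_pos (x := 1 + τ s) (by linarith)
      simp only [hρ]; linarith
    have h4 : s / (1 + τ s) ≤ s := div_le_self hs.le (by linarith)
    have h5 : 0 ≤ s / (1 + τ s) := by positivity
    rw [abs_le]
    constructor <;> simp only [hg] <;> linarith
  have hg0 : g r = 0 := by
    rw [← abs_nonpos_iff]
    refine le_of_forall_pos_le_add fun ε hε => ?_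
    rw [hconst ε hε, zero_add]
    exact hbound ε hε
  have hc : 0 < 1 + τ r := by have := hτ0 r hr.le; positivity
  have : ρ r = r / (1 + τ r) := sub_eq_zero.mp hg0
  change (1 + τ r) * ρ r = r
  rw [this]
  field_simp

end Solve

/-! ### The Stieltjes transform off the support -/

section Stieltjes

variable {μ : Measure ℝ}

theorem norm_inv_ofReal_sub_le {z : ℂ} (hz : z.im ≠ 0) (x : ℝ) :
    ‖((x : ℂ) - z)⁻¹‖ ≤ |z.im|⁻¹ := by
  rw [norm_inv]
  refine inv_anti₀ (abs_pos.mpr hz) ?_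
  simpa using Complex.abs_im_le_norm ((x : ℂ) - z)

theorem integrable_inv_ofReal_sub [IsFiniteMeasure μ] {z : ℂ} (hz : z.im ≠ 0) :
    Integrable (fun x : ℝ => ((x : ℂ) - z)⁻¹) μ :=
  Integrable.of_bound (Measurable.aestronglyMeasurable (by fun_prop)) _
    (Eventually.of_forall (norm_inv_ofReal_sub_le hz))

theorem im_inv_ofReal_sub (x : ℝ) (z : ℂ) :
    (((x : ℂ) - z)⁻¹).im = z.im / ((x - z.re) ^ 2 + z.im ^ 2) := by
  rw [Complex.inv_im, Complex.normSq_apply]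
  simp only [Complex.sub_re, Complex.sub_im, Complex.ofReal_re, Complex.ofReal_im]
  ring_nf

theorem im_stieltjesTransform [IsFiniteMeasure μ] {z : ℂ} (hz : z.im ≠ 0) :
    (stieltjesTransform μ z).im = ∫ x, z.im / ((x - z.re) ^ 2 + z.im ^ 2) ∂μ := by
  rw [stieltjesTransform]
  simp_rw [← im_inv_ofReal_sub]
  exact ((RCLike.imCLM (K := ℂ)).integral_comp_comm (integrable_inv_ofReal_sub hz)).symm

theorem im_stieltjesTransform_pos [IsProbabilityMeasure μ] {z : ℂ} (hz : 0 < z.im) :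
    0 < (stieltjesTransform μ z).im := by
  rw [im_stieltjesTransform hz.ne']
  have hpos : ∀ x : ℝ, 0 < z.im / ((x - z.re) ^ 2 + z.im ^ 2) := fun x => by positivity
  rw [integral_pos_iff_support_of_nonneg (fun x => (hpos x).le)]
  · have : Function.support (fun x : ℝ => z.im / ((x - z.re) ^ 2 + z.im ^ 2)) = Set.univ :=
      Set.eq_univ_of_forall fun x => (hpos x).ne'
    rw [this]
    simp
  · simp_rw [← im_inv_ofReal_sub]
    exact (RCLike.imCLM (K := ℂ)).integrable_comp (integrable_inv_ofReal_sub hz.ne')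

theorem stieltjesTransform_conj (z : ℂ) :
    stieltjesTransform μ (starRingEnd ℂ z) = starRingEnd ℂ (stieltjesTransform μ z) := by
  rw [stieltjesTransform, stieltjesTransform, ← integral_conj]
  simp

theorem stieltjesTransform_neg_inv {r : ℝ} (hr : 0 < r) (hμ : ∀ᵐ x ∂μ, 0 ≤ x) :
    stieltjesTransform μ (-(r : ℂ)⁻¹) = (stieltjesInv μ r : ℂ) := by
  rw [stieltjesTransform, stieltjesInv, ← integral_complex_ofReal]
  refine integral_congr_ae ?_
  filter_upwards [hμ] with x hx
  have h1 : (r : ℂ) ≠ 0 := Complex.ofReal_ne_zero.mpr hr.ne'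
  have h2 : ((1 + r * x : ℝ) : ℂ) ≠ 0 := Complex.ofReal_ne_zero.mpr (by positivity)
  rw [max_eq_left hx]
  push_cast at h2 ⊢
  rw [inv_eq_iff_eq_inv, inv_div]
  field_simp
  ring

/-- The Stieltjes transform is holomorphic off every closed set that carries `μ`. -/
theorem differentiableAt_stieltjesTransform [IsFiniteMeasure μ] {K : Set ℝ} (hK : IsClosed K)
    (hμ : ∀ᵐ x ∂μ, x ∈ K) {z : ℂ} (hz : ∀ x ∈ K, (x : ℂ) ≠ z) :
    DifferentiableAt ℂ (stieltjesTransform μ) z := by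
  have hcl : IsClosed ((fun x : ℝ => (x : ℂ)) '' K) :=
    Complex.isometry_ofReal.isClosedEmbedding.isClosedMap K hK
  have hmem : z ∈ ((fun x : ℝ => (x : ℂ)) '' K)ᶜ := by
    rintro ⟨x, hx, h⟩
    exact hz x hx h
  obtain ⟨d, hd, hball⟩ := Metric.isOpen_iff.mp hcl.isOpen_compl z hmem
  have hlow : ∀ x ∈ K, ∀ s ∈ Metric.ball z (d / 2), d / 2 ≤ ‖(x : ℂ) - s‖ := by
    intro x hx s hs
    have h1 : d ≤ dist (x : ℂ) z := by
      by_contra! h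
      exact hball h ⟨x, hx, rfl⟩
    have h2 := dist_triangle (x : ℂ) s z
    rw [Metric.mem_ball] at hs
    rw [← dist_eq_norm]
    linarith
  refine (hasDerivAt_integral_of_dominated_loc_of_deriv_le (μ := μ)
    (F := fun z x => ((x : ℂ) - z)⁻¹) (F' := fun z x => (((x : ℂ) - z) ^ 2)⁻¹)
    (bound := fun _ => ((d / 2) ^ 2)⁻¹) (s := Metric.ball z (d / 2))
    (Metric.ball_mem_nhds z (by positivity)) ?_ ?_ ?_ ?_ (integrable_const _) ?_).2.differentiableAt
  · exact Eventually.of_forall fun s => Measurable.aestronglyMeasurable (by fun_prop)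
  · refine Integrable.of_bound (Measurable.aestronglyMeasurable (by fun_prop)) (d / 2)⁻¹ ?_
    filter_upwards [hμ] with x hx
    rw [norm_inv]
    exact inv_anti₀ (by positivity) (hlow x hx z (Metric.mem_ball_self (by positivity)))
  · exact Measurable.aestronglyMeasurable (by fun_prop)
  · filter_upwards [hμ] with x hx s hs
    rw [norm_inv, norm_pow]
    exact inv_anti₀ (by positivity) (pow_le_pow_left₀ (by positivity) (hlow x hx s hs) 2)
  · filter_upwards [hμ] with x hx s hs
    have hne : (x : ℂ) - s ≠ 0 := by
      rw [← norm_pos_iff]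
      exact lt_of_lt_of_le (by positivity) (hlow x hx s hs)
    refine (((hasDerivAt_id s).const_sub (x : ℂ)).inv hne).congr_deriv ?_
    simp

end Stieltjes

/-! ### Analytic continuation to the upper half plane -/

section Continuation

variable {μ : Measure ℝ} [IsProbabilityMeasure μ]

theorem one_add_stieltjesTransform_neg_mem_slitPlane (hμ : ∀ᵐ x ∂μ, 0 ≤ x) {ζ : ℂ}
    (hζ : ζ ∈ Complex.slitPlane) : 1 + stieltjesTransform μ (-ζ) ∈ Complex.slitPlane := by
  rcases lt_trichotomy ζ.im 0 with h | h | h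
  · right
    have := im_stieltjesTransform_pos (μ := μ) (z := -ζ) (by simpa using h)
    simpa using this.ne'
  · left
    have hpos : 0 < ζ.re := by
      rcases hζ with h' | h'
      · exact h'
      · exact absurd h h'
    have hval := stieltjesTransform_neg_inv (μ := μ) (inv_pos.mpr hpos) hμ
    have hζ' : ζ = (ζ.re : ℂ) := Complex.ext rfl (by simpa using h)
    rw [Complex.ofReal_inv, inv_inv, ← hζ'] at hval
    have := stieltjesInv_nonneg μ (inv_pos.mpr hpos).le
    rw [hval, Complex.add_re, Complex.ofReal_re, Complex.one_re]
    positivity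
  · right
    have := im_stieltjesTransform_pos (μ := μ) (z := starRingEnd ℂ (-ζ)) (by simpa using h)
    rw [stieltjesTransform_conj, Complex.conj_im] at this
    rw [Complex.add_im, Complex.one_im, zero_add]
    exact (neg_pos.mp this).ne

/-- The equation `C log C = -1 / z` for `C = 1 + S(z)`, known on the negative half line, holds on
`ℂ` cut along the positive half line. -/
theorem one_add_stieltjesTransform_mul_log (hμ : ∀ᵐ x ∂μ, 0 ≤ x)
    (h : ∀ r, 0 < r → (1 + stieltjesInv μ r) * Real.log (1 + stieltjesInv μ r) = r)
    {ζ : ℂ} (hζ : ζ ∈ Complex.slitPlane) :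
    (1 + stieltjesTransform μ (-ζ)) * Complex.log (1 + stieltjesTransform μ (-ζ)) = ζ⁻¹ := by
  have hdiff : DifferentiableOn ℂ (fun ζ => 1 + stieltjesTransform μ (-ζ)) Complex.slitPlane := by
    intro ζ hζ
    have h1 : DifferentiableAt ℂ (stieltjesTransform μ) (-ζ) := by
      refine differentiableAt_stieltjesTransform isClosed_Ici hμ fun x hx hxz => ?_
      have hζ' : ζ = ((-x : ℝ) : ℂ) := by rw [Complex.ofReal_neg, hxz, neg_neg]
      rw [hζ', Complex.ofReal_mem_slitPlane] at hζ
      have : 0 ≤ x := hx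
      linarith
    exact ((h1.comp ζ differentiableAt_id.neg).const_add 1).differentiableWithinAt
  have hf : AnalyticOnNhd ℂ (fun ζ => (1 + stieltjesTransform μ (-ζ)) *
      Complex.log (1 + stieltjesTransform μ (-ζ))) Complex.slitPlane :=
    (hdiff.mul (hdiff.clog fun ζ hζ =>
      one_add_stieltjesTransform_neg_mem_slitPlane hμ hζ)).analyticOnNhd Complex.isOpen_slitPlane
  have hg : AnalyticOnNhd ℂ (fun ζ : ℂ => ζ⁻¹) Complex.slitPlane :=
    (differentiableOn_inv.mono fun ζ hζ => Complex.slitPlane_ne_zero hζ).analyticOnNhd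
      Complex.isOpen_slitPlane
  have hreal : ∀ s : ℝ, 0 < s → (1 + stieltjesTransform μ (-(s : ℂ))) *
      Complex.log (1 + stieltjesTransform μ (-(s : ℂ))) = (s : ℂ)⁻¹ := by
    intro s hs
    have hval := stieltjesTransform_neg_inv (μ := μ) (inv_pos.mpr hs) hμ
    rw [Complex.ofReal_inv, inv_inv] at hval
    have h0 := stieltjesInv_nonneg μ (inv_pos.mpr hs).le
    rw [hval, ← Complex.ofReal_one, ← Complex.ofReal_add, ← Complex.ofReal_log (by positivity),
      ← Complex.ofReal_mul, h _ (inv_pos.mpr hs), Complex.ofReal_inv]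
  have hfreq : ∃ᶠ ζ in 𝓝[≠] (1 : ℂ), (1 + stieltjesTransform μ (-ζ)) *
      Complex.log (1 + stieltjesTransform μ (-ζ)) = ζ⁻¹ := by
    have htend : Tendsto (fun s : ℝ => (s : ℂ)) (𝓝[≠] 1) (𝓝[≠] 1) := by
      refine tendsto_nhdsWithin_iff.mpr ⟨?_, ?_⟩
      · exact (Complex.continuous_ofReal.tendsto' 1 1 (by simp)).mono_left nhdsWithin_le_nhds
      · filter_upwards [self_mem_nhdsWithin] with s hs
        simpa using hs
    refine htend.frequently (Eventually.frequently ?_)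
    filter_upwards [nhdsWithin_le_nhds (Ioi_mem_nhds one_pos)] with s hs using hreal s hs
  exact hf.eqOn_of_preconnected_of_frequently_eq hg
    (Complex.starConvex_one_slitPlane.isPathConnected
      Complex.one_mem_slitPlane).isConnected.isPreconnected
    Complex.one_mem_slitPlane hfreq hζ

/-- On the upper half plane, `log (1 + S(z))` is the point of `lambertUpper` over `-1 / z`. -/
theorem exists_mem_lambertUpper_stieltjesTransform (hμ : ∀ᵐ x ∂μ, 0 ≤ x)
    (h : ∀ r, 0 < r → (1 + stieltjesInv μ r) * Real.log (1 + stieltjesInv μ r) = r)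
    {z : ℂ} (hz : 0 < z.im) :
    ∃ w ∈ lambertUpper, w * Complex.exp w = -z⁻¹ ∧
      stieltjesTransform μ z = -1 + Complex.exp w := by
  have hslit : -z ∈ Complex.slitPlane := Or.inr (by simpa using hz.ne')
  have heq := one_add_stieltjesTransform_mul_log hμ h hslit
  have him := im_stieltjesTransform_pos (μ := μ) hz
  rw [neg_neg, inv_neg] at heq
  set C := 1 + stieltjesTransform μ z with hC
  have hCim : 0 < C.im := by rw [hC, Complex.add_im, Complex.one_im, zero_add]; exact him
  have hC0 : C ≠ 0 := fun h0 => by rw [h0] at hCim; exact lt_irrefl _ hCim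
  have hwexp : Complex.exp (Complex.log C) = C := Complex.exp_log hC0
  have hwim : (Complex.log C).im = C.arg := Complex.log_im C
  have harg0 : 0 < C.arg := by
    refine lt_of_le_of_ne (Complex.arg_nonneg_iff.mpr hCim.le) fun h0 => ?_
    exact hCim.ne' (Complex.arg_eq_zero_iff.mp h0.symm).2
  have heq' : Complex.log C * Complex.exp (Complex.log C) = -z⁻¹ := by
    rw [hwexp, mul_comm, heq]
  refine ⟨Complex.log C, ⟨?_, ?_, ?_⟩, heq', ?_⟩
  · rw [hwim]; exact harg0.le
  · rw [hwim]; exact Complex.arg_le_pi C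
  · have h1 := congrArg Complex.im heq'
    rw [im_mul_exp, Complex.neg_im, Complex.inv_im] at h1
    have h2 : 0 < Complex.normSq z :=
      Complex.normSq_pos.mpr fun h0 => by rw [h0] at hz; exact lt_irrefl _ hz
    have h3 : 0 < -(-z.im / Complex.normSq z) := by
      rw [neg_div, neg_neg]; positivity
    rw [← h1] at h3
    exact (pos_of_mul_pos_right h3 (by rw [hwim]; positivity)).le
  · rw [hwexp, hC]; ring

/-- The Stieltjes transform on the upper half plane in terms of the Lambert function. -/
theorem stieltjesTransform_eq_lambertW (hμ : ∀ᵐ x ∂μ, 0 ≤ x)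
    (h : ∀ r, 0 < r → (1 + stieltjesInv μ r) * Real.log (1 + stieltjesInv μ r) = r)
    {z : ℂ} (hz : 0 < z.im) :
    stieltjesTransform μ z = -1 - 1 / (z * lambertW (-z⁻¹)) ∧
      stieltjesTransform μ z = -1 + Complex.exp (lambertW (-z⁻¹)) := by
  obtain ⟨w, hw, hwz, hS⟩ := exists_mem_lambertUpper_stieltjesTransform hμ h hz
  rw [← hwz, lambertW_mul_exp hw]
  refine ⟨?_, hS⟩
  have hz0 : z ≠ 0 := fun h0 => by rw [h0] at hz; exact lt_irrefl _ hz
  have hw0 : w ≠ 0 := by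
    rintro rfl
    rw [zero_mul, eq_comm, neg_eq_zero, inv_eq_zero] at hwz
    exact hz0 hwz
  rw [hS, sub_eq_add_neg, add_right_inj, ← one_div_neg_eq_neg_one_div, eq_div_iff
    (neg_ne_zero.mpr (mul_ne_zero hz0 hw0))]
  calc Complex.exp w * -(z * w) = -(z * (w * Complex.exp w)) := by ring
    _ = 1 := by rw [hwz]; field_simp

end Continuation

/-! ### Stieltjes inversion -/

section Inversion

variable {μ : Measure ℝ} [IsProbabilityMeasure μ]

theorem integral_mul_poissonKernel (h : ℝ → ℝ) {ε : ℝ} (hε : 0 < ε) (t : ℝ) :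
    ∫ x, h x * (ε / ((t - x) ^ 2 + ε ^ 2)) = ∫ u, h (t + ε * u) * (1 + u ^ 2)⁻¹ := by
  have h1 : ∀ u : ℝ, h (t + ε * u) * (1 + u ^ 2)⁻¹
      = (fun y => ε * (h (t + y) * (ε / ((t - (t + y)) ^ 2 + ε ^ 2)))) (ε * u) := by
    intro u
    have h2 : (t - (t + ε * u)) ^ 2 + ε ^ 2 = ε ^ 2 * (1 + u ^ 2) := by ring
    have h3 : (0 : ℝ) < 1 + u ^ 2 := by positivity
    simp only [h2]
    field_simp
  rw [integral_congr_ae (Eventually.of_forall h1), Measure.integral_comp_mul_left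
    (fun y => ε * (h (t + y) * (ε / ((t - (t + y)) ^ 2 + ε ^ 2)))), integral_const_mul,
    integral_add_left_eq_self (fun x => h x * (ε / ((t - x) ^ 2 + ε ^ 2))) t,
    abs_of_pos (inv_pos.mpr hε), smul_eq_mul, inv_mul_cancel_left₀ hε.ne']

/-- By Fubini, `∫ h(x) Im S(x + i ε) dx` averages `h` over Poisson kernels of width `ε`. -/
theorem integral_mul_im_stieltjesTransform {h : ℝ → ℝ} (hc : Continuous h)
    (hs : HasCompactSupport h) {ε : ℝ} (hε : 0 < ε) :
    ∫ x : ℝ, h x * (stieltjesTransform μ (x + ε * Complex.I)).im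
      = ∫ z : ℝ × ℝ, h (z.1 + ε * z.2) * (1 + z.2 ^ 2)⁻¹ ∂(μ.prod volume) := by
  obtain ⟨M, hM⟩ := hs.exists_bound_of_continuous hc
  have h1 : ∀ x : ℝ, h x * (stieltjesTransform μ (x + ε * Complex.I)).im
      = ∫ t, h x * (ε / ((t - x) ^ 2 + ε ^ 2)) ∂μ := by
    intro x
    rw [im_stieltjesTransform (by simpa using hε.ne'), integral_const_mul]
    simp
  simp_rw [h1]
  rw [integral_integral_swap]
  · simp_rw [integral_mul_poissonKernel h hε]
    rw [integral_prod (fun z : ℝ × ℝ => h (z.1 + ε * z.2) * (1 + z.2 ^ 2)⁻¹)]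
    refine Integrable.mono' ((integrable_const (μ := μ) M).mul_prod integrable_inv_one_add_sq)
      (Continuous.aestronglyMeasurable ?_) (Eventually.of_forall fun z => ?_)
    · exact (hc.comp (by fun_prop)).mul
        (Continuous.inv₀ (by fun_prop) fun z => by positivity)
    · rw [norm_mul, norm_inv, Real.norm_of_nonneg (by positivity : (0 : ℝ) ≤ 1 + z.2 ^ 2)]
      exact mul_le_mul_of_nonneg_right (hM _) (by positivity)
  · have hint : Integrable h volume := hc.integrable_of_hasCompactSupport hs
    refine Integrable.mono' (hint.norm.mul_prod (integrable_const (μ := μ) ε⁻¹))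
      (Continuous.aestronglyMeasurable ?_) (Eventually.of_forall fun z => ?_)
    · exact (hc.comp continuous_fst).mul
        (Continuous.div₀ (by fun_prop) (by fun_prop) fun z => by positivity)
    · simp only [Function.uncurry]
      rw [norm_mul, Real.norm_of_nonneg (by positivity : (0 : ℝ) ≤ ε / ((z.2 - z.1) ^ 2 + ε ^ 2))]
      refine mul_le_mul_of_nonneg_left ?_ (norm_nonneg _)
      rw [div_le_iff₀ (by positivity), inv_mul_eq_div, le_div_iff₀ hε]
      nlinarith [sq_nonneg (z.2 - z.1)]

theorem tendsto_integral_mul_im_stieltjesTransform {h : ℝ → ℝ} (hc : Continuous h)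
    (hs : HasCompactSupport h) :
    Tendsto (fun ε : ℝ => ∫ x : ℝ, h x * (stieltjesTransform μ (x + ε * Complex.I)).im)
      (𝓝[>] 0) (𝓝 (Real.pi * ∫ x, h x ∂μ)) := by
  obtain ⟨M, hM⟩ := hs.exists_bound_of_continuous hc
  have hlim : Real.pi * ∫ x, h x ∂μ
      = ∫ z : ℝ × ℝ, h z.1 * (1 + z.2 ^ 2)⁻¹ ∂(μ.prod volume) := by
    rw [integral_prod_mul h (fun u : ℝ => (1 + u ^ 2)⁻¹), integral_univ_inv_one_add_sq, mul_comm]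
  rw [hlim]
  refine Tendsto.congr' (f₁ := fun ε : ℝ =>
    ∫ z : ℝ × ℝ, h (z.1 + ε * z.2) * (1 + z.2 ^ 2)⁻¹ ∂(μ.prod volume)) ?_ ?_
  · filter_upwards [self_mem_nhdsWithin] with ε hε
    exact (integral_mul_im_stieltjesTransform hc hs hε).symm
  · refine tendsto_integral_filter_of_dominated_convergence
      (fun z : ℝ × ℝ => M * (1 + z.2 ^ 2)⁻¹) ?_ ?_
      ((integrable_const (μ := μ) M).mul_prod integrable_inv_one_add_sq) ?_
    · refine Eventually.of_forall fun ε => Continuous.aestronglyMeasurable ?_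
      exact (hc.comp (by fun_prop)).mul
        (Continuous.inv₀ (by fun_prop) fun z => by positivity)
    · refine Eventually.of_forall fun ε => Eventually.of_forall fun z => ?_
      rw [norm_mul, norm_inv, Real.norm_of_nonneg (by positivity : (0 : ℝ) ≤ 1 + z.2 ^ 2)]
      exact mul_le_mul_of_nonneg_right (hM _) (by positivity)
    · refine Eventually.of_forall fun z => Tendsto.mul_const _ ?_
      have : Continuous fun ε : ℝ => h (z.1 + ε * z.2) := hc.comp (by fun_prop)
      exact (this.tendsto' 0 _ (by simp)).mono_left nhdsWithin_le_nhds

end Inversion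

/-! ### The density -/

/-- The density of the limit law, `Im (1 + S(x)) / π` with the boundary value of `S` from the upper
half plane; the point `x = 0` gets the value `0`. -/
noncomputable def lambertDensity (x : ℝ) : ℝ :=
  (Complex.exp (lambertW (-(x : ℂ)⁻¹))).im / Real.pi

section Density

/-- Every point of the open upper half plane is `-1 / z` for another one, so the Stieltjes
transform makes `w ↦ w e ^ w` map `lambertUpper` onto the closed upper half plane. -/
theorem mem_image_lambertUpper {S : ℂ → ℂ}
    (hS : ∀ z : ℂ, 0 < z.im → ∃ w ∈ lambertUpper, w * Complex.exp w = -z⁻¹ ∧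
      S z = -1 + Complex.exp w) {ζ : ℂ} (hζ : 0 ≤ ζ.im) :
    ζ ∈ (fun w : ℂ => w * Complex.exp w) '' lambertUpper := by
  have h1 : {ζ : ℂ | 0 < ζ.im} ⊆ (fun w : ℂ => w * Complex.exp w) '' lambertUpper := by
    intro ζ hζ
    have hζ : 0 < ζ.im := hζ
    have h0 : 0 < Complex.normSq ζ :=
      Complex.normSq_pos.mpr fun h0 => by rw [h0] at hζ; exact lt_irrefl _ hζ
    obtain ⟨w, hw, hwz, -⟩ := hS (-ζ⁻¹) (by
      rw [Complex.neg_im, Complex.inv_im, neg_div, neg_neg]; positivity)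
    exact ⟨w, hw, hwz.trans (by rw [inv_neg, inv_inv, neg_neg])⟩
  have h2 := closure_minimal h1 continuousOn_lambertW.2
  rw [Complex.closure_setOfPred_lt_im] at h2
  exact h2 hζ

variable (hW : ∀ ζ : ℂ, 0 ≤ ζ.im → ζ ∈ (fun w : ℂ => w * Complex.exp w) '' lambertUpper)

include hW

theorem lambertW_mem_lambertUpper {ζ : ℂ} (hζ : 0 ≤ ζ.im) :
    lambertW ζ ∈ lambertUpper ∧ lambertW ζ * Complex.exp (lambertW ζ) = ζ := by
  obtain ⟨w, hw, rfl⟩ := hW ζ hζ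
  simp only [lambertW_mul_exp hw]
  exact ⟨hw, trivial⟩

theorem lambertDensity_nonneg (x : ℝ) : 0 ≤ lambertDensity x := by
  obtain ⟨hw, -⟩ := lambertW_mem_lambertUpper hW (ζ := -(x : ℂ)⁻¹) (by simp)
  rw [lambertDensity, Complex.exp_im]
  have := Real.sin_nonneg_of_nonneg_of_le_pi hw.1 hw.2.1
  positivity

theorem lambertDensity_pos {x : ℝ} (h0 : 0 < x) (h1 : x < Real.exp 1) :
    0 < lambertDensity x := by
  obtain ⟨hw, hwx⟩ := lambertW_mem_lambertUpper hW (ζ := -(x : ℂ)⁻¹) (by simp)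
  rw [lambertDensity, Complex.exp_im]
  set w := lambertW (-(x : ℂ)⁻¹)
  have him : 0 < w.im := by
    refine lt_of_le_of_ne hw.1 fun h => ?_
    have hre := congrArg Complex.re hwx
    rw [Complex.mul_re, Complex.exp_re, Complex.exp_im, ← h, Real.cos_zero, Real.sin_zero,
      ← Complex.ofReal_inv, Complex.neg_re, Complex.ofReal_re] at hre
    -- `ξ e ^ ξ` has the minimum `-1 / e`
    have h2 := Real.add_one_le_exp (-w.re - 1)
    have h3 : Real.exp (-w.re - 1) * Real.exp w.re = (Real.exp 1)⁻¹ := by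
      rw [← Real.exp_add, ← Real.exp_neg]
      ring_nf
    have h4 := mul_le_mul_of_nonneg_right h2 (Real.exp_pos w.re).le
    have h5 : (Real.exp 1)⁻¹ < x⁻¹ := inv_strictAnti₀ h0 h1
    linarith
  have := Real.sin_pos_of_pos_of_lt_pi him (lambertUpper_im_lt_pi hw)
  positivity

omit hW in
theorem lambertDensity_eq_zero {x : ℝ} (hx : x ≤ 0 ∨ Real.exp 1 ≤ x) :
    lambertDensity x = 0 := by
  have hx' : -(Real.exp 1)⁻¹ ≤ -x⁻¹ := by
    rw [neg_le_neg_iff]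
    rcases hx with hx | hx
    · exact (inv_nonpos.mpr hx).trans (by positivity)
    · exact inv_anti₀ (Real.exp_pos 1) hx
  obtain ⟨ξ, hξ, hξx⟩ : ∃ ξ ∈ Set.Icc (-1 : ℝ) |x⁻¹|, ξ * Real.exp ξ = -x⁻¹ := by
    refine intermediate_value_Icc (f := fun ξ : ℝ => ξ * Real.exp ξ)
      (by linarith [abs_nonneg x⁻¹]) (by fun_prop) ⟨?_, ?_⟩
    · rwa [Real.exp_neg, neg_one_mul]
    · have h1 : 1 ≤ Real.exp |x⁻¹| := Real.one_le_exp (abs_nonneg _)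
      exact (neg_le_abs _).trans (le_mul_of_one_le_right (abs_nonneg _) h1)
  have hmem : (ξ : ℂ) ∈ lambertUpper := by
    refine ⟨by simp, by simpa using Real.pi_pos.le, ?_⟩
    simp only [Complex.ofReal_re, Complex.ofReal_im, Real.sinc_zero, Real.cos_zero]
    linarith [hξ.1]
  have hval : -(x : ℂ)⁻¹ = (ξ : ℂ) * Complex.exp ξ := by
    rw [← Complex.ofReal_exp, ← Complex.ofReal_mul, hξx]
    push_cast
    rfl
  rw [lambertDensity, hval, lambertW_mul_exp hmem, Complex.exp_ofReal_im, zero_div]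

theorem tsupport_lambertDensity : tsupport lambertDensity = Set.Icc 0 (Real.exp 1) := by
  have : Function.support lambertDensity = Set.Ioo 0 (Real.exp 1) := by
    ext x
    rw [Function.mem_support]
    constructor
    · intro h
      by_contra hx
      refine h (lambertDensity_eq_zero ?_)
      rw [Set.mem_Ioo, not_and_or, not_lt, not_lt] at hx
      exact hx
    · exact fun h => (lambertDensity_pos hW h.1 h.2).ne'
  rw [tsupport, this, closure_Ioo (Real.exp_pos 1).ne]

theorem continuousWithinAt_exp_lambertW {z : ℂ} (hz0 : z ≠ 0) (hz : 0 ≤ z.im) :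
    ContinuousWithinAt (fun z => Complex.exp (lambertW (-z⁻¹))) {z | 0 ≤ z.im} z := by
  have hmaps : ∀ z : ℂ, 0 ≤ z.im → 0 ≤ (-z⁻¹).im := fun z hz => by
    rw [Complex.neg_im, Complex.inv_im, neg_div, neg_neg]
    exact div_nonneg hz (Complex.normSq_nonneg z)
  refine Complex.continuous_exp.continuousAt.comp_continuousWithinAt ?_
  refine ContinuousWithinAt.comp (t := (fun w : ℂ => w * Complex.exp w) '' lambertUpper)
    (continuousOn_lambertW.1 _ (hW _ (hmaps z hz)))
    (continuousAt_inv₀ hz0).neg.continuousWithinAt fun z hz => hW _ (hmaps z hz)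

theorem continuousOn_lambertDensity : ContinuousOn lambertDensity {0}ᶜ := by
  intro x hx
  have h1 := continuousWithinAt_exp_lambertW hW (z := (x : ℂ))
    (Complex.ofReal_ne_zero.mpr hx) (by simp)
  have h2 : ContinuousWithinAt (fun x : ℝ => Complex.exp (lambertW (-(x : ℂ)⁻¹))) {0}ᶜ x :=
    ContinuousWithinAt.comp (f := fun x : ℝ => (x : ℂ)) h1
      Complex.continuous_ofReal.continuousWithinAt fun y _ => by simp
  exact (Complex.continuous_im.continuousAt.comp_continuousWithinAt h2).div_const _

theorem norm_mul_norm_exp_lambertW_le {z : ℂ} (hz : 0 ≤ z.im) (hz0 : z ≠ 0) :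
    ‖z‖ * ‖Complex.exp (lambertW (-z⁻¹))‖ ≤ 1 + Real.exp 1 * ‖z‖ := by
  obtain ⟨-, hwz⟩ := lambertW_mem_lambertUpper hW (ζ := -z⁻¹) (by
    rw [Complex.neg_im, Complex.inv_im, neg_div, neg_neg]
    exact div_nonneg hz (Complex.normSq_nonneg z))
  set w := lambertW (-z⁻¹)
  have h1 : ‖w‖ * (‖z‖ * ‖Complex.exp w‖) = 1 := by
    have := congrArg norm hwz
    rw [norm_mul, norm_neg, norm_inv] at this
    rw [mul_left_comm, this, mul_inv_cancel₀ (norm_ne_zero_iff.mpr hz0)]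
  have h0 := norm_nonneg z
  rcases le_total 1 ‖w‖ with h | h
  · have : ‖z‖ * ‖Complex.exp w‖ ≤ 1 := by
      rw [← h1]
      exact le_mul_of_one_le_left (by positivity) h
    have := mul_nonneg (Real.exp_pos 1).le h0
    linarith
  · have : ‖Complex.exp w‖ ≤ Real.exp 1 :=
      (Complex.norm_exp_le_exp_norm w).trans (Real.exp_le_exp.mpr h)
    have := mul_le_mul_of_nonneg_left this h0
    linarith

theorem min_abs_one_mul_abs_im_exp_lambertW_le {x ε : ℝ} (hε : 0 ≤ ε) (hε1 : ε ≤ 1) (hx : x ≠ 0) :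
    min |x| 1 * |(Complex.exp (lambertW (-(x + ε * Complex.I : ℂ)⁻¹))).im|
      ≤ 1 + Real.exp 1 * (|x| + 1) := by
  have hre : (x + ε * Complex.I : ℂ).re = x := by simp
  have him : (x + ε * Complex.I : ℂ).im = ε := by simp
  have hz0 : (x + ε * Complex.I : ℂ) ≠ 0 := fun h => hx (by rw [← hre, h, Complex.zero_re])
  have h1 := norm_mul_norm_exp_lambertW_le hW (him.symm ▸ hε) hz0
  have h2 : |x| ≤ ‖(x + ε * Complex.I : ℂ)‖ := by
    simpa only [hre] using Complex.abs_re_le_norm (x + ε * Complex.I : ℂ)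
  have h3 : ‖(x + ε * Complex.I : ℂ)‖ ≤ |x| + 1 := by
    refine (norm_add_le _ _).trans ?_
    rw [norm_mul, Complex.norm_I, mul_one, Complex.norm_real, Complex.norm_real, Real.norm_eq_abs,
      Real.norm_of_nonneg hε]
    linarith
  calc _ ≤ ‖(x + ε * Complex.I : ℂ)‖ * ‖Complex.exp (lambertW (-(x + ε * Complex.I : ℂ)⁻¹))‖ :=
        mul_le_mul ((min_le_left _ _).trans h2) (Complex.abs_im_le_norm _) (abs_nonneg _)
          (norm_nonneg _)
    _ ≤ _ := h1
    _ ≤ _ := by gcongr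

theorem min_abs_one_mul_lambertDensity_le (x : ℝ) :
    min |x| 1 * lambertDensity x ≤ 1 + Real.exp 1 * (|x| + 1) := by
  rcases eq_or_ne x 0 with rfl | hx
  · simp; positivity
  have h1 := min_abs_one_mul_abs_im_exp_lambertW_le hW le_rfl zero_le_one hx
  rw [Complex.ofReal_zero, zero_mul, add_zero] at h1
  refine le_trans (mul_le_mul_of_nonneg_left ?_ (by positivity)) h1
  refine (div_le_div_of_nonneg_right (le_abs_self _) Real.pi_pos.le).trans ?_
  exact div_le_self (abs_nonneg _) (by linarith [Real.pi_gt_three])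

theorem integrable_min_abs_one_mul_lambertDensity :
    Integrable fun x => min |x| 1 * lambertDensity x := by
  have hmeas : Measurable fun x => min |x| 1 * lambertDensity x :=
    (Measurable.min (by fun_prop) measurable_const).mul
      (measurable_of_continuousOn_compl_singleton 0 (continuousOn_lambertDensity hW))
  have hsub : Function.support (fun x => min |x| 1 * lambertDensity x)
      ⊆ Set.Icc 0 (Real.exp 1) := by
    rw [← tsupport_lambertDensity hW]
    exact (Function.support_mul_subset_right _ _).trans (subset_tsupport _)
  rw [← integrableOn_iff_integrable_of_support_subset hsub]
  refine Measure.integrableOn_of_bounded (M := 1 + Real.exp 1 * (Real.exp 1 + 1))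
    measure_Icc_lt_top.ne hmeas.aestronglyMeasurable ?_
  filter_upwards [ae_restrict_mem measurableSet_Icc] with x hx
  have := lambertDensity_nonneg hW x
  rw [Real.norm_of_nonneg (by positivity)]
  refine (min_abs_one_mul_lambertDensity_le hW x).trans ?_
  rw [abs_of_nonneg hx.1]
  have := hx.2
  gcongr

end Density

section Identification

variable {μ : Measure ℝ} [IsProbabilityMeasure μ]

/-- An atom of mass `a` at `0` would force `c = 1 + S(-1 / r) ≥ 1 + a r`, against
`c log c = r`. -/
theorem measure_singleton_zero
    (h : ∀ r, 0 < r → (1 + stieltjesInv μ r) * Real.log (1 + stieltjesInv μ r) = r) :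
    μ {0} = 0 := by
  by_contra hne
  set a := μ.real {0} with ha
  have ha0 : 0 < a := ENNReal.toReal_pos hne (measure_ne_top _ _)
  have hlow : ∀ r, 0 < r → a * r ≤ stieltjesInv μ r := by
    intro r hr
    have h1 : ∫ x, ({0} : Set ℝ).indicator (fun _ => r) x ∂μ = a * r := by
      rw [integral_indicator_const r (measurableSet_singleton 0), smul_eq_mul]
    rw [← h1, stieltjesInv]
    refine integral_mono ((integrable_const r).indicator (measurableSet_singleton 0))
      (integrable_div_one_add_mul μ hr.le) fun x => ?_
    by_cases hx : x = 0
    · simp [hx]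
    · have : 0 ≤ max x 0 := le_max_right _ _
      rw [Set.indicator_of_notMem (by simpa using hx)]
      positivity
  set r := Real.exp a⁻¹ / a with hr
  have hr0 : 0 < r := by positivity
  have h1 := hlow r hr0
  have h2 : Real.exp a⁻¹ < 1 + stieltjesInv μ r := by
    have : a * r = Real.exp a⁻¹ := by rw [hr]; field_simp
    linarith
  have h3 : a⁻¹ < Real.log (1 + stieltjesInv μ r) :=
    (Real.lt_log_iff_exp_lt ((Real.exp_pos _).trans h2)).mpr h2
  have h4 := h r hr0
  have h5 : r ≤ a⁻¹ * stieltjesInv μ r := by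
    rw [inv_mul_eq_div, le_div_iff₀ ha0, mul_comm]
    exact h1
  have h6 : a⁻¹ * (1 + stieltjesInv μ r)
      < Real.log (1 + stieltjesInv μ r) * (1 + stieltjesInv μ r) :=
    mul_lt_mul_of_pos_right h3 ((Real.exp_pos _).trans h2)
  have h7 : 0 < a⁻¹ := by positivity
  linarith

/-- Boundary values of the Stieltjes transform tested against `g(x) min(|x|, 1)`; the weight keeps
the integrands bounded near `0`. -/
theorem integral_min_abs_one_mul_eq
    (hS : ∀ z : ℂ, 0 < z.im → ∃ w ∈ lambertUpper, w * Complex.exp w = -z⁻¹ ∧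
      stieltjesTransform μ z = -1 + Complex.exp w)
    {g : ℝ → ℝ} (hc : Continuous g) (hs : HasCompactSupport g) :
    ∫ x, g x * min |x| 1 ∂μ = ∫ x, g x * min |x| 1 * lambertDensity x := by
  have hW := fun (ζ : ℂ) (hζ : 0 ≤ ζ.im) => mem_image_lambertUpper hS hζ
  have hval : ∀ z : ℂ, 0 < z.im →
      (stieltjesTransform μ z).im = (Complex.exp (lambertW (-z⁻¹))).im := by
    intro z hz
    obtain ⟨w, hw, hwz, hSz⟩ := hS z hz
    rw [hSz, ← hwz, lambertW_mul_exp hw]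
    simp
  have hpc : Continuous fun x => g x * min |x| 1 := hc.mul (continuous_abs.min continuous_const)
  have h1 := tendsto_integral_mul_im_stieltjesTransform (μ := μ) hpc hs.mul_right
  have h2 : Tendsto (fun ε : ℝ => ∫ x : ℝ, g x * min |x| 1 *
      (stieltjesTransform μ (x + ε * Complex.I)).im) (𝓝[>] 0)
      (𝓝 (∫ x : ℝ, g x * min |x| 1 * (Real.pi * lambertDensity x))) := by
    refine tendsto_integral_filter_of_dominated_convergence
      (fun x => |g x| * (1 + Real.exp 1 * (|x| + 1))) ?_ ?_ ?_ ?_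
    · filter_upwards [self_mem_nhdsWithin] with ε hε
      refine Continuous.aestronglyMeasurable (hpc.mul (Complex.continuous_im.comp ?_))
      rw [continuous_iff_continuousAt]
      intro x
      have hne : ∀ t ∈ Set.univ, ((t : ℝ) : ℂ) ≠ x + ε * Complex.I := by
        intro t _ ht
        have := congrArg Complex.im ht
        have hε : 0 < ε := hε
        simp at this
        exact hε.ne this
      exact ContinuousAt.comp (f := fun x : ℝ => (x + ε * Complex.I : ℂ))
        (differentiableAt_stieltjesTransform isClosed_univ (by simp) hne).continuousAt
        (by fun_prop)
    · filter_upwards [Ioo_mem_nhdsGT one_pos] with ε hε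
      filter_upwards [compl_mem_ae_iff.mpr (Real.volume_singleton (a := 0))] with x hx
      have h0 : (0 : ℝ) ≤ min |x| 1 := by positivity
      rw [hval _ (by simpa using hε.1), norm_mul, norm_mul, Real.norm_of_nonneg h0,
        Real.norm_eq_abs, Real.norm_eq_abs, mul_assoc]
      exact mul_le_mul_of_nonneg_left
        (min_abs_one_mul_abs_im_exp_lambertW_le hW hε.1.le hε.2.le hx) (abs_nonneg _)
    · refine Continuous.integrable_of_hasCompactSupport
        (hc.abs.mul (by fun_prop)) (HasCompactSupport.mul_right ?_)
      exact hs.comp_left (g := fun y : ℝ => |y|) abs_zero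
    · filter_upwards [compl_mem_ae_iff.mpr (Real.volume_singleton (a := 0))] with x hx
      refine Tendsto.const_mul _ ?_
      have h3 := continuousWithinAt_exp_lambertW hW (z := (x : ℂ))
        (Complex.ofReal_ne_zero.mpr hx) (by simp)
      have h4 : Tendsto (fun ε : ℝ => (x + ε * Complex.I : ℂ)) (𝓝[>] 0)
          (𝓝[{z | 0 ≤ z.im}] (x : ℂ)) := by
        refine tendsto_nhdsWithin_iff.mpr ⟨?_, ?_⟩
        · have : Continuous fun ε : ℝ => (x + ε * Complex.I : ℂ) := by fun_prop
          exact (this.tendsto' 0 _ (by simp)).mono_left nhdsWithin_le_nhds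
        · filter_upwards [self_mem_nhdsWithin] with ε hε
          have hε : 0 < ε := hε
          simpa using hε.le
      have h5 := (Complex.continuous_im.tendsto _).comp (h3.tendsto.comp h4)
      rw [lambertDensity, mul_div_cancel₀ _ Real.pi_ne_zero]
      refine h5.congr' ?_
      filter_upwards [self_mem_nhdsWithin] with ε hε
      exact (hval _ (by simpa using hε)).symm
  have h3 := tendsto_nhds_unique h1 h2
  have h4 : ∀ x, g x * min |x| 1 * (Real.pi * lambertDensity x)
      = Real.pi * (g x * min |x| 1 * lambertDensity x) := fun x => by ring
  simp_rw [h4] at h3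
  rw [integral_const_mul] at h3
  exact mul_left_cancel₀ Real.pi_ne_zero h3

theorem eq_withDensity_lambertDensity
    (hS : ∀ z : ℂ, 0 < z.im → ∃ w ∈ lambertUpper, w * Complex.exp w = -z⁻¹ ∧
      stieltjesTransform μ z = -1 + Complex.exp w)
    (h0 : μ {0} = 0) :
    μ = volume.withDensity fun x => ENNReal.ofReal (lambertDensity x) := by
  have hW := fun (ζ : ℂ) (hζ : 0 ≤ ζ.im) => mem_image_lambertUpper hS hζ
  set ν := volume.withDensity fun x => ENNReal.ofReal (lambertDensity x) with hν
  have hm : Measurable lambertDensity :=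
    measurable_of_continuousOn_compl_singleton 0 (continuousOn_lambertDensity hW)
  set q : ℝ → ENNReal := fun x => ENNReal.ofReal (min |x| 1) with hq
  have hqm : Measurable q := by fun_prop
  have hq0 : ∀ x, 0 ≤ min |x| (1 : ℝ) := fun x => by positivity
  have hνq : ν.withDensity q
      = volume.withDensity fun x => ENNReal.ofReal (min |x| 1 * lambertDensity x) := by
    rw [hν, ← withDensity_mul _ hm.ennreal_ofReal hqm]
    congr 1
    ext x
    rw [Pi.mul_apply, ENNReal.ofReal_mul (hq0 x), mul_comm]
  have : IsFiniteMeasure (ν.withDensity q) := by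
    rw [hνq]
    exact isFiniteMeasure_withDensity_ofReal
      (integrable_min_abs_one_mul_lambertDensity hW).hasFiniteIntegral
  have : IsFiniteMeasure (μ.withDensity q) := by
    refine isFiniteMeasure_withDensity_ofReal (Integrable.hasFiniteIntegral ?_)
    refine Integrable.of_bound (C := 1) (Measurable.aestronglyMeasurable (by fun_prop))
      (Eventually.of_forall fun x => ?_)
    rw [Real.norm_of_nonneg (hq0 x)]
    exact min_le_right _ _
  have key : μ.withDensity q = ν.withDensity q := by
    refine Measure.ext_of_integral_eq_on_compactlySupported fun g => ?_
    rw [hνq, integral_withDensity_eq_integral_toReal_smul hqm (by simp [hq]),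
      integral_withDensity_eq_integral_toReal_smul (by fun_prop)
        (Eventually.of_forall fun x => ENNReal.ofReal_lt_top)]
    refine ((integral_congr_ae (Eventually.of_forall fun x => ?_)).trans
      (integral_min_abs_one_mul_eq hS g.continuous g.hasCompactSupport)).trans
      (integral_congr_ae (Eventually.of_forall fun x => ?_))
    · simp only [hq, ENNReal.toReal_ofReal (hq0 x), smul_eq_mul]
      exact mul_comm _ _
    · simp only [ENNReal.toReal_ofReal (mul_nonneg (hq0 x) (lambertDensity_nonneg hW x)),
        smul_eq_mul]
      change g x * min |x| 1 * lambertDensity x = _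
      ring
  have hne : ∀ x ∈ ({0} : Set ℝ)ᶜ, q x ≠ 0 := by
    intro x hx
    have : 0 < |x| := abs_pos.mpr hx
    rw [hq, Ne, ENNReal.ofReal_eq_zero, not_le]
    positivity
  have hν0 : ν {0} = 0 := withDensity_absolutelyContinuous _ _ Real.volume_singleton
  have h1 := withDensity_inv_same (μ := μ) hqm
    (by filter_upwards [compl_mem_ae_iff.mpr h0] with x hx using hne x hx) (by simp [hq])
  have h2 := withDensity_inv_same (μ := ν) hqm
    (by filter_upwards [compl_mem_ae_iff.mpr hν0] with x hx using hne x hx) (by simp [hq])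
  rw [← h1, key, h2]

end Identification

/-! ### The R-transform -/

section RTransform

theorem one_sub_mem_slitPlane {z : ℂ} (hz : ‖z‖ < 1) : 1 - z ∈ Complex.slitPlane := by
  rw [sub_eq_add_neg]
  exact Complex.mem_slitPlane_of_norm_lt_one (by rwa [norm_neg])

/-- The singularity of `-1 / ((1 - z) log (1 - z)) - 1 / z` at `0` is removable: with
`g z = -log (1 - z) / z` and `h z = 1 / ((1 - z) g z)` the function is `(h z - h 0) / z`. -/
theorem exists_analyticOnNhd_eq_inv_mul_log_sub_inv :
    ∃ R : ℂ → ℂ, AnalyticOnNhd ℂ R (Metric.ball 0 1) ∧ ∀ z : ℂ, z ≠ 0 → ‖z‖ < 1 →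
      R z = -1 / ((1 - z) * Complex.log (1 - z)) - 1 / z := by
  set L : ℂ → ℂ := fun z => -Complex.log (1 - z) with hL
  have hball : Metric.ball (0 : ℂ) 1 ∈ 𝓝 0 := Metric.ball_mem_nhds 0 one_pos
  have hmem : ∀ z ∈ Metric.ball (0 : ℂ) 1, 1 - z ∈ Complex.slitPlane := fun z hz =>
    one_sub_mem_slitPlane (by simpa using hz)
  have hLdiff : DifferentiableOn ℂ L (Metric.ball 0 1) :=
    ((differentiableOn_id.const_sub (1 : ℂ)).clog hmem).neg
  have hL0 : L 0 = 0 := by simp [hL]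
  set g : ℂ → ℂ := dslope L 0 with hg
  have hgdiff : DifferentiableOn ℂ g (Metric.ball 0 1) :=
    (Complex.differentiableOn_dslope hball).mpr hLdiff
  have hgz : ∀ z, z ≠ 0 → g z = -Complex.log (1 - z) / z := by
    intro z hz
    rw [hg, dslope_of_ne _ hz, slope_def_field, hL0, sub_zero, sub_zero]
  have hg0 : g 0 = 1 := by
    rw [hg, dslope_same]
    have h1 : HasDerivAt (fun z : ℂ => 1 - z) (-1) 0 := by
      simpa using (hasDerivAt_id (0 : ℂ)).const_sub 1
    have h2 : HasDerivAt L (-(-1 / (1 - 0))) 0 := (h1.clog (by simp)).neg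
    rw [h2.deriv]
    simp
  have hgne : ∀ z ∈ Metric.ball (0 : ℂ) 1, g z ≠ 0 := by
    intro z hz h
    rcases eq_or_ne z 0 with rfl | hz0
    · rw [hg0] at h
      exact one_ne_zero h
    · rw [hgz z hz0, div_eq_zero_iff, or_iff_left hz0, neg_eq_zero] at h
      have h1 := Complex.exp_log (Complex.slitPlane_ne_zero (hmem z hz))
      rw [h, Complex.exp_zero] at h1
      exact hz0 (by linear_combination h1)
  set h : ℂ → ℂ := fun z => ((1 - z) * g z)⁻¹ with hh
  have hdiff : DifferentiableOn ℂ h (Metric.ball 0 1) :=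
    ((differentiableOn_id.const_sub (1 : ℂ)).mul hgdiff).inv fun z hz =>
      mul_ne_zero (Complex.slitPlane_ne_zero (hmem z hz)) (hgne z hz)
  refine ⟨dslope h 0, ((Complex.differentiableOn_dslope hball).mpr hdiff).analyticOnNhd
    Metric.isOpen_ball, fun z hz0 hz => ?_⟩
  have hz1 : z ∈ Metric.ball (0 : ℂ) 1 := by simpa using hz
  have hlog : Complex.log (1 - z) ≠ 0 := by
    intro h0
    apply hgne z hz1
    rw [hgz z hz0, h0, neg_zero, zero_div]
  have h1z : 1 - z ≠ 0 := Complex.slitPlane_ne_zero (hmem z hz1)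
  rw [dslope_of_ne _ hz0, slope_def_field, hh]
  simp only [hgz z hz0, hg0, sub_zero, mul_one, inv_one]
  field_simp

theorem eq_of_mul_log_eq {a b : ℝ} (ha : 1 ≤ a) (hb : 1 ≤ b)
    (h : a * Real.log a = b * Real.log b) : a = b := by
  have aux : ∀ a b : ℝ, 1 ≤ a → a < b → a * Real.log a < b * Real.log b := fun a b ha hab =>
    mul_lt_mul'' hab (Real.log_lt_log (by linarith) hab) (by linarith) (Real.log_nonneg ha)
  rcases lt_trichotomy a b with hab | hab | hab
  · exact absurd h (aux a b ha hab).ne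
  · exact hab
  · exact absurd h (aux b a hb hab).ne'

variable {μ : Measure ℝ} [IsProbabilityMeasure μ]

/-- For `μ` with bounded support, `ζ ↦ S(1 / ζ)` extends holomorphically to `0`. -/
theorem analyticAt_integral_div_mul_sub_one {b : ℝ} (hb : 0 < b) (hμ : ∀ᵐ x ∂μ, |x| ≤ b) :
    AnalyticAt ℂ (fun ζ : ℂ => ∫ x : ℝ, ζ / (ζ * x - 1) ∂μ) 0 := by
  have hlow : ∀ x : ℝ, |x| ≤ b → ∀ ζ ∈ Metric.ball (0 : ℂ) (2 * b)⁻¹,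
      1 / 2 ≤ ‖ζ * (x : ℂ) - 1‖ := by
    intro x hx ζ hζ
    rw [mem_ball_zero_iff] at hζ
    have h1 : ‖ζ * (x : ℂ)‖ ≤ 1 / 2 := by
      rw [norm_mul, Complex.norm_real, Real.norm_eq_abs]
      calc ‖ζ‖ * |x| ≤ (2 * b)⁻¹ * b := by gcongr
        _ = 1 / 2 := by field_simp
    have h2 := norm_sub_norm_le (1 : ℂ) (ζ * (x : ℂ))
    rw [norm_one, norm_sub_rev] at h2
    linarith
  have hdiff : DifferentiableOn ℂ (fun ζ : ℂ => ∫ x : ℝ, ζ / (ζ * x - 1) ∂μ)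
      (Metric.ball 0 (2 * b)⁻¹) := by
    intro ζ hζ
    refine (hasDerivAt_integral_of_dominated_loc_of_deriv_le (μ := μ)
      (F := fun (ζ : ℂ) (x : ℝ) => ζ / (ζ * x - 1))
      (F' := fun (ζ : ℂ) (x : ℝ) => -((ζ * x - 1) ^ 2)⁻¹)
      (bound := fun _ => ((1 / 2) ^ 2)⁻¹) (s := Metric.ball 0 (2 * b)⁻¹)
      (Metric.isOpen_ball.mem_nhds hζ) ?_ ?_ ?_ ?_ (integrable_const _)
      ?_).2.differentiableAt.differentiableWithinAt
    · exact Eventually.of_forall fun s => Measurable.aestronglyMeasurable (by fun_prop)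
    · refine Integrable.of_bound (Measurable.aestronglyMeasurable (by fun_prop))
        (‖ζ‖ / (1 / 2)) ?_
      filter_upwards [hμ] with x hx
      rw [norm_div]
      exact div_le_div_of_nonneg_left (norm_nonneg _) (by norm_num) (hlow x hx ζ hζ)
    · exact Measurable.aestronglyMeasurable (by fun_prop)
    · filter_upwards [hμ] with x hx s hs
      rw [norm_neg, norm_inv, norm_pow]
      exact inv_anti₀ (by norm_num) (pow_le_pow_left₀ (by norm_num) (hlow x hx s hs) 2)
    · filter_upwards [hμ] with x hx s hs
      have hne : s * (x : ℂ) - 1 ≠ 0 := by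
        rw [← norm_pos_iff]
        exact lt_of_lt_of_le (by norm_num) (hlow x hx s hs)
      have h1 : HasDerivAt (fun s : ℂ => s * (x : ℂ) - 1) (x : ℂ) s := by
        simpa using ((hasDerivAt_id s).mul_const (x : ℂ)).sub_const 1
      refine ((hasDerivAt_id s).div h1 hne).congr_deriv ?_
      simp only [id]
      field_simp
      ring
  exact hdiff.analyticAt (Metric.ball_mem_nhds 0 (by positivity))

omit [IsProbabilityMeasure μ] in
theorem stieltjesTransform_inv {ζ : ℂ} (hζ : ζ ≠ 0) :
    stieltjesTransform μ ζ⁻¹ = ∫ x : ℝ, ζ / (ζ * x - 1) ∂μ := by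
  rw [stieltjesTransform]
  congr 1
  ext x
  rw [← inv_div, sub_div, mul_div_cancel_left₀ _ hζ, one_div]

/-- The functional equation `S(-1 / ((1 - z) log (1 - z))) = -z`. For real `z < 0` both `1 + S` and
`1 - z` solve `c log c = (1 - z) log (1 - z)` in `[1, ∞)`; then both sides being holomorphic in `z`
at `0` suffices. -/
theorem eventually_stieltjesTransform_eq_neg {b : ℝ} (hb : 0 < b) (hμ : ∀ᵐ x ∂μ, |x| ≤ b)
    (hμ0 : ∀ᵐ x ∂μ, 0 ≤ x)
    (h : ∀ r, 0 < r → (1 + stieltjesInv μ r) * Real.log (1 + stieltjesInv μ r) = r) :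
    ∀ᶠ z in 𝓝[≠] (0 : ℂ),
      stieltjesTransform μ (-1 / ((1 - z) * Complex.log (1 - z))) = -z := by
  set k : ℂ → ℂ := fun z => -((1 - z) * Complex.log (1 - z)) with hk
  have hk0 : k 0 = 0 := by simp [hk]
  have hkan : AnalyticAt ℂ k 0 :=
    ((analyticAt_const.sub analyticAt_id).mul
      ((analyticAt_const.sub analyticAt_id).clog (by simp))).neg
  have hinv : ∀ z, -1 / ((1 - z) * Complex.log (1 - z)) = (k z)⁻¹ := fun z => by
    rw [hk, inv_neg, neg_div, one_div]
  have hFan : AnalyticAt ℂ (fun z => ∫ x : ℝ, k z / (k z * x - 1) ∂μ) 0 :=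
    AnalyticAt.fun_comp (g := fun ζ : ℂ => ∫ x : ℝ, ζ / (ζ * x - 1) ∂μ)
      (hk0.symm ▸ analyticAt_integral_div_mul_sub_one hb hμ) hkan
  have hfreq : ∃ᶠ z in 𝓝[≠] (0 : ℂ), ∫ x : ℝ, k z / (k z * x - 1) ∂μ = -z := by
    have htend : Tendsto (fun s : ℝ => (s : ℂ)) (𝓝[<] 0) (𝓝[≠] 0) := by
      refine tendsto_nhdsWithin_iff.mpr ⟨?_, ?_⟩
      · exact (Complex.continuous_ofReal.tendsto' 0 0 (by simp)).mono_left nhdsWithin_le_nhds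
      · filter_upwards [self_mem_nhdsWithin] with s hs
        simpa using (ne_of_lt hs)
    refine htend.frequently (Eventually.frequently ?_)
    filter_upwards [self_mem_nhdsWithin] with s hs
    have hs : s < 0 := hs
    have hr : 0 < (1 - s) * Real.log (1 - s) :=
      mul_pos (by linarith) (Real.log_pos (by linarith))
    have hks : k s = ((-((1 - s) * Real.log (1 - s)) : ℝ) : ℂ) := by
      rw [hk]
      push_cast
      rw [Complex.ofReal_log (by linarith)]
      push_cast
      rfl
    have hne : k s ≠ 0 := by
      rw [hks, Complex.ofReal_ne_zero]
      exact (neg_neg_of_pos hr).ne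
    rw [← stieltjesTransform_inv hne, hks, Complex.ofReal_neg, inv_neg,
      stieltjesTransform_neg_inv hr hμ0]
    have h1 := eq_of_mul_log_eq (by linarith [stieltjesInv_nonneg μ hr.le]) (by linarith) (h _ hr)
    rw [← Complex.ofReal_neg]
    congr 1
    linarith
  have hev := (hFan.frequently_eq_iff_eventually_eq analyticAt_id.neg).mp hfreq
  filter_upwards [nhdsWithin_le_nhds hev, self_mem_nhdsWithin,
    nhdsWithin_le_nhds (Metric.ball_mem_nhds (0 : ℂ) one_pos)] with z hz hz0 hz1
  have h1z := one_sub_mem_slitPlane (z := z) (by simpa using hz1)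
  have hne : k z ≠ 0 := by
    refine neg_ne_zero.mpr (mul_ne_zero (Complex.slitPlane_ne_zero h1z) fun h0 => hz0 ?_)
    have h1 := Complex.exp_log (Complex.slitPlane_ne_zero h1z)
    rw [h0, Complex.exp_zero] at h1
    change z = 0
    linear_combination h1
  rw [hinv, stieltjesTransform_inv hne]
  exact hz

end RTransform

theorem corollary1p2 {Ω : Type*} [MeasurableSpace Ω] (P : Measure Ω) [IsProbabilityMeasure P]
    (X : ℕ → ℕ → Ω → ℂ) (hX : IsTriangularIIDArray P X)
    (μ₀ : ProbabilityMeasure ℝ)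
    (hμ₀ : ∀ᵐ ω ∂P, Tendsto (fun n : ℕ => empiricalDistribution X (n + 1) ω) atTop (𝓝 μ₀)) :
    (∃ f₀ : ℝ → ℝ, (∀ x, 0 ≤ f₀ x) ∧ ContinuousOn f₀ {0}ᶜ ∧
      tsupport f₀ = Set.Icc 0 (Real.exp 1) ∧
      (μ₀ : Measure ℝ) = volume.withDensity (fun x => ENNReal.ofReal (f₀ x))) ∧
    (∀ z : ℂ, 0 < z.im →
      stieltjesTransform (μ₀ : Measure ℝ) z = -1 - 1 / (z * lambertW (-z⁻¹)) ∧
      stieltjesTransform (μ₀ : Measure ℝ) z = -1 + Complex.exp (lambertW (-z⁻¹))) ∧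
    (∃ R : ℂ → ℂ, IsRTransformOnBall (μ₀ : Measure ℝ) R 1 ∧
      ∀ z : ℂ, z ≠ 0 → ‖z‖ < 1 →
        R z = -1 / ((1 - z) * Complex.log (1 - z)) - 1 / z) := by
  have hpos : ∀ᵐ x ∂(μ₀ : Measure ℝ), 0 ≤ x := by
    obtain ⟨ω, hω⟩ := hμ₀.exists
    filter_upwards [measure_eq_zero_iff_ae_notMem.mp (measure_Iio_zero_of_tendsto hω)] with x hx
    simpa using hx
  have heq : ∀ r, 0 < r → (1 + stieltjesInv (μ₀ : Measure ℝ) r) *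
      Real.log (1 + stieltjesInv (μ₀ : Measure ℝ) r) = r := fun r hr =>
    one_add_stieltjesInv_mul_log
      (fun r r' hr hr' => integral_logRatio_eq hX μ₀ hμ₀ hr hr') hr
  have hS := fun (z : ℂ) (hz : 0 < z.im) =>
    exists_mem_lambertUpper_stieltjesTransform hpos heq hz
  have hW := fun (ζ : ℂ) (hζ : 0 ≤ ζ.im) => mem_image_lambertUpper hS hζ
  have hdens := eq_withDensity_lambertDensity hS (measure_singleton_zero heq)
  have hIcc : ∀ᵐ x ∂(μ₀ : Measure ℝ), x ∈ Set.Icc 0 (Real.exp 1) := by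
    rw [hdens, ae_withDensity_iff (measurable_of_continuousOn_compl_singleton 0
      (continuousOn_lambertDensity hW)).ennreal_ofReal]
    refine Eventually.of_forall fun x hx => ?_
    rw [← tsupport_lambertDensity hW]
    refine subset_tsupport _ fun h0 => hx ?_
    rw [h0, ENNReal.ofReal_zero]
  refine ⟨⟨lambertDensity, lambertDensity_nonneg hW, continuousOn_lambertDensity hW,
    tsupport_lambertDensity hW, hdens⟩,
    fun z hz => stieltjesTransform_eq_lambertW hpos heq hz, ?_⟩
  obtain ⟨R, hR, hRz⟩ := exists_analyticOnNhd_eq_inv_mul_log_sub_inv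
  refine ⟨R, ⟨?_, hR, ?_⟩, hRz⟩
  · exact isCompact_Icc.of_isClosed_subset Measure.isClosed_support
      (Measure.support_subset_of_isClosed isClosed_Icc hIcc)
  · have habs : ∀ᵐ x ∂(μ₀ : Measure ℝ), |x| ≤ Real.exp 1 := by
      filter_upwards [hIcc] with x hx
      rw [abs_of_nonneg hx.1]
      exact hx.2
    filter_upwards [eventually_stieltjesTransform_eq_neg (Real.exp_pos 1) habs hpos heq,
      self_mem_nhdsWithin, nhdsWithin_le_nhds (Metric.ball_mem_nhds (0 : ℂ) one_pos)]
      with z hz hz0 hz1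
    rw [hRz z hz0 (by simpa using hz1), sub_add_cancel]
    exact hz
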